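/- Let $\mathbb{D}=\{x\in\mathbb{R}^2:\|x\|<1\}$, let $S^1=\partial\mathbb{D}$, let $L$ be one of the two open half circles $\{x\in S^1: x_2>0\}$, $\{x\in S^1: x_2<0\}$, let $m_1\ge 0$, $m_2\ge 1$ and $n\ge 0$ be integers. The vertical poles of the circle with centre $p$ and radius $r$ are the points $(p_1\pm r,p_2)$. Call a family of $n$ circles $C_1,\dots,C_n$, where $C_j$ has centre $c_j$ and radius $r_j>0$, admissible (for $L$) if, with $D=\{x\in\mathbb{D}: \|x-c_j\|>r_j \text{ for all } j\}$: (a) $c_j\in L$ and $c_j$ has non-zero first component; the circles $C_j$ are mutually disjoint; (b) for each $j$, $C_j\cap S^1$ consists of exactly two points, both in $\overline{D}$; exactly one vertical pole of $C_j$ lies in $\overline{D}$, and it is not on $S^1$; the first components of these three points (the marked points of $C_j$) are distinct; (c) for $i\ne j$, either all first components of marked points of $C_i$ are smaller than all those of $C_j$, or conversely; (d) $(\pm1,0)\in\overline{D}$, and $\pm1$ is not the first component of a marked point. For such a family let $$M=\Bigl\{(x,y_1,y_2)\in\mathbb{R}^2\times\mathbb{R}^{m_1+1}\times\mathbb{R}^{m_2+1}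 : 1-\|x\|^2=\|y_1\|^2,\ \prod_{j=1}^{n}\bigl(\|x-c_j\|^2-r_j^2\bigr)=\|y_2\|^2\Bigr\}$$ (an empty product is $1$) and let $f_0:M\to\mathbb{R}$ be $f_0(x,y_1,y_2)=x_1$. The Reeb space of $f_0$ is the quotient of $M$ that identifies two points when they lie in the same connected component of the same level set of $f_0$; its vertices are the classes that contain a singular point of $f_0$, that is, a point where the differential of $f_0$ vanishes on the tangent space of $M$. For $j_1,j_2\ge 0$ with $j_1+j_2=n$ let $G_{P,j_1,j_2}$ be the graph obtained from the path with vertices labelled $1,\dots,2n+2$ (consecutive labels being joined by an edge) by adding $n$ new vertices and $n$ new edges: for $1\le j\le j_1$ the $j$-th new vertex of a first group of $j_1$ is joined to the vertex labelled $2j+1$, and for $1\le j\le j_2$ the $j$-th new vertex of a second group of $j_2$ is joined to the vertex labelled $2j_1+2j$. Then: 1. For each admissible family of $n$ circles, $M$ is compact and its defining equations are non-singular (their differential is onto at each point of $M$). The Reeb space of $f_0$ has exactly $3n+2$ vertices and is, as a graph with these vertices, isomorphic to $G_{P,j_1,j_2}$ for some $j_1,j_2\ge0$ with $j_1+j_2=n$;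 that is, there is a homeomorphism onto the topological realization of $G_{P,j_1,j_2}$ that carries the set of vertices onto the set of vertices. 2. Conversely, for all $j_1,j_2\ge0$ with $j_1+j_2=n$ there is an admissible family of $n$ circles for which the Reeb graph of $f_0$ is isomorphic to $G_{P,j_1,j_2}$. -/

import Mathlib

/-! ### Reeb spaces -/

/-- Two points are equivalent when they lie in the same connected component of the same
level set of `c`. -/
def reebSetoid {X : Type*} [TopologicalSpace X] (c : X → ℝ) : Setoid X where
  r x y := c x = c y ∧ y ∈ connectedComponentIn (c ⁻¹' {c x}) x
  iseqv :=
    { refl := fun x => ⟨rfl, mem_connectedComponentIn (by simp)⟩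
      symm := by
        rintro x y ⟨h, hy⟩
        refine ⟨h.symm, ?_⟩
        rw [← h, ← connectedComponentIn_eq hy]
        exact mem_connectedComponentIn (by simp)
      trans := by
        rintro x y z ⟨h, hy⟩ ⟨h', hz⟩
        refine ⟨h.trans h', ?_⟩
        rw [← h] at hz
        rw [connectedComponentIn_eq hy]
        exact hz }

/-- The Reeb space of `c`, with the quotient topology. -/
def ReebSpace {X : Type*} [TopologicalSpace X] (c : X → ℝ) : Type _ :=
  Quotient (reebSetoid c)

instance instTopologicalSpaceReebSpace {X : Type*} [TopologicalSpace X] (c : X → ℝ) :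
    TopologicalSpace (ReebSpace c) :=
  inferInstanceAs (TopologicalSpace (Quotient (reebSetoid c)))

/-- The quotient map onto the Reeb space. -/
def reebMk {X : Type*} [TopologicalSpace X] (c : X → ℝ) (x : X) : ReebSpace c :=
  Quotient.mk (reebSetoid c) x

/-! ### Topological realization of a finite simple graph -/

/-- The geometric realization of a finite graph as a one-dimensional simplicial complex:
points of the standard simplex supported on one vertex or on the two ends of one edge. -/
def graphRealization {V : Type*} [Fintype V] (G : SimpleGraph V) : Set (V → ℝ) :=
  {w | w ∈ stdSimplex ℝ V ∧
    ∃ a b : V, (a = b ∨ G.Adj a b) ∧ ∀ u : V, u ≠ a → u ≠ b → w u = 0}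

/-- The points of the realization that are vertices of the graph. -/
def graphRealizationVertices {V : Type*} [Fintype V] [DecidableEq V] (G : SimpleGraph V) :
    Set (graphRealization G) :=
  {w | ∃ v : V, (w : V → ℝ) = Pi.single v 1}

/-- The Reeb space of `c`, with vertices the classes that contain a point of `S` (the set of
singular points of `c`), is a graph isomorphic to `G`: there is a homeomorphism onto the
realization of `G` that carries the vertex set onto the vertex set. -/
def ReebGraphIso {X : Type*} [TopologicalSpace X] (c : X → ℝ) (S : Set X)
    {V : Type*} [Fintype V] [DecidableEq V] (G : SimpleGraph V) : Prop :=
  ∃ φ : ReebSpace c ≃ₜ graphRealization G,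
    φ '' (reebMk c '' S) = graphRealizationVertices G

/-! ### Zero sets, tangent spaces and singular points -/

/-- `F = 0` is a non-singular system: the differential of `F` is onto at each zero. -/
def IsNonsingularZeroSet {E G : Type*} [NormedAddCommGroup E] [NormedSpace ℝ E]
    [NormedAddCommGroup G] [NormedSpace ℝ G] (F : E → G) : Prop :=
  ∀ z : E, F z = 0 → Function.Surjective (fderiv ℝ F z)

/-- `z` is a singular point of the restriction of `c` to the manifold `{F = 0}`: the
differential of `c` vanishes on the tangent space `ker dF_z`. -/
def IsSingularPointOn {E G : Type*} [NormedAddCommGroup E] [NormedSpace ℝ E]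
    [NormedAddCommGroup G] [NormedSpace ℝ G] (F : E → G) (c : E → ℝ) (z : E) : Prop :=
  ∀ w : E, fderiv ℝ F z w = 0 → fderiv ℝ c z w = 0

/-! ### Moment-like maps -/

/-- The space `ℝⁿ × ∏ᵢ ℝ^(m(i)+1)`. -/
abbrev MomentAmbient (n : ℕ) {I : Type*} (m : I → ℕ) : Type _ :=
  EuclideanSpace ℝ (Fin n) × ((i : I) → EuclideanSpace ℝ (Fin (m i + 1)))

/-- The map `(x, y) ↦ (∏_{j ∈ μ⁻¹(i)} f_j(x) - ‖y_i‖²)_i`. -/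
noncomputable def momentEq {n : ℕ} {J I : Type*} [Fintype J] [DecidableEq I]
    (f : J → EuclideanSpace ℝ (Fin n) → ℝ) (μ : J → I) (m : I → ℕ)
    (z : MomentAmbient n m) : I → ℝ :=
  fun i => (∏ j ∈ Finset.univ.filter (fun j => μ j = i), f j z.1) - ‖z.2 i‖ ^ 2

/-- The manifold on which the moment-like map is defined (with `U_D = ℝⁿ`): the zero set of
`momentEq`.  The moment-like map is `z ↦ z.1`. -/
def momentManifold {n : ℕ} {J I : Type*} [Fintype J] [DecidableEq I]
    (f : J → EuclideanSpace ℝ (Fin n) → ℝ) (μ : J → I) (m : I → ℕ) :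
    Set (MomentAmbient n m) :=
  {z | momentEq f μ m z = 0}

/-! ### The unit disk with circles added -/

/-- The two vertical poles of the circle with centre `p` and radius `r`. -/
def verticalPoles (p : EuclideanSpace ℝ (Fin 2)) (r : ℝ) : Set (EuclideanSpace ℝ (Fin 2)) :=
  {!₂[p 0 - r, p 1], !₂[p 0 + r, p 1]}

/-- The upper open half of the unit circle. -/
def upperArc : Set (EuclideanSpace ℝ (Fin 2)) := {x | ‖x‖ = 1 ∧ 0 < x 1}

/-- The lower open half of the unit circle. -/
def lowerArc : Set (EuclideanSpace ℝ (Fin 2)) := {x | ‖x‖ = 1 ∧ x 1 < 0}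

/-- The open unit disk with the added closed disks removed. -/
def diskRegion {n : ℕ} (c : Fin n → EuclideanSpace ℝ (Fin 2)) (r : Fin n → ℝ) :
    Set (EuclideanSpace ℝ (Fin 2)) :=
  {x | ‖x‖ < 1 ∧ ∀ j, r j < ‖x - c j‖}

/-- The points of the closed region on the `j`-th added circle that are either a vertical pole
of this circle or lie on the unit circle. -/
def markedPoints {n : ℕ} (c : Fin n → EuclideanSpace ℝ (Fin 2)) (r : Fin n → ℝ) (j : Fin n) :
    Set (EuclideanSpace ℝ (Fin 2)) :=
  {x | x ∈ closure (diskRegion c r) ∧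
    (x ∈ verticalPoles (c j) (r j) ∨ x ∈ Metric.sphere 0 1 ∩ Metric.sphere (c j) (r j))}

/-- The conditions on the added circles, with centres `c j` on the chosen half `L` of the unit
circle and radii `r j`. -/
structure IsAdmissible {n : ℕ} (L : Set (EuclideanSpace ℝ (Fin 2)))
    (c : Fin n → EuclideanSpace ℝ (Fin 2)) (r : Fin n → ℝ) : Prop where
  radius_pos : ∀ j, 0 < r j
  center_mem : ∀ j, c j ∈ L
  /-- No centre is a horizontal pole of the unit circle (vertical ones are not in `L`). -/
  center_ne_pole : ∀ j, c j 0 ≠ 0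
  disjoint : ∀ i j, i ≠ j → Disjoint (Metric.sphere (c i) (r i)) (Metric.sphere (c j) (r j))
  inter_ncard : ∀ j, (Metric.sphere 0 1 ∩ Metric.sphere (c j) (r j)).ncard = 2
  inter_subset : ∀ j,
    Metric.sphere 0 1 ∩ Metric.sphere (c j) (r j) ⊆ closure (diskRegion c r)
  pole_unique : ∀ j, ∃! v, v ∈ verticalPoles (c j) (r j) ∧ v ∈ closure (diskRegion c r)
  /-- The vertical pole is different from the two intersection points. -/
  pole_notMem : ∀ j, ∀ v ∈ verticalPoles (c j) (r j), v ∈ closure (diskRegion c r) →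
    v ∉ Metric.sphere (0 : EuclideanSpace ℝ (Fin 2)) 1
  /-- The first components of the three marked points of a circle are distinct. -/
  marked_injOn : ∀ j, Set.InjOn (fun x : EuclideanSpace ℝ (Fin 2) => x 0) (markedPoints c r j)
  /-- The first components of the marked points of distinct circles are separated. -/
  marked_separated : ∀ i j, i ≠ j →
    (∀ a ∈ markedPoints c r i, ∀ b ∈ markedPoints c r j, a 0 < b 0) ∨
    (∀ a ∈ markedPoints c r i, ∀ b ∈ markedPoints c r j, b 0 < a 0)
  unit_poles_mem : verticalPoles 0 1 ⊆ closure (diskRegion c r)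
  unit_poles_ne : ∀ v ∈ verticalPoles 0 1, ∀ j, ∀ a ∈ markedPoints c r j, v 0 ≠ a 0

/-- The polynomials of the circles: `1 - ‖x‖²` for the unit circle (index `0`) and
`‖x - c j‖² - (r j)²` for the added ones; all are positive on the region. -/
noncomputable def diskPolys {n : ℕ} (c : Fin n → EuclideanSpace ℝ (Fin 2)) (r : Fin n → ℝ) :
    Fin (n + 1) → EuclideanSpace ℝ (Fin 2) → ℝ :=
  Fin.cons (fun x => 1 - ‖x‖ ^ 2) (fun j x => ‖x - c j‖ ^ 2 - r j ^ 2)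

/-- The unit circle goes to the first factor, the added circles to the second one. -/
def diskLabel (n : ℕ) : Fin (n + 1) → Fin 2 :=
  Fin.cons 0 (fun _ => 1)

/-- The defining equations of the manifold obtained from the added circles. -/
noncomputable def diskEq {n : ℕ} (c : Fin n → EuclideanSpace ℝ (Fin 2)) (r : Fin n → ℝ)
    (m : Fin 2 → ℕ) : MomentAmbient 2 m → (Fin 2 → ℝ) :=
  momentEq (diskPolys c r) (diskLabel n) m

/-- The manifold obtained from the added circles. -/
def diskManifold {n : ℕ} (c : Fin n → EuclideanSpace ℝ (Fin 2)) (r : Fin n → ℝ)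
    (m : Fin 2 → ℕ) : Set (MomentAmbient 2 m) :=
  momentManifold (diskPolys c r) (diskLabel n) m

/-- The composition of the moment-like map with the projection to the first coordinate, on
the ambient space. -/
def firstCoord (m : Fin 2 → ℕ) (z : MomentAmbient 2 m) : ℝ := z.1 0

/-- The function on the manifold whose Reeb graph is considered. -/
def diskFun {n : ℕ} (c : Fin n → EuclideanSpace ℝ (Fin 2)) (r : Fin n → ℝ)
    (m : Fin 2 → ℕ) : diskManifold c r m → ℝ :=
  fun z => firstCoord m z

/-- The set of singular points of this function. -/
def diskSingular {n : ℕ} (c : Fin n → EuclideanSpace ℝ (Fin 2)) (r : Fin n → ℝ)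
    (m : Fin 2 → ℕ) : Set (diskManifold c r m) :=
  {z | IsSingularPointOn (diskEq c r m) (firstCoord m) z}

/-! ### The graphs `G_{P, j₁, j₂}` -/

/-- The vertex set: path vertices (the element `a` carries the label `a + 1`), then `j₁` and
`j₂` further vertices (the element `i` is the `(i + 1)`-st one). -/
abbrev PendantVertex (j₁ j₂ : ℕ) : Type :=
  Fin (2 * (j₁ + j₂) + 2) ⊕ (Fin j₁ ⊕ Fin j₂)

/-- The edges, each in one direction. -/
def pendantRel (j₁ j₂ : ℕ) : PendantVertex j₁ j₂ → PendantVertex j₁ j₂ → Prop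
  | .inl a, .inl b => (b : ℕ) = a + 1
  | .inl a, .inr (.inl i) => (a : ℕ) + 1 = 2 * (i + 1) + 1
  | .inl a, .inr (.inr i) => (a : ℕ) + 1 = 2 * j₁ + 2 * (i + 1)
  | .inr _, _ => False

/-- The path with `j₁ + j₂` pendant edges. -/
def pendantGraph (j₁ j₂ : ℕ) : SimpleGraph (PendantVertex j₁ j₂) :=
  SimpleGraph.fromRel (pendantRel j₁ j₂)

/-! The projection to `x` maps `M` onto the closed disk minus the open disks bounded by the circles:
the horizontal projections of the circles inside the disk are disjoint, so at most one factor of the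
product is nonpositive at a point, and a nonnegative product forces nonnegative factors. The fibre
over `x` is a product of two spheres whose radii are the square roots of the left-hand sides. The
second sphere is connected because its dimension is positive. The first may be a pair of points, but
it degenerates on the unit circle. So the part of a level set over a connected piece of a vertical
slice that touches the unit circle is connected (`isPreconnected_sphereBundle`).

It remains to follow the vertical slices of a plane region. For a circle centred in the first
quadrant, the abscissae satisfy pole < tip < base, where tip and base are its intersections with the
unit circle. At the pole the slice splits in two. The piece between circle and near arc shrinks to a
point at the tip, while the other piece always reaches the opposite arc and passes the base. This
gives a path through -1, the ends `lo` and `hi` of each circle, and 1, with one pendant edge per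
circle running from its pole to its tip. Reflection in the vertical axis puts the pole at `hi`
instead of `lo`. Once the circles are sorted from left to right, those with negative centre come
first, which yields the two groups of pendant edges. The planar facts are collected in
`exists_capGeometry` and `IsAdmissible.exists_capSystem`, and `reebGraphIso_of_cover` turns a cover
by edge pieces into the graph.

The vertices are the right ones because a point is singular exactly over a vertical pole of one of
the curves or over a corner where two curves cross (`TransversalAt.isSingularPointOn_iff`). Both
this and non-singularity rest on the curves being transversal. Conversely, small equally spaced
circles realize any split of `n` (`exists_admissible`). -/

/-! ### Recognizing a Reeb space from a map with the same fibres -/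

theorem exists_reebSpace_homeomorph {X Y : Type*} [TopologicalSpace X] [CompactSpace X]
    [TopologicalSpace Y] [T2Space Y] (c : X → ℝ) (Φ : X → Y) (hΦ : Continuous Φ)
    (hsurj : Function.Surjective Φ)
    (h : ∀ x x', Φ x = Φ x' ↔ (c x = c x' ∧ x' ∈ connectedComponentIn (c ⁻¹' {c x}) x)) :
    ∃ φ : ReebSpace c ≃ₜ Y, ∀ x, φ (reebMk c x) = Φ x := by
  let ψ : ReebSpace c → Y := Quotient.lift Φ (fun a b hab => (h a b).2 hab)
  have hψ : Continuous ψ := Continuous.quotient_lift hΦ _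
  have hbij : Function.Bijective ψ := by
    constructor
    · intro a b
      induction a using Quotient.inductionOn with | h a => ?_
      induction b using Quotient.inductionOn with | h b => ?_
      intro hab
      exact Quotient.sound ((h a b).1 hab)
    · intro y
      obtain ⟨x, rfl⟩ := hsurj y
      exact ⟨reebMk c x, rfl⟩
  have : CompactSpace (ReebSpace c) := inferInstanceAs (CompactSpace (Quotient (reebSetoid c)))
  -- A continuous bijection from a compact space to a Hausdorff space is a homeomorphism.
  have hψ' : Continuous (Equiv.ofBijective ψ hbij) := hψ
  exact ⟨hψ'.homeoOfEquivCompactToT2, fun x => rfl⟩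

/-! ### Graph realizations parametrized by a height function -/

section Edges

variable {V I : Type*} [DecidableEq V] (src tgt : I → V) (h : V → ℝ)

/-- The point of height `t` on the edge `i`. -/
noncomputable def edgePoint (i : I) (t : ℝ) : V → ℝ :=
  Pi.single (src i) ((h (tgt i) - t) / (h (tgt i) - h (src i))) +
    Pi.single (tgt i) ((t - h (src i)) / (h (tgt i) - h (src i)))

variable {src tgt h}

theorem edgePoint_src (hlt : ∀ i, h (src i) < h (tgt i)) (i : I) :
    edgePoint src tgt h i (h (src i)) = Pi.single (src i) 1 := by
  have : h (tgt i) - h (src i) ≠ 0 := (sub_pos.2 (hlt i)).ne'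
  simp [edgePoint, div_self this]

theorem edgePoint_tgt (hlt : ∀ i, h (src i) < h (tgt i)) (i : I) :
    edgePoint src tgt h i (h (tgt i)) = Pi.single (tgt i) 1 := by
  have : h (tgt i) - h (src i) ≠ 0 := (sub_pos.2 (hlt i)).ne'
  simp [edgePoint, div_self this]

theorem edgePoint_of_mem (hlt : ∀ i, h (src i) < h (tgt i)) {i : I} {v : V}
    (hv : v = src i ∨ v = tgt i) : edgePoint src tgt h i (h v) = Pi.single v 1 := by
  rcases hv with rfl | rfl
  · exact edgePoint_src hlt i
  · exact edgePoint_tgt hlt i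

theorem edgePoint_apply_src (hlt : ∀ i, h (src i) < h (tgt i)) (i : I) (t : ℝ) :
    edgePoint src tgt h i t (src i) = (h (tgt i) - t) / (h (tgt i) - h (src i)) := by
  have : src i ≠ tgt i := fun e => (hlt i).ne (by rw [e])
  simp [edgePoint, this]

theorem edgePoint_apply_tgt (hlt : ∀ i, h (src i) < h (tgt i)) (i : I) (t : ℝ) :
    edgePoint src tgt h i t (tgt i) = (t - h (src i)) / (h (tgt i) - h (src i)) := by
  have : tgt i ≠ src i := fun e => (hlt i).ne (by rw [e])
  simp [edgePoint, this]

theorem edgePoint_apply_of_ne (i : I) (t : ℝ) {v : V} (h1 : v ≠ src i) (h2 : v ≠ tgt i) :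
    edgePoint src tgt h i t v = 0 := by
  simp [edgePoint, h1, h2]

theorem continuous_edgePoint (i : I) : Continuous (edgePoint src tgt h i) := by
  refine continuous_pi fun v => ?_
  simp only [edgePoint, Pi.add_apply, Pi.single_apply]
  refine Continuous.add ?_ ?_ <;> split_ifs <;> fun_prop

/-- A point in the interior of an edge has both ends in its support, so both are ends of the other
edge too. Heights increase from source to target, which excludes the reversed match, and `hinj` then
identifies the edges. -/
theorem exists_common_of_edgePoint_eq (hlt : ∀ i, h (src i) < h (tgt i))
    (hinj : ∀ i i', src i = src i' → tgt i = tgt i' → i = i') {i i' : I} (hne : i ≠ i') {t : ℝ}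
    (heq : edgePoint src tgt h i t = edgePoint src tgt h i' t) :
    ∃ v, (v = src i ∨ v = tgt i) ∧ (v = src i' ∨ v = tgt i') ∧ t = h v := by
  have hpos := sub_pos.2 (hlt i)
  have key : ∀ v, edgePoint src tgt h i t v ≠ 0 → v = src i' ∨ v = tgt i' := by
    intro v hv
    by_contra! hcon
    rw [heq] at hv
    exact hv (edgePoint_apply_of_ne i' t hcon.1 hcon.2)
  by_cases h1 : t = h (src i)
  · refine ⟨src i, Or.inl rfl, key _ ?_, h1⟩
    rw [edgePoint_apply_src hlt, h1, div_self hpos.ne']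
    exact one_ne_zero
  by_cases h2 : t = h (tgt i)
  · refine ⟨tgt i, Or.inr rfl, key _ ?_, h2⟩
    rw [edgePoint_apply_tgt hlt, h2, div_self hpos.ne']
    exact one_ne_zero
  have k1 := key (src i) (by
    rw [edgePoint_apply_src hlt]
    exact div_ne_zero (sub_ne_zero.2 (Ne.symm h2)) hpos.ne')
  have k2 := key (tgt i) (by
    rw [edgePoint_apply_tgt hlt]
    exact div_ne_zero (sub_ne_zero.2 h1) hpos.ne')
  have := hlt i
  have := hlt i'
  exfalso
  rcases k1 with k1 | k1 <;> rcases k2 with k2 | k2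
  · rw [k1, k2] at hpos; simp at hpos
  · exact hne (hinj _ _ k1 k2)
  · rw [k1, k2] at hpos; linarith
  · rw [k1, k2] at hpos; simp at hpos

variable [Fintype V] {G : SimpleGraph V}

/-- The affine extension of `h` recovers the parameter `t`, so the height can be read off from a
point of the realization without knowing its edge. -/
theorem sum_edgePoint_mul (hlt : ∀ i, h (src i) < h (tgt i)) (i : I) (t : ℝ) :
    ∑ v, edgePoint src tgt h i t v * h v = t := by
  have : h (tgt i) - h (src i) ≠ 0 := (sub_pos.2 (hlt i)).ne'
  simp only [edgePoint, Pi.add_apply, add_mul, Finset.sum_add_distrib, Pi.single_apply, ite_mul,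
    zero_mul, Finset.sum_ite_eq', Finset.mem_univ, if_true]
  field_simp
  ring

theorem edgePoint_mem_graphRealization (hlt : ∀ i, h (src i) < h (tgt i))
    (hadj : ∀ i, G.Adj (src i) (tgt i)) (i : I) {t : ℝ}
    (ht : t ∈ Set.Icc (h (src i)) (h (tgt i))) :
    edgePoint src tgt h i t ∈ graphRealization G := by
  have hpos := sub_pos.2 (hlt i)
  refine ⟨⟨fun v => ?_, ?_⟩, src i, tgt i, Or.inr (hadj i), fun u h1 h2 =>
    edgePoint_apply_of_ne i t h1 h2⟩
  · simp only [edgePoint, Pi.add_apply, Pi.single_apply]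
    have h1 : 0 ≤ (h (tgt i) - t) / (h (tgt i) - h (src i)) :=
      div_nonneg (by linarith [ht.2]) hpos.le
    have h2 : 0 ≤ (t - h (src i)) / (h (tgt i) - h (src i)) :=
      div_nonneg (by linarith [ht.1]) hpos.le
    split_ifs <;> positivity
  · simp only [edgePoint, Pi.add_apply, Finset.sum_add_distrib, Pi.single_apply,
      Finset.sum_ite_eq', Finset.mem_univ, if_true]
    field_simp
    ring

theorem eq_edgePoint_of_support (hlt : ∀ i, h (src i) < h (tgt i)) {w : V → ℝ}
    (hw : w ∈ stdSimplex ℝ V) {i : I} (hsupp : ∀ u, u ≠ src i → u ≠ tgt i → w u = 0) :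
    ∑ v, w v * h v ∈ Set.Icc (h (src i)) (h (tgt i)) ∧
      w = edgePoint src tgt h i (∑ v, w v * h v) := by
  have hpos := sub_pos.2 (hlt i)
  have hne : src i ≠ tgt i := fun e => (hlt i).ne (by rw [e])
  have hsum : ∀ f : V → ℝ, ∑ v, w v * f v = w (src i) * f (src i) + w (tgt i) * f (tgt i) := by
    intro f
    rw [← Finset.sum_pair (f := fun v => w v * f v) hne]
    refine (Finset.sum_subset (Finset.subset_univ _) fun u _ hu => ?_).symm
    simp only [Finset.mem_insert, Finset.mem_singleton, not_or] at hu
    simp [hsupp u hu.1 hu.2]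
  have h1 : w (src i) + w (tgt i) = 1 := by
    have := hsum (fun _ => 1)
    simp only [mul_one] at this
    rw [← this, hw.2]
  have ha := hw.1 (src i)
  have hb := hw.1 (tgt i)
  rw [hsum h]
  have hsrc : w (src i) = 1 - w (tgt i) := by linarith
  refine ⟨⟨?_, ?_⟩, ?_⟩
  · rw [hsrc]; nlinarith
  · rw [show w (tgt i) = 1 - w (src i) by linarith]; nlinarith
  · funext u
    by_cases hu1 : u = src i
    · rw [hu1, edgePoint_apply_src hlt, eq_div_iff hpos.ne',
        show w (tgt i) = 1 - w (src i) by linarith]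
      ring
    by_cases hu2 : u = tgt i
    · rw [hu2, edgePoint_apply_tgt hlt, eq_div_iff hpos.ne', hsrc]
      ring
    rw [hsupp u hu1 hu2, edgePoint_apply_of_ne i _ hu1 hu2]

theorem exists_eq_edgePoint (hlt : ∀ i, h (src i) < h (tgt i))
    (hadj : ∀ a b, G.Adj a b → ∃ i, (a = src i ∧ b = tgt i) ∨ (a = tgt i ∧ b = src i))
    (hcov : ∀ v, ∃ i, v = src i ∨ v = tgt i) {w : V → ℝ} (hw : w ∈ graphRealization G) :
    ∃ i, ∑ v, w v * h v ∈ Set.Icc (h (src i)) (h (tgt i)) ∧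
      w = edgePoint src tgt h i (∑ v, w v * h v) := by
  obtain ⟨hw, a, b, hab, hsupp⟩ := hw
  rcases hab with rfl | hab
  · obtain ⟨i, hi⟩ := hcov a
    refine ⟨i, eq_edgePoint_of_support hlt hw fun u h1 h2 => ?_⟩
    have : u ≠ a := by rcases hi with rfl | rfl <;> assumption
    exact hsupp u this this
  · obtain ⟨i, hi⟩ := hadj a b hab
    refine ⟨i, eq_edgePoint_of_support hlt hw fun u h1 h2 => ?_⟩
    rcases hi with ⟨rfl, rfl⟩ | ⟨rfl, rfl⟩
    · exact hsupp u h1 h2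
    · exact hsupp u h2 h1

/-- A function on a compact space has Reeb graph `G` if the space is covered by closed sets, one
for each edge of `G`, whose level sets are connected and which overlap only over common
vertices. -/
theorem reebGraphIso_of_cover {X : Type*} [TopologicalSpace X] [CompactSpace X] [Finite I]
    {c : X → ℝ} (hc : Continuous c) {S : Set X} (hlt : ∀ i, h (src i) < h (tgt i))
    (hadj : ∀ a b, G.Adj a b ↔ ∃ i, (a = src i ∧ b = tgt i) ∨ (a = tgt i ∧ b = src i))
    (hcov : ∀ v, ∃ i, v = src i ∨ v = tgt i)
    (hinj : ∀ i i', src i = src i' → tgt i = tgt i' → i = i')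
    (E : I → Set X) (hclosed : ∀ i, IsClosed (E i)) (hcover : ∀ x, ∃ i, x ∈ E i)
    (hheight : ∀ i, ∀ x ∈ E i, c x ∈ Set.Icc (h (src i)) (h (tgt i)))
    (hconn : ∀ i t, IsPreconnected (E i ∩ c ⁻¹' {t}))
    (hne : ∀ i, ∀ t ∈ Set.Icc (h (src i)) (h (tgt i)), ∃ x ∈ E i, c x = t)
    (hover : ∀ i i' x, i ≠ i' → x ∈ E i → x ∈ E i' →
      ∃ v, (v = src i ∨ v = tgt i) ∧ (v = src i' ∨ v = tgt i') ∧ c x = h v)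
    (hvert : ∀ i i' v x, (v = src i ∨ v = tgt i) → (v = src i' ∨ v = tgt i') → c x = h v →
      x ∈ E i → x ∈ E i')
    (hS : ∀ z ∈ S, ∃ i v, (v = src i ∨ v = tgt i) ∧ z ∈ E i ∧ c z = h v)
    (hS' : ∀ v, ∃ z ∈ S, ∃ i, (v = src i ∨ v = tgt i) ∧ z ∈ E i ∧ c z = h v) :
    ReebGraphIso c S G := by
  choose e he using hcover
  have hadj' : ∀ i, G.Adj (src i) (tgt i) := fun i => (hadj _ _).2 ⟨i, Or.inl ⟨rfl, rfl⟩⟩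
  let Φ : X → graphRealization G := fun x =>
    ⟨edgePoint src tgt h (e x) (c x),
      edgePoint_mem_graphRealization hlt hadj' (e x) (hheight _ x (he x))⟩
  -- The arbitrary choice of edge is harmless: pieces overlap only over a common vertex, where both
  -- formulas give that vertex. Continuity then glues over the finite closed cover.
  have hΦ : ∀ i x, x ∈ E i → (Φ x : V → ℝ) = edgePoint src tgt h i (c x) := by
    intro i x hx
    by_cases hi : e x = i
    · simp only [Φ, hi]
    · obtain ⟨v, hv1, hv2, hv⟩ := hover _ _ x hi (he x) hx
      simp only [Φ]
      rw [hv, edgePoint_of_mem hlt hv1, edgePoint_of_mem hlt hv2]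
  have hsum : ∀ x, ∑ v, (Φ x : V → ℝ) v * h v = c x := fun x => sum_edgePoint_mul hlt _ _
  have hcont : Continuous Φ := by
    refine Continuous.subtype_mk ?_ _
    change Continuous fun x => (Φ x : V → ℝ)
    refine (locallyFinite_of_finite E).continuous
      (Set.eq_univ_of_forall fun x => Set.mem_iUnion.2 ⟨e x, he x⟩) hclosed fun i => ?_
    exact ((continuous_edgePoint i).comp hc).continuousOn.congr fun x hx => hΦ i x hx
  have hsurj : Function.Surjective Φ := by
    rintro ⟨w, hw⟩
    obtain ⟨i, hi, hwi⟩ := exists_eq_edgePoint hlt (fun a b => (hadj a b).1) hcov hw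
    obtain ⟨x, hx, hcx⟩ := hne i _ hi
    refine ⟨x, Subtype.ext ?_⟩
    rw [hΦ i x hx, hcx]
    exact hwi.symm
  -- Each edge contributes at most one point of height `t`.
  have hfib : ∀ t, {y : graphRealization G | ∑ v, (y : V → ℝ) v * h v = t}.Finite := by
    intro t
    refine Set.Finite.of_finite_image (f := Subtype.val) ?_ Subtype.val_injective.injOn
    refine (Set.finite_range fun i => edgePoint src tgt h i t).subset ?_
    rintro _ ⟨⟨w, hw⟩, hwt, rfl⟩
    obtain ⟨i, -, hwi⟩ := exists_eq_edgePoint hlt (fun a b => (hadj a b).1) hcov hw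
    refine ⟨i, ?_⟩
    simp only [Set.mem_ofPred_eq] at hwt
    simp only
    rw [hwi, hwt]
  obtain ⟨φ, hφ⟩ := exists_reebSpace_homeomorph c Φ hcont hsurj (by
    intro x x'
    constructor
    · intro hxx
      have hcc : c x = c x' := by rw [← hsum x, ← hsum x', hxx]
      -- Both points must be placed in one piece, whose level set is connected by `hconn`. If the
      -- chosen edges differ, the points lie over a common vertex and `hvert` moves `x` across.
      have hmem : x ∈ E (e x') := by
        by_cases hi : e x = e x'
        · rw [← hi]; exact he x
        · have : edgePoint src tgt h (e x) (c x) = edgePoint src tgt h (e x') (c x) := by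
            have := congrArg Subtype.val hxx
            rw [hΦ _ _ (he x), hΦ _ _ (he x'), ← hcc] at this
            exact this
          obtain ⟨v, hv1, hv2, hv⟩ := exists_common_of_edgePoint_eq hlt hinj hi this
          exact hvert _ _ v x hv1 hv2 hv (he x)
      refine ⟨hcc, (hconn (e x') (c x)).subset_connectedComponentIn ⟨hmem, rfl⟩
        Set.inter_subset_right ⟨he x', hcc.symm⟩⟩
    · rintro ⟨-, hx'⟩
      -- The image of a component is connected and lies in a finite level of the realization, hence
      -- is a single point.
      have hpre : IsPreconnected (Φ '' connectedComponentIn (c ⁻¹' {c x}) x) :=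
        isPreconnected_connectedComponentIn.image _ hcont.continuousOn
      have hfin : (Φ '' connectedComponentIn (c ⁻¹' {c x}) x).Finite := by
        refine (hfib (c x)).subset ?_
        rintro _ ⟨y, hy, rfl⟩
        have := connectedComponentIn_subset _ _ hy
        simp only [Set.mem_ofPred_eq, hsum]
        exact this
      by_contra hcon
      exact hpre.infinite_of_nontrivial
        ⟨_, ⟨x, mem_connectedComponentIn (by simp), rfl⟩, _, ⟨x', hx', rfl⟩, hcon⟩ hfin)
  refine ⟨φ, ?_⟩
  ext y
  constructor
  · rintro ⟨_, ⟨z, hz, rfl⟩, rfl⟩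
    obtain ⟨i, v, hv, hzi, hcz⟩ := hS z hz
    refine ⟨v, ?_⟩
    rw [hφ, hΦ i z hzi, hcz, edgePoint_of_mem hlt hv]
  · rintro ⟨v, hv⟩
    obtain ⟨z, hz, i, hvi, hzi, hcz⟩ := hS' v
    refine ⟨_, ⟨z, hz, rfl⟩, Subtype.ext ?_⟩
    rw [hφ, hΦ i z hzi, hcz, edgePoint_of_mem hlt hvi, hv]

end Edges

theorem ncard_graphRealizationVertices {V : Type*} [Fintype V] [DecidableEq V]
    (G : SimpleGraph V) : (graphRealizationVertices G).ncard = Fintype.card V := by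
  have hmem : ∀ v : V, (Pi.single v 1 : V → ℝ) ∈ graphRealization G := fun v =>
    ⟨single_mem_stdSimplex ℝ v, v, v, Or.inl rfl, fun u hu _ => by simp [hu]⟩
  have : graphRealizationVertices G =
      Set.range fun v : V => (⟨Pi.single v 1, hmem v⟩ : graphRealization G) := by
    ext w
    simp only [graphRealizationVertices, Set.mem_ofPred_eq, Set.mem_range, Subtype.ext_iff]
    exact exists_congr fun v => eq_comm
  rw [this, ← Set.image_univ, Set.ncard_image_of_injective, Set.ncard_univ,
    Nat.card_eq_fintype_card]
  intro v w hvw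
  have := congrFun (congrArg Subtype.val hvw) v
  by_contra hne
  simp [hne] at this

theorem ReebGraphIso.ncard_vertices {X : Type*} [TopologicalSpace X] {c : X → ℝ} {S : Set X}
    {V : Type*} [Fintype V] [DecidableEq V] {G : SimpleGraph V} (hG : ReebGraphIso c S G) :
    (reebMk c '' S).ncard = Fintype.card V := by
  obtain ⟨φ, hφ⟩ := hG
  rw [← ncard_graphRealizationVertices G, ← hφ, Set.ncard_image_of_injective _ φ.injective]

/-! ### Connectedness of sphere bundles over planar sets -/

section Lift

variable {m : Fin 2 → ℕ}

/-- The element of the product of two Euclidean spaces with the given components. -/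
def pairVec (a : EuclideanSpace ℝ (Fin (m 0 + 1))) (b : EuclideanSpace ℝ (Fin (m 1 + 1))) :
    (i : Fin 2) → EuclideanSpace ℝ (Fin (m i + 1))
  | 0 => a
  | 1 => b

theorem pairVec_eta (y : (i : Fin 2) → EuclideanSpace ℝ (Fin (m i + 1))) :
    pairVec (y 0) (y 1) = y := by
  funext i
  fin_cases i <;> rfl

theorem continuous_pairVec {T : Type*} [TopologicalSpace T]
    {f : T → EuclideanSpace ℝ (Fin (m 0 + 1))} {g : T → EuclideanSpace ℝ (Fin (m 1 + 1))}
    (hf : Continuous f) (hg : Continuous g) : Continuous fun t => pairVec (f t) (g t) := by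
  refine continuous_pi fun i => ?_
  fin_cases i
  · exact hf
  · exact hg

theorem exists_eq_norm_smul {k : ℕ} (y : EuclideanSpace ℝ (Fin (k + 1))) :
    ∃ e ∈ Metric.sphere (0 : EuclideanSpace ℝ (Fin (k + 1))) 1, y = ‖y‖ • e := by
  by_cases hy : y = 0
  · exact ⟨EuclideanSpace.single 0 1, by simp, by simp [hy]⟩
  · have : ‖y‖ ≠ 0 := norm_ne_zero_iff.2 hy
    refine ⟨‖y‖⁻¹ • y, ?_, ?_⟩
    · simp [norm_smul, inv_mul_cancel₀ this]
    · rw [smul_smul, mul_inv_cancel₀ this, one_smul]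

/-- The sphere bundle over a connected set is connected as soon as its first sphere degenerates
somewhere and the second one has positive dimension. -/
theorem isPreconnected_sphereBundle (hm : 0 < m 1) {f g : EuclideanSpace ℝ (Fin 2) → ℝ}
    (hf : Continuous f) (hg : Continuous g) {A : Set (EuclideanSpace ℝ (Fin 2))}
    (hA : IsPreconnected A) (hfA : ∀ x ∈ A, 0 ≤ f x) (hgA : ∀ x ∈ A, 0 ≤ g x)
    {x₀ : EuclideanSpace ℝ (Fin 2)} (hx₀ : x₀ ∈ A) (hfx₀ : f x₀ = 0) :
    IsPreconnected {z : MomentAmbient 2 m | z.1 ∈ A ∧ f z.1 = ‖z.2 0‖ ^ 2 ∧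
      g z.1 = ‖z.2 1‖ ^ 2} := by
  have hsphere : IsPreconnected (Metric.sphere (0 : EuclideanSpace ℝ (Fin (m 1 + 1))) 1) := by
    refine isPreconnected_sphere ?_ 0 1
    rw [← Module.finrank_eq_rank]
    simp only [finrank_euclideanSpace, Fintype.card_fin]
    exact_mod_cast Nat.lt_add_of_pos_left hm
  obtain ⟨e₀, he₀⟩ : (Metric.sphere (0 : EuclideanSpace ℝ (Fin (m 1 + 1))) 1).Nonempty :=
    ⟨EuclideanSpace.single 0 1, by simp⟩
  -- The base point has first vector zero since `f x₀ = 0`.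
  refine isPreconnected_of_forall (x₀, pairVec 0 (√(g x₀) • e₀)) ?_
  rintro ⟨x, y⟩ ⟨hx, hfx, hgx⟩
  obtain ⟨a, ha, hya⟩ := exists_eq_norm_smul (y 0)
  obtain ⟨b, hb, hyb⟩ := exists_eq_norm_smul (y 1)
  -- The direction `a` of the first vector stays fixed while the base point and the second direction
  -- vary. The image contains the given point, and also the base point, because the choice of `a`
  -- does not matter over `x₀`.
  let Ψ : EuclideanSpace ℝ (Fin 2) × EuclideanSpace ℝ (Fin (m 1 + 1)) → MomentAmbient 2 m :=
    fun p => (p.1, pairVec (√(f p.1) • a) (√(g p.1) • p.2))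
  have hΨ : Continuous Ψ := by
    refine continuous_fst.prodMk (continuous_pairVec ?_ ?_)
    · exact ((hf.comp continuous_fst).sqrt).smul continuous_const
    · exact ((hg.comp continuous_fst).sqrt).smul continuous_snd
  refine ⟨Ψ '' (A ×ˢ Metric.sphere 0 1), ?_, ?_, ?_, ?_⟩
  · rintro _ ⟨⟨u, v⟩, ⟨hu, hv⟩, rfl⟩
    have ha' : ‖a‖ = 1 := by simpa using ha
    have hv' : ‖v‖ = 1 := by simpa using hv
    have hu : u ∈ A := hu
    refine ⟨hu, ?_, ?_⟩
    · simp [Ψ, pairVec, norm_smul, ha', Real.sq_sqrt (hfA u hu)]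
    · simp [Ψ, pairVec, norm_smul, hv', Real.sq_sqrt (hgA u hu)]
  · exact ⟨(x₀, e₀), ⟨hx₀, he₀⟩, by simp [Ψ, hfx₀]⟩
  · refine ⟨(x, b), ⟨hx, hb⟩, ?_⟩
    simp only [Ψ, Prod.mk.injEq, true_and]
    simp only at hfx hgx
    rw [hfx, hgx, Real.sqrt_sq (norm_nonneg _), Real.sqrt_sq (norm_nonneg _), ← hya, ← hyb,
      pairVec_eta]
  · exact (hA.prod hsphere).image _ hΨ.continuousOn

end Lift

/-! ### The defining equations: compactness, differentials, singular points -/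

section Equations

variable {n : ℕ} (c : Fin n → EuclideanSpace ℝ (Fin 2)) (r : Fin n → ℝ) (m : Fin 2 → ℕ)

/-- The power of a point with respect to the `j`-th circle. -/
noncomputable def circlePower (j : Fin n) (x : EuclideanSpace ℝ (Fin 2)) : ℝ :=
  ‖x - c j‖ ^ 2 - r j ^ 2

theorem diskEq_zero (z : MomentAmbient 2 m) : diskEq c r m z 0 = 1 - ‖z.1‖ ^ 2 - ‖z.2 0‖ ^ 2 := by
  rw [diskEq, momentEq, Finset.prod_filter, Fin.prod_univ_succ]
  simp [diskLabel, diskPolys]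

theorem diskEq_one (z : MomentAmbient 2 m) :
    diskEq c r m z 1 = ∏ j, circlePower c r j z.1 - ‖z.2 1‖ ^ 2 := by
  rw [diskEq, momentEq, Finset.prod_filter, Fin.prod_univ_succ]
  simp [diskLabel, diskPolys, circlePower]

theorem diskEq_eq_zero_iff (z : MomentAmbient 2 m) : diskEq c r m z = 0 ↔
    1 - ‖z.1‖ ^ 2 = ‖z.2 0‖ ^ 2 ∧ ∏ j, circlePower c r j z.1 = ‖z.2 1‖ ^ 2 := by
  rw [funext_iff, Fin.forall_fin_two, diskEq_zero, diskEq_one]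
  simp only [Pi.zero_apply, sub_eq_zero]

theorem norm_sq_eq_coords (x : EuclideanSpace ℝ (Fin 2)) : ‖x‖ ^ 2 = x 0 ^ 2 + x 1 ^ 2 := by
  simp [EuclideanSpace.norm_sq_eq, Fin.sum_univ_two]

theorem circlePower_eq_coords (j : Fin n) (x : EuclideanSpace ℝ (Fin 2)) :
    circlePower c r j x = (x 0 - c j 0) ^ 2 + (x 1 - c j 1) ^ 2 - r j ^ 2 := by
  rw [circlePower, norm_sq_eq_coords]
  simp

theorem continuous_circlePower (j : Fin n) : Continuous (circlePower c r j) := by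
  unfold circlePower
  fun_prop

theorem continuous_diskEq : Continuous (diskEq c r m) := by
  refine continuous_pi (Fin.forall_fin_two.2 ⟨?_, ?_⟩)
  · simp only [diskEq_zero]
    fun_prop
  · simp only [diskEq_one]
    have := continuous_circlePower c r
    fun_prop

theorem isCompact_diskManifold : IsCompact (diskManifold c r m) := by
  refine Metric.isCompact_of_isClosed_isBounded ?_ ?_
  · exact isClosed_singleton.preimage (continuous_diskEq c r m)
  · obtain ⟨B, hB⟩ := (isCompact_closedBall (0 : EuclideanSpace ℝ (Fin 2)) 1).exists_bound_of_continuousOn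
      (f := fun x => ∏ j, circlePower c r j x)
      (continuous_finsetProd _ fun j _ => continuous_circlePower c r j).continuousOn
    rw [isBounded_iff_forall_norm_le]
    -- The first equation bounds `x` and the first vector by 1. The product is then at most `B` in
    -- absolute value, and `2s ≤ 1 + s ^ 2` turns the bound on the squared norm of the second vector
    -- into one on its norm.
    refine ⟨max 1 (1 + B), fun z hz => ?_⟩
    obtain ⟨h1, h2⟩ := (diskEq_eq_zero_iff c r m z).1 hz
    have hx : ‖z.1‖ ≤ 1 := by nlinarith [sq_nonneg ‖z.2 0‖, norm_nonneg z.1]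
    have hb := hB z.1 (by simpa using hx)
    rw [Real.norm_eq_abs, h2, abs_of_nonneg (sq_nonneg _)] at hb
    refine max_le (hx.trans (le_max_left _ _)) ((pi_norm_le_iff_of_nonneg (by positivity)).2
      (Fin.forall_fin_two.2 ⟨?_, ?_⟩))
    · refine le_trans ?_ (le_max_left _ _)
      nlinarith [sq_nonneg ‖z.1‖, norm_nonneg (z.2 0)]
    · refine le_trans ?_ (le_max_right _ _)
      nlinarith [sq_nonneg (‖z.2 1‖ - 1), norm_nonneg (z.2 1)]

theorem inner_eq_coords (x u : EuclideanSpace ℝ (Fin 2)) :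
    inner ℝ x u = x 0 * u 0 + x 1 * u 1 := by
  simp [PiLp.inner_apply, Fin.sum_univ_two, mul_comm]

theorem differentiable_circlePower (j : Fin n) : Differentiable ℝ (circlePower c r j) := by
  unfold circlePower
  have : Differentiable ℝ fun x : EuclideanSpace ℝ (Fin 2) => ‖x - c j‖ ^ 2 :=
    (differentiable_id.sub_const (c j)).norm_sq ℝ
  exact this.sub_const _

theorem fderiv_circlePower (j : Fin n) (x u : EuclideanSpace ℝ (Fin 2)) :
    fderiv ℝ (circlePower c r j) x u =
      2 * ((x 0 - c j 0) * u 0 + (x 1 - c j 1) * u 1) := by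
  have h := ((((hasFDerivAt_id (𝕜 := ℝ) x).sub_const (c j)).norm_sq).sub_const (r j ^ 2)).fderiv
  have h' : circlePower c r j = fun x => ‖id x - c j‖ ^ 2 - r j ^ 2 := rfl
  rw [h', h]
  simp [inner_eq_coords]
  ring

theorem differentiable_prod_circlePower (s : Finset (Fin n)) :
    Differentiable ℝ fun x => ∏ j ∈ s, circlePower c r j x :=
  fun x => (HasFDerivAt.finsetProd (g := circlePower c r) fun j _ =>
    (differentiable_circlePower c r j x).hasFDerivAt).differentiableAt

theorem fderiv_prod_circlePower {j : Fin n} {x : EuclideanSpace ℝ (Fin 2)}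
    (hx : circlePower c r j x = 0) (u : EuclideanSpace ℝ (Fin 2)) :
    fderiv ℝ (fun x => ∏ i, circlePower c r i x) x u =
      (∏ i ∈ Finset.univ.erase j, circlePower c r i x) *
        (2 * ((x 0 - c j 0) * u 0 + (x 1 - c j 1) * u 1)) := by
  have : (fun x => ∏ i, circlePower c r i x) = fun x =>
      circlePower c r j x * ∏ i ∈ Finset.univ.erase j, circlePower c r i x := by
    funext x
    exact (Finset.mul_prod_erase _ _ (Finset.mem_univ j)).symm
  rw [this, fderiv_fun_mul (differentiable_circlePower c r j x)
    (differentiable_prod_circlePower c r _ x)]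
  simp [hx, fderiv_circlePower]

theorem fderiv_diskEq (z w : MomentAmbient 2 m) :
    fderiv ℝ (diskEq c r m) z w 0 =
        -2 * (z.1 0 * w.1 0 + z.1 1 * w.1 1) - 2 * inner ℝ (z.2 0) (w.2 0) ∧
      fderiv ℝ (diskEq c r m) z w 1 =
        fderiv ℝ (fun x => ∏ i, circlePower c r i x) z.1 w.1 - 2 * inner ℝ (z.2 1) (w.2 1) := by
  have hfst : HasFDerivAt (fun z : MomentAmbient 2 m => z.1)
    (ContinuousLinearMap.fst ℝ _ _) z := hasFDerivAt_fst
  have hsnd : ∀ i, HasFDerivAt (fun z : MomentAmbient 2 m => z.2 i)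
      ((ContinuousLinearMap.proj i).comp (ContinuousLinearMap.snd ℝ _ _)) z := fun i =>
    ((ContinuousLinearMap.proj (R := ℝ) (φ := fun i : Fin 2 => EuclideanSpace ℝ (Fin (m i + 1)))
      i).comp (ContinuousLinearMap.snd ℝ (EuclideanSpace ℝ (Fin 2)) _)).hasFDerivAt
  have h0 := ((hfst.norm_sq).const_sub 1).sub (hsnd 0).norm_sq
  have h1 := ((differentiable_prod_circlePower c r Finset.univ z.1).hasFDerivAt.comp z hfst).sub
    (hsnd 1).norm_sq
  have h0' := h0.congr_of_eventuallyEq (Filter.Eventually.of_forall (diskEq_zero c r m))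
  have h1' := h1.congr_of_eventuallyEq (Filter.Eventually.of_forall (diskEq_one c r m))
  have hd : DifferentiableAt ℝ (diskEq c r m) z := differentiableAt_pi.2
    (Fin.forall_fin_two.2 ⟨h0'.differentiableAt, h1'.differentiableAt⟩)
  have hap : ∀ i, fderiv ℝ (diskEq c r m) z w i = fderiv ℝ (fun z => diskEq c r m z i) z w := by
    intro i
    rw [fderiv_apply hd]
    rfl
  rw [hap, hap, h0'.fderiv, h1'.fderiv]
  constructor
  · simp [inner_eq_coords]
    ring
  · simp

theorem fderiv_firstCoord (z w : MomentAmbient 2 m) : fderiv ℝ (firstCoord m) z w = w.1 0 := by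
  let ℓ : MomentAmbient 2 m →L[ℝ] ℝ :=
    (EuclideanSpace.proj (0 : Fin 2)).comp (ContinuousLinearMap.fst ℝ _ _)
  have : firstCoord m = ℓ := rfl
  rw [this, ContinuousLinearMap.fderiv]
  rfl

theorem exists_inner_eq {k : ℕ} {y : EuclideanSpace ℝ (Fin k)} (hy : y ≠ 0) (β : ℝ) :
    ∃ v, inner ℝ y v = β := by
  refine ⟨(β / ‖y‖ ^ 2) • y, ?_⟩
  have : ‖y‖ ≠ 0 := norm_ne_zero_iff.2 hy
  rw [inner_smul_right, real_inner_self_eq_norm_sq]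
  field_simp

variable {c r m}

/-- The circles meet transversally inside the closed disk: at most two of the curves go through a
point, and if one of them is the unit circle, it is not tangent to the other one. -/
structure TransversalAt (c : Fin n → EuclideanSpace ℝ (Fin 2)) (r : Fin n → ℝ)
    (x : EuclideanSpace ℝ (Fin 2)) : Prop where
  radius_pos : ∀ j, 0 < r j
  unique : ∀ i j, circlePower c r i x = 0 → circlePower c r j x = 0 → i = j
  det_ne : ∀ j, ‖x‖ = 1 → circlePower c r j x = 0 → x 0 * c j 1 - x 1 * c j 0 ≠ 0

theorem TransversalAt.prod_erase_ne {x : EuclideanSpace ℝ (Fin 2)} (h : TransversalAt c r x)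
    {j : Fin n} (hj : circlePower c r j x = 0) :
    ∏ i ∈ Finset.univ.erase j, circlePower c r i x ≠ 0 :=
  Finset.prod_ne_zero_iff.2 fun i hi hi0 => (Finset.ne_of_mem_erase hi) (h.unique i j hi0 hj)

theorem norm_eq_one_of_diskEq {z : MomentAmbient 2 m} (hz : diskEq c r m z = 0)
    (h0 : z.2 0 = 0) : ‖z.1‖ = 1 := by
  have := ((diskEq_eq_zero_iff c r m z).1 hz).1
  rw [h0, norm_zero] at this
  nlinarith [norm_nonneg z.1]

theorem exists_circlePower_eq_zero {z : MomentAmbient 2 m} (hz : diskEq c r m z = 0)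
    (h1 : z.2 1 = 0) : ∃ j, circlePower c r j z.1 = 0 := by
  have := ((diskEq_eq_zero_iff c r m z).1 hz).2
  rw [h1, norm_zero, zero_pow two_ne_zero, Finset.prod_eq_zero_iff] at this
  simpa using this

/-- A nonzero vector `z.2 i` lets the `i`-th component of the differential be adjusted freely. If it
vanishes, `x` lies on a curve of the `i`-th factor, whose gradient must do the work. If both vanish,
the two gradients are independent by `det_ne`. -/
theorem TransversalAt.surjective_fderiv {z : MomentAmbient 2 m} (h : TransversalAt c r z.1)
    (hz : diskEq c r m z = 0) : Function.Surjective (fderiv ℝ (diskEq c r m) z) := by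
  intro b
  have key : ∀ w : MomentAmbient 2 m,
      -2 * (z.1 0 * w.1 0 + z.1 1 * w.1 1) - 2 * inner ℝ (z.2 0) (w.2 0) = b 0 →
      fderiv ℝ (fun x => ∏ i, circlePower c r i x) z.1 w.1 - 2 * inner ℝ (z.2 1) (w.2 1) = b 1 →
      ∃ w, fderiv ℝ (diskEq c r m) z w = b := by
    intro w h0 h1
    refine ⟨w, funext (Fin.forall_fin_two.2 ⟨?_, ?_⟩)⟩
    · rw [(fderiv_diskEq c r m z w).1, h0]
    · rw [(fderiv_diskEq c r m z w).2, h1]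
  by_cases h0 : z.2 0 = 0 <;> by_cases h1 : z.2 1 = 0
  · have hx := norm_eq_one_of_diskEq hz h0
    obtain ⟨j, hj⟩ := exists_circlePower_eq_zero hz h1
    have hR := h.prod_erase_ne hj
    have hdet := h.det_ne j hx hj
    set R := ∏ i ∈ Finset.univ.erase j, circlePower c r i z.1
    set D := z.1 0 * c j 1 - z.1 1 * c j 0
    -- Cramer's rule for the gradients `-2x` and `2R(x - c j)`; the determinant of `x` and `x - c j`
    -- is `-D`.
    refine key (!₂[((c j 1 - z.1 1) * (- b 0 / 2) + z.1 1 * (b 1 / (2 * R))) / D,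
      ((z.1 0 - c j 0) * (- b 0 / 2) - z.1 0 * (b 1 / (2 * R))) / D], 0) ?_ ?_
    · simp
      field_simp
      simp only [D]
      ring
    · rw [fderiv_prod_circlePower c r hj]
      simp
      field_simp
      simp only [D]
      ring
  · have hx := norm_eq_one_of_diskEq hz h0
    have hx2 := norm_sq_eq_coords z.1
    rw [hx] at hx2
    obtain ⟨v, hv⟩ := exists_inner_eq h1
      ((fderiv ℝ (fun x => ∏ i, circlePower c r i x) z.1 ((-b 0 / 2) • z.1) - b 1) / 2)
    refine key ((-b 0 / 2) • z.1, pairVec 0 v) ?_ ?_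
    · simp [pairVec]
      linear_combination (- b 0) * hx2
    · simp only [pairVec, hv]
      ring
  · obtain ⟨j, hj⟩ := exists_circlePower_eq_zero hz h1
    have hR := h.prod_erase_ne hj
    have hr := (h.radius_pos j).ne'
    have hj' := hj
    rw [circlePower_eq_coords] at hj'
    set R := ∏ i ∈ Finset.univ.erase j, circlePower c r i z.1 with hRdef
    -- On the `j`-th circle the derivative of the product along the radial vector `x - c j` is `2 *
    -- R * r j ^ 2`.
    set u := (b 1 / (2 * R * r j ^ 2)) • (z.1 - c j) with hu
    obtain ⟨v, hv⟩ := exists_inner_eq h0 (- (z.1 0 * u 0 + z.1 1 * u 1) - b 0 / 2)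
    refine key (u, pairVec v 0) ?_ ?_
    · simp only [pairVec, hv]
      ring
    · rw [fderiv_prod_circlePower c r hj, ← hRdef]
      simp [pairVec, hu]
      field_simp
      linear_combination (b 1) * hj'
  · obtain ⟨v, hv⟩ := exists_inner_eq h0 (-b 0 / 2)
    obtain ⟨v', hv'⟩ := exists_inner_eq h1 (-b 1 / 2)
    refine key (0, pairVec v v') ?_ ?_
    · simp [pairVec, hv]
      ring
    · simp [pairVec, hv']
      ring

/-- A factor with nonzero vector puts no constraint on the planar component of a tangent vector; a
vanishing one forces that component to be tangent to the curve through `x`. With no curve the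
horizontal direction lifts. With one curve the point is singular exactly when the tangent is
vertical. With two transversal curves the planar component is zero. -/
theorem TransversalAt.isSingularPointOn_iff {z : MomentAmbient 2 m} (h : TransversalAt c r z.1)
    (hz : diskEq c r m z = 0) :
    IsSingularPointOn (diskEq c r m) (firstCoord m) z ↔
      (‖z.1‖ = 1 ∧ z.1 1 = 0) ∨ ∃ j, circlePower c r j z.1 = 0 ∧ (z.1 1 = c j 1 ∨ ‖z.1‖ = 1) := by
  obtain ⟨hz0, hz1⟩ := (diskEq_eq_zero_iff c r m z).1 hz
  constructor
  · intro hs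
    have key : ∀ w : MomentAmbient 2 m,
        -2 * (z.1 0 * w.1 0 + z.1 1 * w.1 1) - 2 * inner ℝ (z.2 0) (w.2 0) = 0 →
        fderiv ℝ (fun x => ∏ i, circlePower c r i x) z.1 w.1 - 2 * inner ℝ (z.2 1) (w.2 1) = 0 →
        w.1 0 = 0 := by
      intro w h0 h1
      rw [← fderiv_firstCoord m z w]
      refine hs w (funext (Fin.forall_fin_two.2 ⟨?_, ?_⟩))
      · rw [(fderiv_diskEq c r m z w).1, h0]; rfl
      · rw [(fderiv_diskEq c r m z w).2, h1]; rfl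
    by_cases h0 : z.2 0 = 0 <;> by_cases h1 : z.2 1 = 0
    · obtain ⟨j, hj⟩ := exists_circlePower_eq_zero hz h1
      exact Or.inr ⟨j, hj, Or.inr (norm_eq_one_of_diskEq hz h0)⟩
    · refine Or.inl ⟨norm_eq_one_of_diskEq hz h0, ?_⟩
      obtain ⟨v, hv⟩ := exists_inner_eq h1
        (fderiv ℝ (fun x => ∏ i, circlePower c r i x) z.1 !₂[z.1 1, -z.1 0] / 2)
      refine key (!₂[z.1 1, -z.1 0], pairVec 0 v) ?_ ?_
      · simp [pairVec]
        ring
      · simp only [pairVec, hv]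
        ring
    · obtain ⟨j, hj⟩ := exists_circlePower_eq_zero hz h1
      refine Or.inr ⟨j, hj, Or.inl ?_⟩
      set u : EuclideanSpace ℝ (Fin 2) := !₂[z.1 1 - c j 1, -(z.1 0 - c j 0)] with hu
      obtain ⟨v, hv⟩ := exists_inner_eq h0 (- (z.1 0 * u 0 + z.1 1 * u 1))
      have := key (u, pairVec v 0) (by simp only [pairVec, hv]; ring) (by
        rw [fderiv_prod_circlePower c r hj]
        simp [pairVec, hu]
        right
        ring)
      simp only [hu] at this
      simpa [sub_eq_zero] using this
    · exfalso
      obtain ⟨v, hv⟩ := exists_inner_eq h0 (- z.1 0)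
      obtain ⟨v', hv'⟩ := exists_inner_eq h1
        (fderiv ℝ (fun x => ∏ i, circlePower c r i x) z.1 !₂[1, 0] / 2)
      have := key (!₂[1, 0], pairVec v v') (by simp [pairVec, hv]) (by
        simp only [pairVec, hv']
        ring)
      simp at this
  · intro hcase w hw
    rw [fderiv_firstCoord]
    obtain ⟨e0, e1⟩ := fderiv_diskEq c r m z w
    rw [hw] at e0 e1
    simp only [Pi.zero_apply] at e0 e1
    have hy0 : ‖z.1‖ = 1 → z.1 0 * w.1 0 + z.1 1 * w.1 1 = 0 := by
      intro hx
      rw [hx] at hz0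
      have : z.2 0 = 0 := by
        rw [← norm_eq_zero]
        exact pow_eq_zero_iff two_ne_zero |>.1 (by linarith)
      rw [this, inner_zero_left] at e0
      linarith
    have hy1 : ∀ j, circlePower c r j z.1 = 0 →
        (z.1 0 - c j 0) * w.1 0 + (z.1 1 - c j 1) * w.1 1 = 0 := by
      intro j hj
      rw [Finset.prod_eq_zero (Finset.mem_univ j) hj] at hz1
      have : z.2 1 = 0 := by
        rw [← norm_eq_zero]
        exact pow_eq_zero_iff two_ne_zero |>.1 hz1.symm
      rw [this, inner_zero_left, fderiv_prod_circlePower c r hj] at e1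
      have := h.prod_erase_ne hj
      simp only [mul_zero, sub_zero, zero_eq_mul, this, false_or] at e1
      linarith
    rcases hcase with ⟨hx, hx1⟩ | ⟨j, hj, hx | hx⟩
    · have h2 := norm_sq_eq_coords z.1
      have h3 := hy0 hx
      rw [hx, hx1] at h2
      rw [hx1, zero_mul, add_zero] at h3
      refine (mul_eq_zero.1 h3).resolve_left fun h4 => ?_
      rw [h4] at h2
      norm_num at h2
    · have h3 := hy1 j hj
      rw [circlePower_eq_coords] at hj
      rw [hx, sub_self] at h3 hj
      rw [zero_mul, add_zero] at h3
      refine (mul_eq_zero.1 h3).resolve_left fun h4 => ?_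
      rw [h4] at hj
      nlinarith [h.radius_pos j]
    · have h3 := hy1 j hj
      have h4 := hy0 hx
      -- Eliminating `w.1 1` from the two tangency equations leaves the determinant times `w.1 0`.
      refine (mul_eq_zero.1 (?_ : (z.1 0 * c j 1 - z.1 1 * c j 0) * w.1 0 = 0)).resolve_left
        (h.det_ne j hx hj)
      linear_combination (c j 1 - z.1 1) * h4 + z.1 1 * h3

end Equations

/-! ### Plane geometry of one circle centred on the unit circle -/

section Cap

/-- The cosine of the angular radius of a circle of radius `r` centred on the unit circle. -/
noncomputable def capCos (r : ℝ) : ℝ := 1 - r ^ 2 / 2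

/-- The sine of the angular radius of a circle of radius `r` centred on the unit circle. -/
noncomputable def capSin (r : ℝ) : ℝ := √(1 - capCos r ^ 2)

/-- A circle centred at the point `(a, b)` of the open first quadrant of the unit circle, of
radius `r`, which contains neither horizontal pole of the unit circle and whose left pole is in
the open unit disk. -/
structure IsCap (a b r : ℝ) : Prop where
  a_pos : 0 < a
  b_pos : 0 < b
  norm_eq : a ^ 2 + b ^ 2 = 1
  r_pos : 0 < r
  r_lt : r < 2 * a
  a_lt : a < capCos r

variable {a b r : ℝ}

namespace IsCap

theorem capCos_lt (h : IsCap a b r) : capCos r < 1 := by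
  have := h.r_pos
  unfold capCos
  nlinarith

theorem capCos_pos (h : IsCap a b r) : 0 < capCos r := h.a_pos.trans h.a_lt

theorem capSin_sq (h : IsCap a b r) : capSin r ^ 2 = 1 - capCos r ^ 2 :=
  Real.sq_sqrt (by nlinarith [h.capCos_lt, h.capCos_pos])

theorem capSin_pos (h : IsCap a b r) : 0 < capSin r :=
  Real.sqrt_pos.2 (by nlinarith [h.capCos_lt, h.capCos_pos])

theorem capSin_lt (h : IsCap a b r) : capSin r < b := by
  refine lt_of_pow_lt_pow_left₀ 2 h.b_pos.le ?_
  nlinarith [h.capSin_sq, h.norm_eq, h.a_lt, h.a_pos]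

/-- The tip is the centre rotated by the angular radius away from `(1, 0)`. After squaring and
division by `1 - capCos r`, the claim becomes `r ^ 2 < 4 * a ^ 2`. -/
theorem b_lt_tip_snd (h : IsCap a b r) : b < capCos r * b + capSin r * a := by
  have h1 : (1 - capCos r) * b < capSin r * a := by
    refine lt_of_pow_lt_pow_left₀ 2 (mul_pos h.capSin_pos h.a_pos).le ?_
    have e1 : ((1 - capCos r) * b) ^ 2 = (1 - capCos r) * ((1 - capCos r) * (1 - a ^ 2)) := by
      rw [← h.norm_eq]; ring
    have e2 : (capSin r * a) ^ 2 = (1 - capCos r) * ((1 + capCos r) * a ^ 2) := by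
      rw [mul_pow, h.capSin_sq]; ring
    rw [e1, e2]
    refine mul_lt_mul_of_pos_left ?_ (by linarith [h.capCos_lt])
    have : 1 - capCos r = r ^ 2 / 2 := by unfold capCos; ring
    nlinarith [h.r_lt, h.r_pos]
  linarith

theorem tip_lt_a (h : IsCap a b r) : capCos r * a - capSin r * b < a := by
  nlinarith [h.capCos_lt, h.a_pos, mul_pos h.capSin_pos h.b_pos]

/-- The tip lies on the circle but not at the height of the centre, so its horizontal distance from
the centre is less than `r`. -/
theorem pole_lt_tip (h : IsCap a b r) : a - r < capCos r * a - capSin r * b := by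
  have h1 : a - (capCos r * a - capSin r * b) < r := by
    refine lt_of_pow_lt_pow_left₀ 2 h.r_pos.le ?_
    have e : (a - (capCos r * a - capSin r * b)) ^ 2 +
        (capCos r * b + capSin r * a - b) ^ 2 = r ^ 2 := by
      have : r ^ 2 = 2 - 2 * capCos r := by unfold capCos; ring
      rw [this]
      linear_combination (1 - 2 * capCos r + capCos r ^ 2 + capSin r ^ 2) * h.norm_eq +
        h.capSin_sq
    nlinarith [h.b_lt_tip_snd]
  linarith

/-- With `C = capCos r` and `S = capSin r`: `S * b > S ^ 2 = (1 - C) * (1 + C) > (1 - C) * a`. -/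
theorem a_lt_base (h : IsCap a b r) : a < capCos r * a + capSin r * b := by
  have h1 := h.capSin_sq
  have h2 := mul_lt_mul_of_pos_left h.capSin_lt h.capSin_pos
  have h3 : a < 1 := h.a_lt.trans h.capCos_lt
  have h4 := h.capCos_lt
  nlinarith [h.capCos_pos, mul_pos (sub_pos.2 h4) h.capCos_pos,
    mul_pos (sub_pos.2 h4) (sub_pos.2 h3)]

theorem tip_lt_base (h : IsCap a b r) :
    capCos r * a - capSin r * b < capCos r * a + capSin r * b := h.tip_lt_a.trans h.a_lt_base

theorem base_lt_one (h : IsCap a b r) : capCos r * a + capSin r * b < 1 := by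
  have h1 : 0 < capCos r * b - capSin r * a := by
    nlinarith [h.capSin_lt, h.a_lt, h.a_pos, h.b_pos, h.capSin_pos]
  have e : (capCos r * a + capSin r * b) ^ 2 + (capCos r * b - capSin r * a) ^ 2 = 1 := by
    linear_combination (capCos r ^ 2 + capSin r ^ 2) * h.norm_eq + h.capSin_sq
  nlinarith

theorem neg_one_lt_pole (h : IsCap a b r) : -1 < a - r := by
  linarith [h.r_lt, h.a_lt, h.capCos_lt]

/-- On the unit circle the power is affine in the point, and its sign compares the angular distance
from the centre with the angular radius. -/
theorem power_unit (h : IsCap a b r) {t u : ℝ} (htu : t ^ 2 + u ^ 2 = 1) :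
    (t - a) ^ 2 + (u - b) ^ 2 - r ^ 2 = 2 * (capCos r - t * a - u * b) := by
  unfold capCos
  linear_combination htu + h.norm_eq

theorem power_bottom (h : IsCap a b r) {t u : ℝ} (htu : t ^ 2 + u ^ 2 = 1) (hu : u ≤ 0) :
    0 < (t - a) ^ 2 + (u - b) ^ 2 - r ^ 2 := by
  rw [h.power_unit htu]
  have : t ≤ 1 := by nlinarith
  nlinarith [h.a_lt, h.a_pos, h.b_pos]

/-- Multiplication by the conjugate factor, with `u` replaced by `-u`, makes the power a quadratic
in `t` with roots tip and base. That factor is positive on the upper half, so there the sign of the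
power is known from the abscissa. -/
theorem exists_power_top (h : IsCap a b r) {t u : ℝ} (htu : t ^ 2 + u ^ 2 = 1) (hu : 0 ≤ u) :
    ∃ q > 0, (t - (capCos r * a - capSin r * b)) * (t - (capCos r * a + capSin r * b)) =
      q * ((t - a) ^ 2 + (u - b) ^ 2 - r ^ 2) := by
  refine ⟨(capCos r - t * a + u * b) / 2, ?_, ?_⟩
  · have : t ≤ 1 := by nlinarith
    nlinarith [h.a_lt, h.a_pos, mul_nonneg hu h.b_pos.le]
  · rw [h.power_unit htu]
    have e := h.capSin_sq
    have e' := h.norm_eq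
    linear_combination (-b ^ 2) * e + b ^ 2 * htu + (capCos r ^ 2 - t ^ 2) * e'

theorem b_le_of_sq_le (h : IsCap a b r) {t u : ℝ} (htu : t ^ 2 + u ^ 2 = 1) (hu : 0 ≤ u)
    (ht : t ^ 2 ≤ a ^ 2) : b ≤ u :=
  le_of_sq_le_sq (by nlinarith [h.norm_eq]) hu

theorem u_lt_b (h : IsCap a b r) {t u : ℝ} (htu : t ^ 2 + u ^ 2 = 1) (ht : a < t) : u < b := by
  by_contra! hu
  nlinarith [h.norm_eq, h.a_pos, h.b_pos]

theorem exists_top {t y : ℝ} (hty : t ^ 2 + y ^ 2 ≤ 1) :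
    ∃ u, 0 ≤ u ∧ t ^ 2 + u ^ 2 = 1 ∧ y ≤ u := by
  refine ⟨√(1 - t ^ 2), Real.sqrt_nonneg _, ?_, ?_⟩
  · rw [Real.sq_sqrt (by nlinarith [sq_nonneg y])]
    ring
  · exact Real.le_sqrt_of_sq_le (by linarith)

/-- Left of the pole the horizontal distance alone suffices. Right of the base the arc is below the
height `b`, so moving down from the arc only increases the power. -/
theorem power_nonneg (h : IsCap a b r) {t y : ℝ} (hty : t ^ 2 + y ^ 2 ≤ 1)
    (ht : t ≤ a - r ∨ capCos r * a + capSin r * b ≤ t) :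
    0 ≤ (t - a) ^ 2 + (y - b) ^ 2 - r ^ 2 := by
  rcases ht with ht | ht
  · nlinarith [h.r_pos, sq_nonneg (y - b)]
  · obtain ⟨u, hu, htu, hyu⟩ := exists_top hty
    obtain ⟨q, hq, e⟩ := h.exists_power_top htu hu
    have hb := h.u_lt_b htu (h.a_lt_base.trans_le ht)
    have : 0 ≤ q * ((t - a) ^ 2 + (u - b) ^ 2 - r ^ 2) := by
      rw [← e]
      exact mul_nonneg (by linarith [h.tip_lt_base]) (by linarith)
    have := nonneg_of_mul_nonneg_right this hq
    nlinarith

theorem power_pos (h : IsCap a b r) {t y : ℝ} (hty : t ^ 2 + y ^ 2 ≤ 1)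
    (ht : t < a - r ∨ capCos r * a + capSin r * b < t) :
    0 < (t - a) ^ 2 + (y - b) ^ 2 - r ^ 2 := by
  rcases ht with ht | ht
  · nlinarith [h.r_pos, sq_nonneg (y - b)]
  · obtain ⟨u, hu, htu, hyu⟩ := exists_top hty
    obtain ⟨q, hq, e⟩ := h.exists_power_top htu hu
    have hb := h.u_lt_b htu (h.a_lt_base.trans ht)
    have : 0 < q * ((t - a) ^ 2 + (u - b) ^ 2 - r ^ 2) := by
      rw [← e]
      exact mul_pos (by linarith [h.tip_lt_base]) (by linarith)
    have := pos_of_mul_pos_right this hq.le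
    nlinarith

/-- Above the height `b` the power grows with `y`, so it is nonnegative at the arc point over `t` as
well, and `t` cannot lie strictly between tip and base. At height exactly `b` the power would be
negative. -/
theorem upper (h : IsCap a b r) {t y : ℝ} (hty : t ^ 2 + y ^ 2 ≤ 1) (h1 : a - r < t)
    (h2 : t < capCos r * a + capSin r * b) (hQ : 0 ≤ (t - a) ^ 2 + (y - b) ^ 2 - r ^ 2)
    (hy : b ≤ y) : t ≤ capCos r * a - capSin r * b ∧ b < y := by
  obtain ⟨u, hu, htu, hyu⟩ := exists_top hty
  obtain ⟨q, hq, e⟩ := h.exists_power_top htu hu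
  have hQu : 0 ≤ (t - a) ^ 2 + (u - b) ^ 2 - r ^ 2 := by nlinarith
  have ht : t ≤ capCos r * a - capSin r * b := by
    by_contra! hcon
    have := mul_nonneg hq.le hQu
    rw [← e] at this
    nlinarith
  refine ⟨ht, lt_of_le_of_ne hy fun hby => ?_⟩
  rw [← hby] at hQ
  nlinarith [h.tip_lt_a]

theorem top (h : IsCap a b r) {t u : ℝ} (htu : t ^ 2 + u ^ 2 = 1) (hu : 0 ≤ u)
    (h1 : a - r ≤ t) (h2 : t ≤ capCos r * a - capSin r * b) :
    b ≤ u ∧ 0 ≤ (t - a) ^ 2 + (u - b) ^ 2 - r ^ 2 := by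
  constructor
  · refine h.b_le_of_sq_le htu hu (sq_le_sq' ?_ ?_)
    · linarith [h.r_lt]
    · linarith [h.tip_lt_a]
  · obtain ⟨q, hq, e⟩ := h.exists_power_top htu hu
    refine nonneg_of_mul_nonneg_right (a := q) ?_ hq
    rw [← e]
    nlinarith [h.tip_lt_base]

theorem eq_pole (h : IsCap a b r) {t y : ℝ} (hty : t ^ 2 + y ^ 2 ≤ 1) (hy : y = b)
    (hQ : (t - a) ^ 2 + (y - b) ^ 2 - r ^ 2 = 0) : t = a - r := by
  subst hy
  have : (t - (a - r)) * (t - (a + r)) = 0 := by linear_combination hQ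
  rcases mul_eq_zero.1 this with h1 | h1
  · linarith
  -- The other vertical pole is outside the unit disk.
  · have : t = a + r := by linarith
    subst this
    nlinarith [h.norm_eq, h.a_pos, h.r_pos]

theorem pole_inside (h : IsCap a b r) : (a - r) ^ 2 + b ^ 2 < 1 := by
  nlinarith [h.norm_eq, h.r_lt, h.r_pos]

theorem eq_tip_or_base (h : IsCap a b r) {t u : ℝ} (htu : t ^ 2 + u ^ 2 = 1)
    (hQ : (t - a) ^ 2 + (u - b) ^ 2 - r ^ 2 = 0) :
    0 < u ∧ (t = capCos r * a - capSin r * b ∨ t = capCos r * a + capSin r * b) := by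
  have hu : 0 < u := by
    by_contra! hu
    exact (h.power_bottom htu hu).ne' hQ
  refine ⟨hu, ?_⟩
  obtain ⟨q, hq, e⟩ := h.exists_power_top htu hu.le
  rw [hQ, mul_zero] at e
  rcases mul_eq_zero.1 e with h1 | h1
  · exact Or.inl (by linarith)
  · exact Or.inr (by linarith)

theorem power_tip_base (h : IsCap a b r) {t u : ℝ} (htu : t ^ 2 + u ^ 2 = 1) (hu : 0 ≤ u)
    (ht : t = capCos r * a - capSin r * b ∨ t = capCos r * a + capSin r * b) :
    (t - a) ^ 2 + (u - b) ^ 2 - r ^ 2 = 0 := by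
  obtain ⟨q, hq, e⟩ := h.exists_power_top htu hu
  refine (mul_eq_zero.1 (e.symm.trans ?_)).resolve_left hq.ne'
  rcases ht with rfl | rfl <;> ring

/-- If the point were parallel to the centre, their inner product `capCos r` would be `±1`, whereas
it lies strictly between 0 and 1. -/
theorem det_ne_zero (h : IsCap a b r) {t u : ℝ} (htu : t ^ 2 + u ^ 2 = 1)
    (hQ : (t - a) ^ 2 + (u - b) ^ 2 - r ^ 2 = 0) : t * b - u * a ≠ 0 := by
  intro h0
  rw [h.power_unit htu] at hQ
  have e : (t * a + u * b) ^ 2 + (t * b - u * a) ^ 2 = 1 := by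
    linear_combination (a ^ 2 + b ^ 2) * htu + h.norm_eq
  rw [h0, show t * a + u * b = capCos r by linarith] at e
  nlinarith [h.capCos_lt, h.capCos_pos]

end IsCap

/-- The position of a circle relative to the unit disk in terms of the first coordinates: `pole`
is the first coordinate of its vertical pole in the disk, `tip` and `base` are those of its
intersection points with the unit circle, `[lo, hi]` is the projection of its part in the disk,
and `[lt, rt]` is the projection of the part of the disk cut off between circle and arc. -/
structure CapGeometry (ε c₀ c₁ r lo hi lt rt pole tip base : ℝ) : Prop where
  order : (0 < c₀ ∧ pole = c₀ - r ∧ lo = pole ∧ hi = base ∧ lt = pole ∧ rt = tip) ∨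
    (c₀ < 0 ∧ pole = c₀ + r ∧ hi = pole ∧ lo = base ∧ lt = tip ∧ rt = pole)
  neg_one_lt_lo : -1 < lo
  lo_lt_tip : lo < tip
  tip_lt_hi : tip < hi
  hi_lt_one : hi < 1
  lo_lt_center : lo < c₀
  center_lt_hi : c₀ < hi
  power_nonneg : ∀ {x y : ℝ}, x ^ 2 + y ^ 2 ≤ 1 → x ≤ lo ∨ hi ≤ x →
    0 ≤ (x - c₀) ^ 2 + (y - c₁) ^ 2 - r ^ 2
  power_pos : ∀ {x y : ℝ}, x ^ 2 + y ^ 2 ≤ 1 → x < lo ∨ hi < x →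
    0 < (x - c₀) ^ 2 + (y - c₁) ^ 2 - r ^ 2
  power_bottom : ∀ {x y : ℝ}, x ^ 2 + y ^ 2 = 1 → ε * y ≤ 0 →
    0 < (x - c₀) ^ 2 + (y - c₁) ^ 2 - r ^ 2
  upper : ∀ {x y : ℝ}, x ^ 2 + y ^ 2 ≤ 1 → lo < x → x < hi →
    0 ≤ (x - c₀) ^ 2 + (y - c₁) ^ 2 - r ^ 2 → ε * c₁ ≤ ε * y →
    x ∈ Set.Icc lt rt ∧ ε * c₁ < ε * y
  top : ∀ {x y : ℝ}, x ^ 2 + y ^ 2 = 1 → 0 ≤ ε * y → x ∈ Set.Icc lt rt →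
    ε * c₁ ≤ ε * y ∧ 0 ≤ (x - c₀) ^ 2 + (y - c₁) ^ 2 - r ^ 2
  eq_pole : ∀ {x y : ℝ}, x ^ 2 + y ^ 2 ≤ 1 → y = c₁ →
    (x - c₀) ^ 2 + (y - c₁) ^ 2 - r ^ 2 = 0 → x = pole
  pole_inside : pole ^ 2 + c₁ ^ 2 < 1
  eq_tip_or_base : ∀ {x y : ℝ}, x ^ 2 + y ^ 2 = 1 →
    (x - c₀) ^ 2 + (y - c₁) ^ 2 - r ^ 2 = 0 → 0 < ε * y ∧ (x = tip ∨ x = base)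
  power_tip_base : ∀ {x y : ℝ}, x ^ 2 + y ^ 2 = 1 → 0 ≤ ε * y → x = tip ∨ x = base →
    (x - c₀) ^ 2 + (y - c₁) ^ 2 - r ^ 2 = 0
  det_ne_zero : ∀ {x y : ℝ}, x ^ 2 + y ^ 2 = 1 →
    (x - c₀) ^ 2 + (y - c₁) ^ 2 - r ^ 2 = 0 → x * c₁ - y * c₀ ≠ 0

/-- Reflections in the axes reduce all positions to the first quadrant. The horizontal reflection
exchanges left and right, so the pole becomes the right end and the base the left end. -/
theorem exists_capGeometry {ε c₀ c₁ r : ℝ} (hε : ε = 1 ∨ ε = -1) (hc : c₀ ≠ 0)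
    (h : IsCap |c₀| (ε * c₁) r) :
    ∃ lo hi lt rt pole tip base, CapGeometry ε c₀ c₁ r lo hi lt rt pole tip base := by
  have hε2 : ε ^ 2 = 1 := by rcases hε with rfl | rfl <;> norm_num
  have hsq : ∀ y, (ε * y) ^ 2 = y ^ 2 := fun y => by rw [mul_pow, hε2, one_mul]
  have hsq' : ∀ y, (ε * y - ε * c₁) ^ 2 = (y - c₁) ^ 2 := fun y => by
    rw [← mul_sub, mul_pow, hε2, one_mul]
  rcases lt_or_gt_of_ne hc with hneg | hpos
  · rw [abs_of_neg hneg] at h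
    have hflip : ∀ x, (-x - -c₀) ^ 2 = (x - c₀) ^ 2 := fun x => by ring
    refine ⟨-(capCos r * -c₀ + capSin r * (ε * c₁)), -(-c₀ - r),
      -(capCos r * -c₀ - capSin r * (ε * c₁)), -(-c₀ - r), -(-c₀ - r),
      -(capCos r * -c₀ - capSin r * (ε * c₁)), -(capCos r * -c₀ + capSin r * (ε * c₁)), ?_⟩
    constructor
    case order => exact Or.inr ⟨hneg, by ring, rfl, rfl, rfl, rfl⟩
    case neg_one_lt_lo => linarith [h.base_lt_one]
    case lo_lt_tip => linarith [h.tip_lt_base]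
    case tip_lt_hi => linarith [h.pole_lt_tip]
    case hi_lt_one => linarith [h.neg_one_lt_pole]
    case lo_lt_center => linarith [h.a_lt_base]
    case center_lt_hi => linarith [h.r_pos]
    case power_nonneg =>
      intro x y hxy hx
      have := h.power_nonneg (t := -x) (y := ε * y) (by rwa [hsq, neg_sq])
        (hx.symm.imp (fun _ => by linarith) fun _ => by linarith)
      rwa [hsq', hflip] at this
    case power_pos =>
      intro x y hxy hx
      have := h.power_pos (t := -x) (y := ε * y) (by rwa [hsq, neg_sq])
        (hx.symm.imp (fun _ => by linarith) fun _ => by linarith)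
      rwa [hsq', hflip] at this
    case power_bottom =>
      intro x y hxy hy
      have := h.power_bottom (t := -x) (u := ε * y) (by rwa [hsq, neg_sq]) hy
      rwa [hsq', hflip] at this
    case upper =>
      intro x y hxy h1 h2 hQ hy
      have := h.upper (t := -x) (y := ε * y) (by rwa [hsq, neg_sq]) (by linarith) (by linarith)
        (by rwa [hsq', hflip]) hy
      exact ⟨⟨by linarith [this.1], h2.le⟩, this.2⟩
    case top =>
      intro x y hxy hy hx
      have := h.top (t := -x) (u := ε * y) (by rwa [hsq, neg_sq]) hy (by linarith [hx.2])
        (by linarith [hx.1])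
      rwa [hsq', hflip] at this
    case eq_pole =>
      intro x y hxy hy hQ
      have := h.eq_pole (t := -x) (y := ε * y) (by rwa [hsq, neg_sq]) (by rw [hy])
        (by rwa [hsq', hflip])
      linarith
    case pole_inside =>
      have := h.pole_inside
      rwa [hsq, ← neg_sq] at this
    case eq_tip_or_base =>
      intro x y hxy hQ
      have := h.eq_tip_or_base (t := -x) (u := ε * y) (by rwa [hsq, neg_sq])
        (by rwa [hsq', hflip])
      exact ⟨this.1, this.2.imp (fun _ => by linarith) fun _ => by linarith⟩
    case power_tip_base =>
      intro x y hxy hy hx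
      have := h.power_tip_base (t := -x) (u := ε * y) (by rwa [hsq, neg_sq]) hy
        (hx.imp (fun _ => by linarith) fun _ => by linarith)
      rwa [hsq', hflip] at this
    case det_ne_zero =>
      intro x y hxy hQ h0
      refine h.det_ne_zero (t := -x) (u := ε * y) (by rwa [hsq, neg_sq]) (by rwa [hsq', hflip]) ?_
      linear_combination (-ε) * h0
  · rw [abs_of_pos hpos] at h
    refine ⟨c₀ - r, capCos r * c₀ + capSin r * (ε * c₁), c₀ - r,
      capCos r * c₀ - capSin r * (ε * c₁), c₀ - r,
      capCos r * c₀ - capSin r * (ε * c₁), capCos r * c₀ + capSin r * (ε * c₁), ?_⟩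
    constructor
    case order => exact Or.inl ⟨hpos, rfl, rfl, rfl, rfl, rfl⟩
    case neg_one_lt_lo => exact h.neg_one_lt_pole
    case lo_lt_tip => exact h.pole_lt_tip
    case tip_lt_hi => exact h.tip_lt_base
    case hi_lt_one => exact h.base_lt_one
    case lo_lt_center => linarith [h.r_pos]
    case center_lt_hi => exact h.a_lt_base
    case power_nonneg =>
      intro x y hxy hx
      have := h.power_nonneg (t := x) (y := ε * y) (by rwa [hsq]) hx
      rwa [hsq'] at this
    case power_pos =>
      intro x y hxy hx
      have := h.power_pos (t := x) (y := ε * y) (by rwa [hsq]) hx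
      rwa [hsq'] at this
    case power_bottom =>
      intro x y hxy hy
      have := h.power_bottom (t := x) (u := ε * y) (by rwa [hsq]) hy
      rwa [hsq'] at this
    case upper =>
      intro x y hxy h1 h2 hQ hy
      have := h.upper (t := x) (y := ε * y) (by rwa [hsq]) h1 h2 (by rwa [hsq']) hy
      exact ⟨⟨h1.le, this.1⟩, this.2⟩
    case top =>
      intro x y hxy hy hx
      have := h.top (t := x) (u := ε * y) (by rwa [hsq]) hy hx.1 hx.2
      rwa [hsq'] at this
    case eq_pole =>
      intro x y hxy hy hQ
      exact h.eq_pole (t := x) (y := ε * y) (by rwa [hsq]) (by rw [hy]) (by rwa [hsq'])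
    case pole_inside =>
      have := h.pole_inside
      rwa [hsq] at this
    case eq_tip_or_base =>
      intro x y hxy hQ
      exact h.eq_tip_or_base (t := x) (u := ε * y) (by rwa [hsq]) (by rwa [hsq'])
    case power_tip_base =>
      intro x y hxy hy hx
      have := h.power_tip_base (t := x) (u := ε * y) (by rwa [hsq]) hy hx
      rwa [hsq'] at this
    case det_ne_zero =>
      intro x y hxy hQ h0
      refine h.det_ne_zero (t := x) (u := ε * y) (by rwa [hsq]) (by rwa [hsq']) ?_
      linear_combination ε * h0

theorem CapGeometry.exists_intersection {ε c₀ c₁ r lo hi lt rt pole tip base : ℝ}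
    (h : CapGeometry ε c₀ c₁ r lo hi lt rt pole tip base) (hε : ε ^ 2 = 1) {t : ℝ}
    (ht : t = tip ∨ t = base) :
    ∃ y, t ^ 2 + y ^ 2 = 1 ∧ 0 ≤ ε * y ∧ (t - c₀) ^ 2 + (y - c₁) ^ 2 - r ^ 2 = 0 := by
  have hmem : -1 ≤ t ∧ t ≤ 1 := by
    have h1 := h.neg_one_lt_lo
    have h2 := h.hi_lt_one
    have h3 := h.lo_lt_tip
    have h4 := h.tip_lt_hi
    rcases ht with rfl | rfl <;> rcases h.order with h | h <;> constructor <;>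
      linarith [h.2.2.2.1]
  have hnn : 0 ≤ 1 - t ^ 2 := by nlinarith [hmem.1, hmem.2]
  have hsq : t ^ 2 + (ε * √(1 - t ^ 2)) ^ 2 = 1 := by
    rw [mul_pow, hε, Real.sq_sqrt hnn]
    ring
  have hpos : 0 ≤ ε * (ε * √(1 - t ^ 2)) := by
    rw [← mul_assoc, ← pow_two, hε, one_mul]
    exact Real.sqrt_nonneg _
  exact ⟨ε * √(1 - t ^ 2), hsq, hpos, h.power_tip_base hsq hpos ht⟩

end Cap

/-- A family of circles centred on the half `{ε x₁ > 0}` of the unit circle, ordered from left to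
right, the first `j₁` centres being those with negative first coordinate, together with the
coordinates describing their position. -/
structure CapSystem (ε : ℝ) (j₁ j₂ : ℕ) (c : Fin (j₁ + j₂) → EuclideanSpace ℝ (Fin 2))
    (r : Fin (j₁ + j₂) → ℝ) where
  lo : Fin (j₁ + j₂) → ℝ
  hi : Fin (j₁ + j₂) → ℝ
  lt : Fin (j₁ + j₂) → ℝ
  rt : Fin (j₁ + j₂) → ℝ
  pole : Fin (j₁ + j₂) → ℝ
  tip : Fin (j₁ + j₂) → ℝ
  base : Fin (j₁ + j₂) → ℝ
  cap : ∀ j, CapGeometry ε (c j 0) (c j 1) (r j) (lo j) (hi j) (lt j) (rt j) (pole j) (tip j)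
    (base j)
  sign : ε = 1 ∨ ε = -1
  center_pos : ∀ j, 0 < ε * c j 1
  radius_pos : ∀ j, 0 < r j
  hi_lt_lo : ∀ i j, i < j → hi i < lo j
  center_neg : ∀ j, c j 0 < 0 ↔ (j : ℕ) < j₁

/-- The closed unit disk without the open disks bounded by the circles. -/
def closedRegion {n : ℕ} (c : Fin n → EuclideanSpace ℝ (Fin 2)) (r : Fin n → ℝ) :
    Set (EuclideanSpace ℝ (Fin 2)) :=
  {x | x 0 ^ 2 + x 1 ^ 2 ≤ 1 ∧ ∀ j, 0 ≤ circlePower c r j x}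

theorem coord_mem_Icc_of_mem_closedRegion {n : ℕ} {c : Fin n → EuclideanSpace ℝ (Fin 2)}
    {r : Fin n → ℝ} {x : EuclideanSpace ℝ (Fin 2)} (hx : x ∈ closedRegion c r) :
    x 0 ∈ Set.Icc (-1 : ℝ) 1 := by
  have := hx.1
  constructor <;> nlinarith [sq_nonneg (x 1)]

theorem isPreconnected_of_slice {t : ℝ} {A : Set (EuclideanSpace ℝ (Fin 2))}
    (hA : ∀ x ∈ A, x 0 = t) (hord : {u : ℝ | !₂[t, u] ∈ A}.OrdConnected) : IsPreconnected A := by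
  have : A = (fun u : ℝ => !₂[t, u]) '' {u : ℝ | !₂[t, u] ∈ A} := by
    ext x
    constructor
    · intro hx
      have e : !₂[t, x 1] = x := by
        ext i
        fin_cases i
        · simp [hA x hx]
        · simp
      exact ⟨x 1, by rw [Set.mem_ofPred_eq, e]; exact hx, e⟩
    · rintro ⟨u, hu, rfl⟩
      exact hu
  rw [this]
  refine hord.isPreconnected.image _ (Continuous.continuousOn ?_)
  refine (PiLp.continuous_toLp 2 _).comp (continuous_pi fun i => ?_)
  fin_cases i
  · exact continuous_const
  · exact continuous_id

theorem exists_mem_diskManifold {n : ℕ} {c : Fin n → EuclideanSpace ℝ (Fin 2)} {r : Fin n → ℝ}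
    {m : Fin 2 → ℕ} {x : EuclideanSpace ℝ (Fin 2)} (hx : x ∈ closedRegion c r) :
    ∃ z ∈ diskManifold c r m, z.1 = x := by
  refine ⟨(x, pairVec (√(1 - ‖x‖ ^ 2) • EuclideanSpace.single 0 1)
    (√(∏ j, circlePower c r j x) • EuclideanSpace.single 0 1)), ?_, rfl⟩
  refine (diskEq_eq_zero_iff c r m _).2 ⟨?_, ?_⟩
  · have : 0 ≤ 1 - ‖x‖ ^ 2 := by rw [norm_sq_eq_coords]; linarith [hx.1]
    simp [pairVec, norm_smul, Real.sq_sqrt this]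
  · have : 0 ≤ ∏ j, circlePower c r j x := Finset.prod_nonneg fun j _ => hx.2 j
    simp [pairVec, norm_smul, Real.sq_sqrt this]

/-! ### Slices of the region and connectedness of the level pieces -/

namespace CapSystem

variable {ε : ℝ} {j₁ j₂ : ℕ} {c : Fin (j₁ + j₂) → EuclideanSpace ℝ (Fin 2)}
  {r : Fin (j₁ + j₂) → ℝ} {m : Fin 2 → ℕ} (s : CapSystem ε j₁ j₂ c r)

include s

theorem eps_sq : ε ^ 2 = 1 := by rcases s.sign with h | h <;> rw [h] <;> norm_num

theorem lo_lt_hi (j) : s.lo j < s.hi j := (s.cap j).lo_lt_tip.trans (s.cap j).tip_lt_hi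

theorem eq_of_mem_Icc {i j} {t : ℝ} (hi : t ∈ Set.Icc (s.lo i) (s.hi i))
    (hj : t ∈ Set.Icc (s.lo j) (s.hi j)) : i = j := by
  rcases lt_trichotomy i j with h | h | h
  · linarith [s.hi_lt_lo i j h, hi.2, hj.1]
  · exact h
  · linarith [s.hi_lt_lo j i h, hi.1, hj.2]

theorem outside_of_mem_Icc {i j} {t : ℝ} (hi : t ∈ Set.Icc (s.lo i) (s.hi i)) (hij : i ≠ j) :
    t < s.lo j ∨ s.hi j < t := by
  by_contra! hcon
  exact hij (s.eq_of_mem_Icc hi hcon)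

theorem power_nonneg {j} {x : EuclideanSpace ℝ (Fin 2)} (hx : x 0 ^ 2 + x 1 ^ 2 ≤ 1)
    (h : x 0 ≤ s.lo j ∨ s.hi j ≤ x 0) : 0 ≤ circlePower c r j x := by
  rw [circlePower_eq_coords]
  exact (s.cap j).power_nonneg hx h

theorem power_pos {j} {x : EuclideanSpace ℝ (Fin 2)} (hx : x 0 ^ 2 + x 1 ^ 2 ≤ 1)
    (h : x 0 < s.lo j ∨ s.hi j < x 0) : 0 < circlePower c r j x := by
  rw [circlePower_eq_coords]
  exact (s.cap j).power_pos hx h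

theorem mem_Icc_of_power_nonpos {j} {x : EuclideanSpace ℝ (Fin 2)} (hx : x 0 ^ 2 + x 1 ^ 2 ≤ 1)
    (h : circlePower c r j x ≤ 0) : x 0 ∈ Set.Icc (s.lo j) (s.hi j) := by
  by_contra hcon
  rw [Set.mem_Icc, not_and_or, not_le, not_le] at hcon
  exact absurd h (not_le.2 (s.power_pos hx hcon))

/-- If one factor were negative, disjointness of the projections would make all the others positive,
and the product could not be a square. -/
theorem mem_closedRegion {z : MomentAmbient 2 m} (hz : diskEq c r m z = 0) :
    z.1 ∈ closedRegion c r := by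
  obtain ⟨h0, h1⟩ := (diskEq_eq_zero_iff c r m z).1 hz
  rw [norm_sq_eq_coords] at h0
  have hx : z.1 0 ^ 2 + z.1 1 ^ 2 ≤ 1 := by nlinarith [sq_nonneg ‖z.2 0‖]
  refine ⟨hx, fun j => ?_⟩
  by_contra! hj
  have hpos : 0 < ∏ i ∈ Finset.univ.erase j, circlePower c r i z.1 :=
    Finset.prod_pos fun i hi => s.power_pos hx
      (s.outside_of_mem_Icc (s.mem_Icc_of_power_nonpos hx hj.le) (Finset.ne_of_mem_erase hi).symm)
  rw [← Finset.mul_prod_erase _ _ (Finset.mem_univ j)] at h1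
  nlinarith [mul_neg_of_neg_of_pos hj hpos, sq_nonneg ‖z.2 1‖]

theorem transversalAt {x : EuclideanSpace ℝ (Fin 2)} (hx : x ∈ closedRegion c r) :
    TransversalAt c r x where
  radius_pos := s.radius_pos
  unique i j hi hj := s.eq_of_mem_Icc (s.mem_Icc_of_power_nonpos hx.1 hi.le)
    (s.mem_Icc_of_power_nonpos hx.1 hj.le)
  det_ne j h1 hj := by
    rw [circlePower_eq_coords] at hj
    refine (s.cap j).det_ne_zero ?_ hj
    rw [← norm_sq_eq_coords, h1, one_pow]

theorem isNonsingularZeroSet : IsNonsingularZeroSet (diskEq c r m) := fun _ hz =>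
  (s.transversalAt (s.mem_closedRegion hz)).surjective_fderiv hz

/-- The points that are not cut off between a circle and the arc `{ε x₁ > 0}`. -/
def mainSet : Set (EuclideanSpace ℝ (Fin 2)) :=
  {x | ∀ j, x 0 ≤ s.lo j ∨ s.hi j ≤ x 0 ∨ ε * x 1 ≤ ε * c j 1}

/-- The points cut off between the `j`-th circle and the arc `{ε x₁ > 0}`, and those below or
above the vertical pole. -/
def cutSet (j : Fin (j₁ + j₂)) : Set (EuclideanSpace ℝ (Fin 2)) :=
  {x | (x 0 ∈ Set.Icc (s.lt j) (s.rt j) ∧ ε * c j 1 ≤ ε * x 1) ∨ x 0 = s.pole j}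

theorem isClosed_mainSet : IsClosed s.mainSet := by
  simp only [mainSet, Set.ofPred_forall]
  refine isClosed_iInter fun j => ?_
  have h : ∀ i, Continuous fun x : EuclideanSpace ℝ (Fin 2) => x i := fun i => by fun_prop
  exact (isClosed_le (h 0) continuous_const).union ((isClosed_le continuous_const (h 0)).union
    (isClosed_le (continuous_const.mul (h 1)) continuous_const))

theorem isClosed_cutSet (j) : IsClosed (s.cutSet j) := by
  have h : ∀ i, Continuous fun x : EuclideanSpace ℝ (Fin 2) => x i := fun i => by fun_prop
  exact ((isClosed_Icc.preimage (h 0)).inter (isClosed_le continuous_const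
    (continuous_const.mul (h 1)))).union (isClosed_eq (h 0) continuous_const)

theorem pole_eq (j) : s.pole j = s.lo j ∨ s.pole j = s.hi j := by
  rcases (s.cap j).order with h | h
  · exact Or.inl h.2.2.1.symm
  · exact Or.inr h.2.2.1.symm

theorem Icc_lt_rt_subset (j) : Set.Icc (s.lt j) (s.rt j) ⊆ Set.Icc (s.lo j) (s.hi j) := by
  have h1 := (s.cap j).lo_lt_tip
  have h2 := (s.cap j).tip_lt_hi
  refine Set.Icc_subset_Icc ?_ ?_ <;>
    rcases (s.cap j).order with ⟨-, -, h⟩ | ⟨-, -, h⟩ <;> linarith [h.2.2.1, h.2.2.2]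

theorem pole_mem_lt_rt (j) : s.pole j ∈ Set.Icc (s.lt j) (s.rt j) := by
  have h1 := (s.cap j).lo_lt_tip
  have h2 := (s.cap j).tip_lt_hi
  rcases (s.cap j).order with ⟨-, -, h⟩ | ⟨-, -, h⟩ <;> constructor <;>
    linarith [h.1, h.2.1, h.2.2.1, h.2.2.2]

theorem tip_mem_lt_rt (j) : s.tip j ∈ Set.Icc (s.lt j) (s.rt j) := by
  have h1 := (s.cap j).lo_lt_tip
  have h2 := (s.cap j).tip_lt_hi
  rcases (s.cap j).order with ⟨-, -, h⟩ | ⟨-, -, h⟩ <;> constructor <;>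
    linarith [h.1, h.2.1, h.2.2.1, h.2.2.2]

theorem inside_of_mem_lt_rt {j} {t : ℝ} (ht : t ∈ Set.Icc (s.lt j) (s.rt j))
    (hne : t ≠ s.pole j) : s.lo j < t ∧ t < s.hi j := by
  have h1 := (s.cap j).lo_lt_tip
  have h2 := (s.cap j).tip_lt_hi
  obtain ⟨ht1, ht2⟩ := ht
  rcases (s.cap j).order with ⟨-, -, h⟩ | ⟨-, -, h⟩
  · have : s.pole j < t := lt_of_le_of_ne (by linarith [h.2.2.1]) hne.symm
    constructor <;> linarith [h.1, h.2.1, h.2.2.1, h.2.2.2]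
  · have : t < s.pole j := lt_of_le_of_ne (by linarith [h.2.2.2]) hne
    constructor <;> linarith [h.1, h.2.1, h.2.2.1, h.2.2.2]

theorem cutSet_subset (j) {x : EuclideanSpace ℝ (Fin 2)} (hx : x ∈ s.cutSet j) :
    x 0 ∈ Set.Icc (s.lt j) (s.rt j) := by
  rcases hx with hx | hx
  · exact hx.1
  · rw [hx]
    exact s.pole_mem_lt_rt j

theorem outside_of_eq_lo_or_hi {i j} {t : ℝ} (ht : t = s.lo i ∨ t = s.hi i) :
    t ≤ s.lo j ∨ s.hi j ≤ t := by
  by_cases hij : i = j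
  · subst hij
    exact ht.imp le_of_eq ge_of_eq
  · refine (s.outside_of_mem_Icc (i := i) ?_ hij).imp le_of_lt le_of_lt
    have := (s.lo_lt_hi i).le
    rcases ht with rfl | rfl
    · exact ⟨le_rfl, this⟩
    · exact ⟨this, le_rfl⟩

theorem mem_mainSet_of_outside {x : EuclideanSpace ℝ (Fin 2)}
    (h : ∀ j, x 0 ≤ s.lo j ∨ s.hi j ≤ x 0) : x ∈ s.mainSet := fun j =>
  (h j).imp_right Or.inl

theorem mem_mainSet_or_cutSet {x : EuclideanSpace ℝ (Fin 2)} (hx : x ∈ closedRegion c r) :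
    x ∈ s.mainSet ∨ ∃ j, x ∈ s.cutSet j := by
  by_cases h : x ∈ s.mainSet
  · exact Or.inl h
  · simp only [mainSet, Set.mem_ofPred_eq, not_forall, not_or, not_le] at h
    obtain ⟨j, h1, h2, h3⟩ := h
    have hQ := hx.2 j
    rw [circlePower_eq_coords] at hQ
    exact Or.inr ⟨j, Or.inl ⟨((s.cap j).upper hx.1 h1 h2 hQ h3.le).1, h3.le⟩⟩

/-- Away from the pole's abscissa the main set requires a height at most that of the centre, while
points of the region in the cut set are strictly beyond it. -/
theorem eq_pole_of_mem_of_mem {x : EuclideanSpace ℝ (Fin 2)} (hx : x ∈ closedRegion c r)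
    (hmain : x ∈ s.mainSet) {j} (hcut : x ∈ s.cutSet j) : x 0 = s.pole j := by
  by_contra hne
  have hcut' := hcut.resolve_right hne
  obtain ⟨h1, h2⟩ := s.inside_of_mem_lt_rt hcut'.1 hne
  have h3 := ((hmain j).resolve_left (not_le.2 h1)).resolve_left (not_le.2 h2)
  have hQ := hx.2 j
  rw [circlePower_eq_coords] at hQ
  exact absurd h3 (not_le.2 ((s.cap j).upper hx.1 h1 h2 hQ hcut'.2).2)

/-- The opposite arc meets none of the circles. It supplies over every abscissa a point of the main
slice where the first sphere degenerates. -/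
theorem exists_bottom {t : ℝ} (ht : t ∈ Set.Icc (-1 : ℝ) 1) :
    ∃ u, t ^ 2 + u ^ 2 = 1 ∧ !₂[t, u] ∈ closedRegion c r ∧ !₂[t, u] ∈ s.mainSet := by
  have hnn : 0 ≤ 1 - t ^ 2 := by nlinarith [ht.1, ht.2]
  have hsq : t ^ 2 + (-ε * √(1 - t ^ 2)) ^ 2 = 1 := by
    rw [mul_pow, neg_sq, s.eps_sq, Real.sq_sqrt hnn]
    ring
  have hneg : ε * (-ε * √(1 - t ^ 2)) ≤ 0 := by
    have : ε * (-ε * √(1 - t ^ 2)) = -√(1 - t ^ 2) := by linear_combination (-√(1 - t ^ 2)) * s.eps_sq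
    rw [this]
    exact neg_nonpos.2 (Real.sqrt_nonneg _)
  refine ⟨-ε * √(1 - t ^ 2), hsq, ⟨by simpa using hsq.le, fun j => ?_⟩, fun j => ?_⟩
  · rw [circlePower_eq_coords]
    simpa using ((s.cap j).power_bottom hsq hneg).le
  · right; right
    simpa using hneg.trans (s.center_pos j).le

theorem exists_top {j} {t : ℝ} (ht : t ∈ Set.Icc (s.lt j) (s.rt j)) :
    ∃ u, t ^ 2 + u ^ 2 = 1 ∧ 0 ≤ ε * u ∧ !₂[t, u] ∈ closedRegion c r ∧
      !₂[t, u] ∈ s.cutSet j := by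
  have ht' := s.Icc_lt_rt_subset j ht
  have hnn : 0 ≤ 1 - t ^ 2 := by
    nlinarith [ht'.1, ht'.2, (s.cap j).neg_one_lt_lo, (s.cap j).hi_lt_one]
  have hsq : t ^ 2 + (ε * √(1 - t ^ 2)) ^ 2 = 1 := by
    rw [mul_pow, s.eps_sq, Real.sq_sqrt hnn]
    ring
  have hpos : 0 ≤ ε * (ε * √(1 - t ^ 2)) := by
    rw [← mul_assoc, ← pow_two, s.eps_sq, one_mul]
    exact Real.sqrt_nonneg _
  have htop := (s.cap j).top hsq hpos ht
  have hle : (!₂[t, ε * √(1 - t ^ 2)] : EuclideanSpace ℝ (Fin 2)) 0 ^ 2 +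
    (!₂[t, ε * √(1 - t ^ 2)] : EuclideanSpace ℝ (Fin 2)) 1 ^ 2 ≤ 1 := by simpa using hsq.le
  refine ⟨ε * √(1 - t ^ 2), hsq, hpos, ⟨hle, fun i => ?_⟩, Or.inl ⟨ht, htop.1⟩⟩
  by_cases hij : i = j
  · subst hij
    rw [circlePower_eq_coords]
    exact htop.2
  · refine (s.power_pos hle ?_).le
    exact s.outside_of_mem_Icc ht' (Ne.symm hij)

/-- On a vertical line the power is a parabola with vertex at the height of the centre. On one side
of the vertex its nonnegativity cuts out an interval, and outside the projection of the circle it is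
automatic in the disk. -/
theorem ordConnected_slice {t : ℝ} {P : ℝ → Prop} (hP : {u | P u}.OrdConnected)
    (hside : ∀ j, (t ≤ s.lo j ∨ s.hi j ≤ t) ∨ (∀ u, P u → ε * u ≤ ε * c j 1) ∨
      ∀ u, P u → ε * c j 1 ≤ ε * u) :
    {u : ℝ | !₂[t, u] ∈ closedRegion c r ∧ P u}.OrdConnected := by
  refine ⟨?_⟩
  rintro u ⟨⟨hu1, hu2⟩, hPu⟩ w ⟨⟨hw1, hw2⟩, hPw⟩ v ⟨huv, hvw⟩
  have hPv : P v := hP.out hPu hPw ⟨huv, hvw⟩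
  have hv1 : t ^ 2 + v ^ 2 ≤ 1 := by
    have hu1 : t ^ 2 + u ^ 2 ≤ 1 := hu1
    have hw1 : t ^ 2 + w ^ 2 ≤ 1 := hw1
    rcases le_total 0 v with h | h <;> nlinarith
  refine ⟨⟨hv1, fun j => ?_⟩, hPv⟩
  have hu := hu2 j
  have hw := hw2 j
  rw [circlePower_eq_coords] at hu hw ⊢
  change 0 ≤ (t - c j 0) ^ 2 + (u - c j 1) ^ 2 - r j ^ 2 at hu
  change 0 ≤ (t - c j 0) ^ 2 + (w - c j 1) ^ 2 - r j ^ 2 at hw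
  change 0 ≤ (t - c j 0) ^ 2 + (v - c j 1) ^ 2 - r j ^ 2
  rcases hside j with h | h | h
  · exact (s.cap j).power_nonneg hv1 h
  · have h1 := h u hPu
    have h2 := h v hPv
    have h3 := h w hPw
    rcases s.sign with e | e <;> simp only [e, one_mul, neg_one_mul, neg_le_neg_iff] at h1 h2 h3 <;>
      nlinarith
  · have h1 := h u hPu
    have h2 := h v hPv
    have h3 := h w hPw
    rcases s.sign with e | e <;> simp only [e, one_mul, neg_one_mul, neg_le_neg_iff] at h1 h2 h3 <;>
      nlinarith

theorem ordConnected_le (b : ℝ) : {u | ε * u ≤ ε * b}.OrdConnected := by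
  rcases s.sign with e | e <;> simp only [e, one_mul, neg_one_mul, neg_le_neg_iff]
  · exact Set.ordConnected_Iic
  · exact Set.ordConnected_Ici

theorem ordConnected_ge (b : ℝ) : {u | ε * b ≤ ε * u}.OrdConnected := by
  rcases s.sign with e | e <;> simp only [e, one_mul, neg_one_mul, neg_le_neg_iff]
  · exact Set.ordConnected_Ici
  · exact Set.ordConnected_Iic

theorem isPreconnected_mainSlice (t : ℝ) :
    IsPreconnected {x | x ∈ closedRegion c r ∧ x ∈ s.mainSet ∧ x 0 = t} := by
  refine isPreconnected_of_slice (t := t) (fun x hx => hx.2.2) ?_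
  have : {u : ℝ | !₂[t, u] ∈ {x | x ∈ closedRegion c r ∧ x ∈ s.mainSet ∧ x 0 = t}} =
      {u : ℝ | !₂[t, u] ∈ closedRegion c r ∧
        ∀ j, t ≤ s.lo j ∨ s.hi j ≤ t ∨ ε * u ≤ ε * c j 1} := by
    ext u
    simp only [mainSet, Set.mem_ofPred_eq]
    exact and_congr_right fun _ => and_iff_left rfl
  rw [this]
  refine s.ordConnected_slice (P := fun u => ∀ j, t ≤ s.lo j ∨ s.hi j ≤ t ∨ ε * u ≤ ε * c j 1)
    ?_ fun j => ?_
  · simp only [Set.ofPred_forall]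
    refine Set.ordConnected_iInter fun j => ?_
    by_cases h : t ≤ s.lo j
    · simpa [h] using Set.ordConnected_univ
    by_cases h' : s.hi j ≤ t
    · simpa [h'] using Set.ordConnected_univ
    simpa [h, h'] using s.ordConnected_le (c j 1)
  · by_cases h : t ≤ s.lo j ∨ s.hi j ≤ t
    · exact Or.inl h
    · rw [not_or] at h
      exact Or.inr (Or.inl fun u hu => ((hu j).resolve_left h.1).resolve_left h.2)

theorem mem_mainSet_of_eq_pole {x : EuclideanSpace ℝ (Fin 2)} {j} (hx : x 0 = s.pole j) :
    x ∈ s.mainSet := by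
  refine s.mem_mainSet_of_outside fun i => ?_
  rw [hx]
  exact s.outside_of_eq_lo_or_hi (s.pole_eq j)

theorem isPreconnected_cutSlice (j) (t : ℝ) :
    IsPreconnected {x | x ∈ closedRegion c r ∧ x ∈ s.cutSet j ∧ x 0 = t} := by
  -- Over the pole the cut set contains the whole vertical line, so that its slice agrees with the
  -- main one at the attaching vertex.
  by_cases ht : t = s.pole j
  · convert s.isPreconnected_mainSlice t using 1
    ext x
    refine and_congr_right fun _ => and_congr_left fun hx => ?_
    exact ⟨fun _ => s.mem_mainSet_of_eq_pole (hx.trans ht), fun _ => Or.inr (hx.trans ht)⟩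
  refine isPreconnected_of_slice (t := t) (fun x hx => hx.2.2) ?_
  by_cases ht' : t ∈ Set.Icc (s.lt j) (s.rt j)
  · have : {u : ℝ | !₂[t, u] ∈ {x | x ∈ closedRegion c r ∧ x ∈ s.cutSet j ∧ x 0 = t}} =
        {u : ℝ | !₂[t, u] ∈ closedRegion c r ∧ ε * c j 1 ≤ ε * u} := by
      ext u
      simp only [cutSet, Set.mem_ofPred_eq]
      exact and_congr_right fun _ => ⟨fun h => (h.1.resolve_right ht).2,
        fun h => ⟨Or.inl ⟨ht', h⟩, rfl⟩⟩
    rw [this]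
    refine s.ordConnected_slice (P := fun u => ε * c j 1 ≤ ε * u) (s.ordConnected_ge _)
      fun i => ?_
    by_cases hij : i = j
    · subst hij
      exact Or.inr (Or.inr fun u hu => hu)
    · exact Or.inl ((s.outside_of_mem_Icc (s.Icc_lt_rt_subset j ht') (Ne.symm hij)).imp
        le_of_lt le_of_lt)
  · convert Set.ordConnected_empty using 1
    rw [Set.eq_empty_iff_forall_notMem]
    rintro u ⟨-, hu, -⟩
    exact ht' (s.cutSet_subset j hu)

/-- The part of a level set lying over a connected part of a slice of the region that touches the
unit circle is connected. -/
theorem isPreconnected_level (hm : 0 < m 1) {B : Set (EuclideanSpace ℝ (Fin 2))} {t : ℝ}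
    (hB : IsPreconnected {x | x ∈ closedRegion c r ∧ x ∈ B ∧ x 0 = t})
    (hne : (∃ x, x ∈ closedRegion c r ∧ x ∈ B ∧ x 0 = t) →
      ∃ u, t ^ 2 + u ^ 2 = 1 ∧ !₂[t, u] ∈ closedRegion c r ∧ !₂[t, u] ∈ B) :
    IsPreconnected ({z : diskManifold c r m | z.1.1 ∈ B} ∩ diskFun c r m ⁻¹' {t}) := by
  rw [← Topology.IsInducing.subtypeVal.isPreconnected_image]
  by_cases h : ∃ x, x ∈ closedRegion c r ∧ x ∈ B ∧ x 0 = t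
  · obtain ⟨u, hu, huK, huB⟩ := hne h
    have := isPreconnected_sphereBundle (m := m) hm (f := fun x => 1 - ‖x‖ ^ 2)
      (g := fun x => ∏ j, circlePower c r j x) (by fun_prop)
      (continuous_finsetProd _ fun j _ => continuous_circlePower c r j) hB
      (fun x hx => by rw [norm_sq_eq_coords]; linarith [hx.1.1])
      (fun x hx => Finset.prod_nonneg fun j _ => hx.1.2 j) (x₀ := !₂[t, u])
      ⟨huK, huB, rfl⟩ (by rw [norm_sq_eq_coords]; simp [← hu])
    convert this using 1
    ext z
    constructor
    · rintro ⟨z, ⟨hz, hzt⟩, rfl⟩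
      exact ⟨⟨s.mem_closedRegion z.2, hz, hzt⟩, (diskEq_eq_zero_iff c r m z.1).1 z.2⟩
    · rintro ⟨⟨-, hz, hzt⟩, hz'⟩
      exact ⟨⟨z, (diskEq_eq_zero_iff c r m z).2 hz'⟩, ⟨hz, hzt⟩, rfl⟩
  · convert isPreconnected_empty using 1
    rw [Set.image_eq_empty, Set.eq_empty_iff_forall_notMem]
    rintro z ⟨hz, hzt⟩
    exact h ⟨z.1.1, s.mem_closedRegion z.2, hz, hzt⟩

theorem isPreconnected_mainLevel (hm : 0 < m 1) (t : ℝ) :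
    IsPreconnected ({z : diskManifold c r m | z.1.1 ∈ s.mainSet} ∩ diskFun c r m ⁻¹' {t}) := by
  refine s.isPreconnected_level hm (s.isPreconnected_mainSlice t) ?_
  rintro ⟨x, hx, -, rfl⟩
  exact s.exists_bottom (coord_mem_Icc_of_mem_closedRegion hx)

theorem isPreconnected_cutLevel (hm : 0 < m 1) (j) (t : ℝ) :
    IsPreconnected ({z : diskManifold c r m | z.1.1 ∈ s.cutSet j} ∩ diskFun c r m ⁻¹' {t}) := by
  refine s.isPreconnected_level hm (s.isPreconnected_cutSlice j t) ?_
  rintro ⟨x, -, hx, rfl⟩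
  obtain ⟨u, h1, -, h2⟩ := s.exists_top (s.cutSet_subset j hx)
  exact ⟨u, h1, h2⟩

end CapSystem

theorem exists_consecutive {N : ℕ} (f : Fin (N + 1 + 1) → ℝ) {x : ℝ} (h0 : f 0 ≤ x)
    (h1 : x ≤ f (Fin.last _)) : ∃ k : Fin (N + 1), f k.castSucc ≤ x ∧ x ≤ f k.succ := by
  by_contra! hcon
  have : ∀ k, f k ≤ x := by
    intro k
    induction k using Fin.induction with
    | zero => exact h0
    | succ k ih => exact (hcon k ih).le
  have h2 := hcon (Fin.last N) (this _)
  rw [Fin.succ_last] at h2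
  exact absurd h1 (not_le.2 h2)

/-! ### Edges of the graph, directed by increasing height -/

section PendantGraph

variable {j₁ j₂ : ℕ}

/-- The vertex of the path to which a pendant vertex is attached. -/
def attach : Fin j₁ ⊕ Fin j₂ → Fin (2 * (j₁ + j₂) + 1 + 1)
  -- Counting from 0, the path vertices of circle `j` are `2 * j + 1` (left end) and `2 * j + 2`
  -- (right end). The pole is the right end for the first group and the left end for the second.
  | .inl i => ⟨2 * i + 2, by omega⟩
  | .inr i => ⟨2 * (j₁ + i) + 1, by omega⟩

/-- The edges of the path and the pendant edges. -/
abbrev PendantEdge (j₁ j₂ : ℕ) : Type :=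
  Fin (2 * (j₁ + j₂) + 1) ⊕ (Fin j₁ ⊕ Fin j₂)

/-- The left end of an edge. -/
def edgeSrc : PendantEdge j₁ j₂ → PendantVertex j₁ j₂
  | .inl k => .inl k.castSucc
  -- In the first group the tip is left of the pole, so the pendant vertex is the lower end; in the
  -- second group it is the upper end.
  | .inr (.inl i) => .inr (.inl i)
  | .inr (.inr i) => .inl (attach (.inr i))

/-- The right end of an edge. -/
def edgeTgt : PendantEdge j₁ j₂ → PendantVertex j₁ j₂
  | .inl k => .inl k.succ
  | .inr (.inl i) => .inl (attach (.inl i))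
  | .inr (.inr i) => .inr (.inr i)

theorem mem_ends_pendant {p : Fin j₁ ⊕ Fin j₂} {v : PendantVertex j₁ j₂} :
    (v = edgeSrc (.inr p) ∨ v = edgeTgt (.inr p)) ↔ (v = .inr p ∨ v = .inl (attach p)) := by
  rcases p with i | i
  · rfl
  · exact or_comm

theorem pendantRel_iff {a b : PendantVertex j₁ j₂} : pendantRel j₁ j₂ a b ↔
    (∃ k, a = edgeSrc (.inl k) ∧ b = edgeTgt (.inl k)) ∨
      ∃ p, a = .inl (attach p) ∧ b = .inr p := by
  rcases a with a | a
  · rcases b with b | b | b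
    · simp only [pendantRel, edgeSrc, edgeTgt, Sum.inl.injEq, reduceCtorEq, and_false,
        exists_false, or_false, Fin.ext_iff, Fin.val_castSucc, Fin.val_succ]
      constructor
      · intro h
        exact ⟨⟨a, by omega⟩, rfl, h⟩
      · rintro ⟨k, h1, h2⟩
        omega
    · simp only [pendantRel, edgeSrc, edgeTgt, reduceCtorEq, and_false, exists_false, false_or,
        Sum.inl.injEq, Sum.inr.injEq]
      constructor
      · intro h
        exact ⟨.inl b, Fin.ext (by simp only [attach]; omega), rfl⟩
      · rintro ⟨p, h, rfl⟩
        rw [h]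
        simp only [attach]
        omega
    · simp only [pendantRel, edgeSrc, edgeTgt, reduceCtorEq, and_false, exists_false, false_or,
        Sum.inl.injEq, Sum.inr.injEq]
      constructor
      · intro h
        exact ⟨.inr b, Fin.ext (by simp only [attach]; omega), rfl⟩
      · rintro ⟨p, h, rfl⟩
        rw [h]
        simp only [attach]
        omega
  · simp [pendantRel, edgeSrc]

theorem edgeSrc_ne_edgeTgt (e : PendantEdge j₁ j₂) : edgeSrc e ≠ edgeTgt e := by
  rcases e with k | i | i
  · simp [edgeSrc, edgeTgt, Fin.ext_iff]
  · simp [edgeSrc, edgeTgt]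
  · simp [edgeSrc, edgeTgt]

theorem pendantGraph_adj_iff {a b : PendantVertex j₁ j₂} : (pendantGraph j₁ j₂).Adj a b ↔
    ∃ e, (a = edgeSrc e ∧ b = edgeTgt e) ∨ (a = edgeTgt e ∧ b = edgeSrc e) := by
  have key : ∀ a b : PendantVertex j₁ j₂, pendantRel j₁ j₂ a b →
      ∃ e, (a = edgeSrc e ∧ b = edgeTgt e) ∨ (a = edgeTgt e ∧ b = edgeSrc e) := by
    intro a b hab
    rcases pendantRel_iff.1 hab with ⟨k, h⟩ | ⟨i | i, rfl, rfl⟩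
    · exact ⟨.inl k, Or.inl h⟩
    · exact ⟨.inr (.inl i), Or.inr ⟨rfl, rfl⟩⟩
    · exact ⟨.inr (.inr i), Or.inl ⟨rfl, rfl⟩⟩
  have key' : ∀ e : PendantEdge j₁ j₂, (pendantGraph j₁ j₂).Adj (edgeSrc e) (edgeTgt e) := by
    intro e
    rw [pendantGraph, SimpleGraph.fromRel_adj]
    refine ⟨edgeSrc_ne_edgeTgt e, ?_⟩
    rcases e with k | i | i
    · exact Or.inl (pendantRel_iff.2 (Or.inl ⟨k, rfl, rfl⟩))
    · exact Or.inr (pendantRel_iff.2 (Or.inr ⟨.inl i, rfl, rfl⟩))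
    · exact Or.inl (pendantRel_iff.2 (Or.inr ⟨.inr i, rfl, rfl⟩))
  constructor
  · intro hab
    rw [pendantGraph, SimpleGraph.fromRel_adj] at hab
    rcases hab.2 with h | h
    · exact key a b h
    · obtain ⟨e, he⟩ := key b a h
      exact ⟨e, he.symm.imp (fun h => ⟨h.2, h.1⟩) fun h => ⟨h.2, h.1⟩⟩
  · rintro ⟨e, ⟨rfl, rfl⟩ | ⟨rfl, rfl⟩⟩
    · exact key' e
    · exact (key' e).symm

theorem exists_path_edge (a : Fin (2 * (j₁ + j₂) + 1 + 1)) :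
    ∃ k : Fin (2 * (j₁ + j₂) + 1), a = k.castSucc ∨ a = k.succ := by
  by_cases h : (a : ℕ) = 0
  · exact ⟨0, Or.inl (Fin.ext h)⟩
  · exact ⟨⟨a - 1, by omega⟩, Or.inr (Fin.ext (by simp only [Fin.val_succ]; omega))⟩

theorem exists_edge (v : PendantVertex j₁ j₂) :
    ∃ e : PendantEdge j₁ j₂, v = edgeSrc e ∨ v = edgeTgt e := by
  rcases v with a | p
  · obtain ⟨k, hk⟩ := exists_path_edge a
    exact ⟨.inl k, hk.imp (congrArg Sum.inl) (congrArg Sum.inl)⟩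
  · exact ⟨.inr p, mem_ends_pendant.2 (Or.inl rfl)⟩

theorem edge_ext (e e' : PendantEdge j₁ j₂) (h1 : edgeSrc e = edgeSrc e')
    (h2 : edgeTgt e = edgeTgt e') : e = e' := by
  rcases e with k | i | i <;> rcases e' with k' | i' | i' <;>
    simp_all [edgeSrc, edgeTgt]

end PendantGraph

/-! ### Heights of the vertices and the cover of the manifold by edge pieces -/

namespace CapSystem

variable {ε : ℝ} {j₁ j₂ : ℕ} {c : Fin (j₁ + j₂) → EuclideanSpace ℝ (Fin 2)}
  {r : Fin (j₁ + j₂) → ℝ} {m : Fin 2 → ℕ} (s : CapSystem ε j₁ j₂ c r)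

/-- The first coordinate belonging to a vertex of the path. -/
noncomputable def pathHeight (a : Fin (2 * (j₁ + j₂) + 1 + 1)) : ℝ :=
  if (a : ℕ) = 0 then -1
  else if h : ((a : ℕ) - 1) / 2 < j₁ + j₂ then
    if (a : ℕ) % 2 = 1 then s.lo ⟨((a : ℕ) - 1) / 2, h⟩ else s.hi ⟨((a : ℕ) - 1) / 2, h⟩
  else 1

theorem pathHeight_zero {a : Fin (2 * (j₁ + j₂) + 1 + 1)} (ha : (a : ℕ) = 0) :
    s.pathHeight a = -1 := by simp [pathHeight, ha]

theorem pathHeight_last {a : Fin (2 * (j₁ + j₂) + 1 + 1)}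
    (ha : (a : ℕ) = 2 * (j₁ + j₂) + 1) : s.pathHeight a = 1 := by
  rw [pathHeight, if_neg (by omega), dif_neg (by omega)]

theorem pathHeight_lo {a : Fin (2 * (j₁ + j₂) + 1 + 1)} {j : Fin (j₁ + j₂)}
    (ha : (a : ℕ) = 2 * j + 1) : s.pathHeight a = s.lo j := by
  have e : ((a : ℕ) - 1) / 2 = j := by omega
  have := j.2
  rw [pathHeight, if_neg (by omega), dif_pos (by omega), if_pos (by omega)]
  exact congrArg s.lo (Fin.ext e)

theorem pathHeight_hi {a : Fin (2 * (j₁ + j₂) + 1 + 1)} {j : Fin (j₁ + j₂)}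
    (ha : (a : ℕ) = 2 * j + 2) : s.pathHeight a = s.hi j := by
  have e : ((a : ℕ) - 1) / 2 = j := by omega
  have := j.2
  rw [pathHeight, if_neg (by omega), dif_pos (by omega), if_neg (by omega)]
  exact congrArg s.hi (Fin.ext e)

theorem strictMono_pathHeight : StrictMono s.pathHeight := by
  rw [Fin.strictMono_iff_lt_succ]
  intro k
  have hk := k.2
  rcases Nat.even_or_odd' k with ⟨q, hq | hq⟩
  -- An edge starting at an even index `2 * q` crosses a gap, from -1 or `hi (q - 1)` to `lo q` or
  -- 1; one starting at an odd index crosses the projection of circle `q`.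
  · have hright : ∀ x : ℝ, x < 1 → (∀ h : q < j₁ + j₂, x < s.lo ⟨q, h⟩) →
        x < s.pathHeight k.succ := by
      intro x h1 h2
      by_cases h : q < j₁ + j₂
      · rw [s.pathHeight_lo (j := ⟨q, h⟩) (by simp [hq])]
        exact h2 h
      · rw [s.pathHeight_last (by simp only [Fin.val_succ]; omega)]
        exact h1
    refine hright _ ?_ ?_ <;> by_cases h0 : q = 0
    · rw [s.pathHeight_zero (by simp [hq, h0])]
      norm_num
    · rw [s.pathHeight_hi (j := ⟨q - 1, by omega⟩) (by simp only [Fin.val_castSucc]; omega)]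
      exact (s.cap _).hi_lt_one
    · intro h
      rw [s.pathHeight_zero (by simp [hq, h0])]
      exact (s.cap _).neg_one_lt_lo
    · intro h
      rw [s.pathHeight_hi (j := ⟨q - 1, by omega⟩) (by simp only [Fin.val_castSucc]; omega)]
      exact s.hi_lt_lo _ _ (by rw [Fin.lt_def]; simp only; omega)
  · rw [s.pathHeight_lo (j := ⟨q, by omega⟩) (by simp [hq]),
      s.pathHeight_hi (j := ⟨q, by omega⟩) (by simp [hq])]
    exact s.lo_lt_hi _

theorem pathHeight_cases (a : Fin (2 * (j₁ + j₂) + 1 + 1)) :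
    s.pathHeight a = -1 ∨ s.pathHeight a = 1 ∨
      ∃ j, s.pathHeight a = s.lo j ∨ s.pathHeight a = s.hi j := by
  have ha := a.2
  by_cases h0 : (a : ℕ) = 0
  · exact Or.inl (s.pathHeight_zero h0)
  by_cases h1 : (a : ℕ) = 2 * (j₁ + j₂) + 1
  · exact Or.inr (Or.inl (s.pathHeight_last h1))
  refine Or.inr (Or.inr ⟨⟨(a - 1) / 2, by omega⟩, ?_⟩)
  rcases Nat.even_or_odd' a with ⟨q, hq | hq⟩
  · exact Or.inr (s.pathHeight_hi (by simp only; omega))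
  · exact Or.inl (s.pathHeight_lo (by simp only; omega))

theorem exists_pathHeight_lo (j) : ∃ a, s.pathHeight a = s.lo j :=
  ⟨⟨2 * j + 1, by omega⟩, s.pathHeight_lo rfl⟩

theorem exists_pathHeight_hi (j) : ∃ a, s.pathHeight a = s.hi j :=
  ⟨⟨2 * j + 2, by omega⟩, s.pathHeight_hi rfl⟩

theorem pathHeight_attach (p : Fin j₁ ⊕ Fin j₂) :
    s.pathHeight (attach p) = s.pole (finSumFinEquiv p) := by
  rcases p with i | i
  · rw [s.pathHeight_hi (j := finSumFinEquiv (.inl i)) (by simp [attach])]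
    rcases (s.cap (finSumFinEquiv (.inl i))).order with h | h
    · exact absurd ((s.center_neg _).2 (by simp)) (not_lt.2 h.1.le)
    · exact h.2.2.1
  · rw [s.pathHeight_lo (j := finSumFinEquiv (.inr i)) (by simp [attach])]
    rcases (s.cap (finSumFinEquiv (.inr i))).order with h | h
    · exact h.2.2.1
    · exact absurd ((s.center_neg _).1 h.1) (by simp)

/-- The first coordinate belonging to a vertex of the Reeb graph. -/
noncomputable def height : PendantVertex j₁ j₂ → ℝ
  | .inl a => s.pathHeight a
  | .inr p => s.tip (finSumFinEquiv p)

theorem height_pendant (p : Fin j₁ ⊕ Fin j₂) :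
    s.height (edgeSrc (.inr p)) = s.lt (finSumFinEquiv p) ∧
      s.height (edgeTgt (.inr p)) = s.rt (finSumFinEquiv p) := by
  have h := s.pathHeight_attach p
  rcases p with i | i
  · rcases (s.cap (finSumFinEquiv (.inl i))).order with h' | h'
    · exact absurd ((s.center_neg _).2 (by simp)) (not_lt.2 h'.1.le)
    · exact ⟨h'.2.2.2.2.1.symm, h.trans h'.2.2.2.2.2.symm⟩
  · rcases (s.cap (finSumFinEquiv (.inr i))).order with h' | h'
    · exact ⟨h.trans h'.2.2.2.2.1.symm, h'.2.2.2.2.2.symm⟩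
    · exact absurd ((s.center_neg _).1 h'.1) (by simp)

theorem height_src_lt_tgt (e : PendantEdge j₁ j₂) :
    s.height (edgeSrc e) < s.height (edgeTgt e) := by
  rcases e with k | p
  · exact s.strictMono_pathHeight k.castSucc_lt_succ
  · rw [(s.height_pendant p).1, (s.height_pendant p).2]
    have h1 := (s.cap (finSumFinEquiv p)).lo_lt_tip
    have h2 := (s.cap (finSumFinEquiv p)).tip_lt_hi
    rcases (s.cap (finSumFinEquiv p)).order with ⟨-, -, h⟩ | ⟨-, -, h⟩ <;>
      linarith [h.1, h.2.1, h.2.2.1, h.2.2.2]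

/-- The part of the manifold belonging to an edge. -/
def edgeSet (m : Fin 2 → ℕ) : PendantEdge j₁ j₂ → Set (diskManifold c r m)
  | .inl k => {z | z.1.1 ∈ s.mainSet ∧
      z.1.1 0 ∈ Set.Icc (s.pathHeight k.castSucc) (s.pathHeight k.succ)}
  | .inr p => {z | z.1.1 ∈ s.cutSet (finSumFinEquiv p)}

theorem continuous_base : Continuous fun z : diskManifold c r m => z.1.1 :=
  continuous_fst.comp continuous_subtype_val

theorem continuous_diskFun : Continuous (diskFun c r m) := by
  have : Continuous fun x : EuclideanSpace ℝ (Fin 2) => x 0 := by fun_prop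
  exact this.comp continuous_base

include s

theorem isClosed_edgeSet (e) : IsClosed (s.edgeSet m e) := by
  rcases e with k | p
  · exact (s.isClosed_mainSet.preimage continuous_base).inter
      (isClosed_Icc.preimage continuous_diskFun)
  · exact (s.isClosed_cutSet _).preimage continuous_base

theorem mem_region (z : diskManifold c r m) : z.1.1 ∈ closedRegion c r := s.mem_closedRegion z.2

theorem mem_mainSet_of_eq_pathHeight {x : EuclideanSpace ℝ (Fin 2)}
    {a : Fin (2 * (j₁ + j₂) + 1 + 1)} (hx : x 0 = s.pathHeight a) : x ∈ s.mainSet := by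
  refine s.mem_mainSet_of_outside fun i => ?_
  rw [hx]
  rcases s.pathHeight_cases a with h | h | ⟨j, h⟩
  · rw [h]
    exact Or.inl (s.cap i).neg_one_lt_lo.le
  · rw [h]
    exact Or.inr (s.cap i).hi_lt_one.le
  · exact s.outside_of_eq_lo_or_hi h

theorem mem_edgeSet_of_eq_height {z : diskManifold c r m} {k : Fin (2 * (j₁ + j₂) + 1)}
    {v : PendantVertex j₁ j₂} (hv : v = edgeSrc (.inl k) ∨ v = edgeTgt (.inl k))
    (hz : z.1.1 0 = s.height v) : z ∈ s.edgeSet m (.inl k) := by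
  have hlt := (s.strictMono_pathHeight k.castSucc_lt_succ).le
  rcases hv with rfl | rfl
  · exact ⟨s.mem_mainSet_of_eq_pathHeight hz, hz.ge, hz.trans_le hlt⟩
  · exact ⟨s.mem_mainSet_of_eq_pathHeight hz, hlt.trans hz.ge, hz.le⟩

theorem exists_edge_of_eq_pathHeight {z : diskManifold c r m}
    {a : Fin (2 * (j₁ + j₂) + 1 + 1)} (hz : z.1.1 0 = s.pathHeight a) :
    ∃ e, ((.inl a : PendantVertex j₁ j₂) = edgeSrc e ∨ .inl a = edgeTgt e) ∧
      z ∈ s.edgeSet m e ∧ diskFun c r m z = s.height (.inl a) := by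
  obtain ⟨k, hk⟩ := exists_path_edge a
  have hk' : (.inl a : PendantVertex j₁ j₂) = edgeSrc (.inl k) ∨ .inl a = edgeTgt (.inl k) :=
    hk.imp (congrArg Sum.inl) (congrArg Sum.inl)
  exact ⟨.inl k, hk', s.mem_edgeSet_of_eq_height hk' hz, hz⟩

theorem exists_mem_edgeSet (z : diskManifold c r m) : ∃ e, z ∈ s.edgeSet m e := by
  rcases s.mem_mainSet_or_cutSet (s.mem_region z) with h | ⟨j, h⟩
  · have hz := coord_mem_Icc_of_mem_closedRegion (s.mem_region z)
    obtain ⟨k, hk⟩ := exists_consecutive s.pathHeight (x := z.1.1 0)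
      (by rw [s.pathHeight_zero rfl]; exact hz.1) (by rw [s.pathHeight_last rfl]; exact hz.2)
    exact ⟨.inl k, h, hk⟩
  · refine ⟨.inr (finSumFinEquiv.symm j), ?_⟩
    simpa [edgeSet] using h

theorem diskFun_mem_Icc (e : PendantEdge j₁ j₂) (z) (hz : z ∈ s.edgeSet m e) :
    diskFun c r m z ∈ Set.Icc (s.height (edgeSrc e)) (s.height (edgeTgt e)) := by
  rcases e with k | p
  · exact hz.2
  · rw [(s.height_pendant p).1, (s.height_pendant p).2]
    exact s.cutSet_subset _ hz

theorem isPreconnected_edgeLevel (hm : 0 < m 1) (e : PendantEdge j₁ j₂) (t : ℝ) :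
    IsPreconnected (s.edgeSet m e ∩ diskFun c r m ⁻¹' {t}) := by
  rcases e with k | p
  · by_cases ht : t ∈ Set.Icc (s.pathHeight k.castSucc) (s.pathHeight k.succ)
    · convert s.isPreconnected_mainLevel hm t using 1
      ext z
      refine and_congr_left fun hz => and_iff_left ?_
      have : z.1.1 0 = t := hz
      rwa [this]
    · convert isPreconnected_empty using 1
      rw [Set.eq_empty_iff_forall_notMem]
      rintro z ⟨⟨-, hz⟩, hzt⟩
      have : z.1.1 0 = t := hzt
      exact ht (this ▸ hz)
  · exact s.isPreconnected_cutLevel hm _ t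

theorem exists_mem_edgeLevel (e : PendantEdge j₁ j₂) (t : ℝ)
    (ht : t ∈ Set.Icc (s.height (edgeSrc e)) (s.height (edgeTgt e))) :
    ∃ z ∈ s.edgeSet m e, diskFun c r m z = t := by
  rcases e with k | p
  · have h1 : s.pathHeight 0 ≤ s.pathHeight k.castSucc := s.strictMono_pathHeight.monotone (Fin.zero_le k.castSucc)
    have h2 : s.pathHeight k.succ ≤ s.pathHeight (Fin.last _) :=
      s.strictMono_pathHeight.monotone (Fin.le_last k.succ)
    rw [s.pathHeight_zero rfl] at h1
    rw [s.pathHeight_last (a := Fin.last _) rfl] at h2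
    obtain ⟨u, -, hu, hu'⟩ := s.exists_bottom ⟨h1.trans ht.1, ht.2.trans h2⟩
    obtain ⟨z, hz, hzx⟩ := exists_mem_diskManifold (m := m) hu
    refine ⟨⟨z, hz⟩, ⟨?_, ?_⟩, ?_⟩
    · simp only [hzx]; exact hu'
    · simp only [hzx]; exact ht
    · simp only [diskFun, firstCoord, hzx]; rfl
  · rw [(s.height_pendant p).1, (s.height_pendant p).2] at ht
    obtain ⟨u, -, -, hu, hu'⟩ := s.exists_top ht
    obtain ⟨z, hz, hzx⟩ := exists_mem_diskManifold (m := m) hu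
    refine ⟨⟨z, hz⟩, ?_, ?_⟩
    · simp only [edgeSet, Set.mem_ofPred_eq, hzx]; exact hu'
    · simp only [diskFun, firstCoord, hzx]; rfl

theorem exists_common_of_path {k k' : Fin (2 * (j₁ + j₂) + 1)} {t : ℝ} (hkk : k < k')
    (hk : t ∈ Set.Icc (s.pathHeight k.castSucc) (s.pathHeight k.succ))
    (hk' : t ∈ Set.Icc (s.pathHeight k'.castSucc) (s.pathHeight k'.succ)) :
    k.succ = k'.castSucc ∧ t = s.pathHeight k.succ := by
  have h1 : k.succ ≤ k'.castSucc := Fin.succ_le_castSucc_iff.2 hkk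
  have h2 := s.strictMono_pathHeight.monotone h1
  have h3 : t = s.pathHeight k.succ := le_antisymm hk.2 (h2.trans hk'.1)
  refine ⟨s.strictMono_pathHeight.injective (le_antisymm h2 (h3 ▸ hk'.1)), h3⟩

/-- The two pieces can meet only over the pole, which is the height of the attaching vertex. Strict
monotonicity leaves that vertex no place but an end of the path edge. -/
theorem exists_common_of_path_pendant {k : Fin (2 * (j₁ + j₂) + 1)} {p : Fin j₁ ⊕ Fin j₂}
    {z : diskManifold c r m} (hk : z ∈ s.edgeSet m (.inl k)) (hp : z ∈ s.edgeSet m (.inr p)) :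
    ((.inl (attach p) : PendantVertex j₁ j₂) = edgeSrc (.inl k) ∨
      .inl (attach p) = edgeTgt (.inl k)) ∧ diskFun c r m z = s.height (.inl (attach p)) := by
  have h1 : z.1.1 0 = s.pathHeight (attach p) := by
    rw [s.pathHeight_attach]
    exact s.eq_pole_of_mem_of_mem (s.mem_region z) hk.1 hp
  refine ⟨?_, h1⟩
  have h2 := hk.2
  rw [h1, Set.mem_Icc, s.strictMono_pathHeight.le_iff_le, s.strictMono_pathHeight.le_iff_le,
    Fin.le_def, Fin.le_def, Fin.val_castSucc, Fin.val_succ] at h2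
  simp only [edgeSrc, edgeTgt, Sum.inl.injEq, Fin.ext_iff, Fin.val_castSucc, Fin.val_succ]
  omega

theorem exists_common (e e' : PendantEdge j₁ j₂) (z) (hne : e ≠ e') (hz : z ∈ s.edgeSet m e)
    (hz' : z ∈ s.edgeSet m e') : ∃ v, (v = edgeSrc e ∨ v = edgeTgt e) ∧
      (v = edgeSrc e' ∨ v = edgeTgt e') ∧ diskFun c r m z = s.height v := by
  rcases e with k | p <;> rcases e' with k' | p'
  · rcases lt_or_gt_of_ne (fun h : k = k' => hne (congrArg _ h)) with h | h
    · obtain ⟨h1, h2⟩ := s.exists_common_of_path h hz.2 hz'.2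
      exact ⟨edgeTgt (.inl k), Or.inr rfl, Or.inl (congrArg Sum.inl h1), h2⟩
    · obtain ⟨h1, h2⟩ := s.exists_common_of_path h hz'.2 hz.2
      exact ⟨edgeTgt (.inl k'), Or.inl (congrArg Sum.inl h1), Or.inr rfl, h2⟩
  · obtain ⟨h1, h2⟩ := s.exists_common_of_path_pendant hz hz'
    exact ⟨_, h1, mem_ends_pendant.2 (Or.inr rfl), h2⟩
  · obtain ⟨h1, h2⟩ := s.exists_common_of_path_pendant hz' hz
    exact ⟨_, mem_ends_pendant.2 (Or.inr rfl), h1, h2⟩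
  · have := s.eq_of_mem_Icc (s.Icc_lt_rt_subset _ (s.cutSet_subset _ hz))
      (s.Icc_lt_rt_subset _ (s.cutSet_subset _ hz'))
    exact absurd (congrArg Sum.inr (finSumFinEquiv.injective this)) hne

theorem mem_edgeSet_of_common (e e' : PendantEdge j₁ j₂) (v) (z : diskManifold c r m)
    (hv : v = edgeSrc e ∨ v = edgeTgt e) (hv' : v = edgeSrc e' ∨ v = edgeTgt e')
    (hz : diskFun c r m z = s.height v) (hze : z ∈ s.edgeSet m e) : z ∈ s.edgeSet m e' := by
  rcases e' with k' | p'
  · exact s.mem_edgeSet_of_eq_height hv' hz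
  · rcases mem_ends_pendant.1 hv' with rfl | rfl
    · rcases e with k | p
      · simp [edgeSrc, edgeTgt] at hv
      · rcases mem_ends_pendant.1 hv with h | h
        · rwa [Sum.inr.inj h]
        · simp at h
    -- This is where the cut set needs the entire line over the pole.
    · exact Or.inr (hz.trans (s.pathHeight_attach p'))

theorem mem_diskSingular_iff (z : diskManifold c r m) : z ∈ diskSingular c r m ↔
    (‖z.1.1‖ = 1 ∧ z.1.1 1 = 0) ∨
      ∃ j, circlePower c r j z.1.1 = 0 ∧ (z.1.1 1 = c j 1 ∨ ‖z.1.1‖ = 1) :=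
  (s.transversalAt (s.mem_region z)).isSingularPointOn_iff z.2

/-- Vertical poles of the unit circle give the ends of the path, poles and bases of the added
circles its inner vertices, and tips the pendant vertices. -/
theorem exists_vertex_of_mem_diskSingular (z : diskManifold c r m)
    (hz : z ∈ diskSingular c r m) : ∃ e v, (v = edgeSrc e ∨ v = edgeTgt e) ∧
      z ∈ s.edgeSet m e ∧ diskFun c r m z = s.height v := by
  have hpath : (∃ a, z.1.1 0 = s.pathHeight a) → ∃ e v, (v = edgeSrc e ∨ v = edgeTgt e) ∧
      z ∈ s.edgeSet m e ∧ diskFun c r m z = s.height v := by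
    rintro ⟨a, ha⟩
    obtain ⟨e, he⟩ := s.exists_edge_of_eq_pathHeight ha
    exact ⟨e, _, he⟩
  have hlohi : ∀ j, (z.1.1 0 = s.lo j ∨ z.1.1 0 = s.hi j) → ∃ a, z.1.1 0 = s.pathHeight a := by
    rintro j (h | h)
    · obtain ⟨a, ha⟩ := s.exists_pathHeight_lo j
      exact ⟨a, h.trans ha.symm⟩
    · obtain ⟨a, ha⟩ := s.exists_pathHeight_hi j
      exact ⟨a, h.trans ha.symm⟩
  have hxK := s.mem_region z
  rcases (s.mem_diskSingular_iff z).1 hz with ⟨h1, h2⟩ | ⟨j, hj, h | h⟩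
  · have h3 := norm_sq_eq_coords z.1.1
    rw [h1, h2] at h3
    have h4 : (z.1.1 0 - 1) * (z.1.1 0 + 1) = 0 := by linarith
    refine hpath ?_
    rcases mul_eq_zero.1 h4 with h5 | h5
    · exact ⟨Fin.last _, by rw [s.pathHeight_last rfl]; linarith⟩
    · exact ⟨0, by rw [s.pathHeight_zero rfl]; linarith⟩
  · rw [circlePower_eq_coords] at hj
    have := (s.cap j).eq_pole hxK.1 h hj
    exact hpath (hlohi j ((s.pole_eq j).imp this.trans this.trans))
  · rw [circlePower_eq_coords] at hj
    have hsq : z.1.1 0 ^ 2 + z.1.1 1 ^ 2 = 1 := by rw [← norm_sq_eq_coords, h, one_pow]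
    obtain ⟨hpos, htip | hbase⟩ := (s.cap j).eq_tip_or_base hsq hj
    · refine ⟨.inr (finSumFinEquiv.symm j), .inr (finSumFinEquiv.symm j),
        mem_ends_pendant.2 (Or.inl rfl), ?_, ?_⟩
      · simp only [edgeSet, Equiv.apply_symm_apply]
        have hmem : z.1.1 0 ∈ Set.Icc (s.lt j) (s.rt j) := htip ▸ s.tip_mem_lt_rt j
        exact Or.inl ⟨hmem, ((s.cap j).top hsq hpos.le hmem).1⟩
      · exact htip.trans (by simp [height])
    · refine hpath (hlohi j ?_)
      rcases (s.cap j).order with h' | h'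
      · exact Or.inr (hbase.trans h'.2.2.2.1.symm)
      · exact Or.inl (hbase.trans h'.2.2.2.1.symm)

theorem exists_singular_of_mem {x : EuclideanSpace ℝ (Fin 2)} (hx : x ∈ closedRegion c r)
    (h : (‖x‖ = 1 ∧ x 1 = 0) ∨ ∃ j, circlePower c r j x = 0 ∧ (x 1 = c j 1 ∨ ‖x‖ = 1)) :
    ∃ z ∈ diskSingular c r m, z.1.1 = x := by
  obtain ⟨z, hz, rfl⟩ := exists_mem_diskManifold (m := m) hx
  exact ⟨⟨z, hz⟩, (s.mem_diskSingular_iff ⟨z, hz⟩).2 h, rfl⟩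

theorem mem_closedRegion_of_power_eq_zero {j} {x : EuclideanSpace ℝ (Fin 2)}
    (hx : x 0 ^ 2 + x 1 ^ 2 ≤ 1) (hj : circlePower c r j x = 0) : x ∈ closedRegion c r := by
  refine ⟨hx, fun i => ?_⟩
  by_cases hij : j = i
  · subst hij
    exact hj.ge
  · exact (s.power_pos hx (s.outside_of_mem_Icc (s.mem_Icc_of_power_nonpos hx hj.le) hij)).le

/-- The intersection point of a circle and the unit circle with the given first coordinate. -/
theorem exists_intersection {j} {t : ℝ} (ht : t = s.tip j ∨ t = s.base j) :
    ∃ x : EuclideanSpace ℝ (Fin 2), x 0 = t ∧ 0 ≤ ε * x 1 ∧ ‖x‖ = 1 ∧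
      circlePower c r j x = 0 := by
  obtain ⟨y, hsq, hy, hQ⟩ := (s.cap j).exists_intersection s.eps_sq ht
  refine ⟨!₂[t, y], rfl, hy, ?_, ?_⟩
  · rw [← sq_eq_sq₀ (norm_nonneg _) zero_le_one, norm_sq_eq_coords, one_pow]
    exact hsq
  · rw [circlePower_eq_coords]
    exact hQ

theorem power_pole (j) : circlePower c r j !₂[s.pole j, c j 1] = 0 := by
  rw [circlePower_eq_coords]
  rcases (s.cap j).order with h | h <;> simp [h.2.1]

theorem exists_diskSingular_tip_base {j} {t : ℝ} (ht : t = s.tip j ∨ t = s.base j) :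
    ∃ z ∈ diskSingular c r m, z.1.1 0 = t ∧ 0 ≤ ε * z.1.1 1 ∧
      z.1.1 0 ^ 2 + z.1.1 1 ^ 2 = 1 := by
  obtain ⟨x, h1, h2, h3, h4⟩ := s.exists_intersection ht
  have hsq : x 0 ^ 2 + x 1 ^ 2 = 1 := by rw [← norm_sq_eq_coords, h3, one_pow]
  obtain ⟨z, hz, rfl⟩ := s.exists_singular_of_mem (m := m)
    (s.mem_closedRegion_of_power_eq_zero hsq.le h4) (Or.inr ⟨j, h4, Or.inr h3⟩)
  exact ⟨z, hz, h1, h2, hsq⟩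

theorem exists_diskSingular_pole (j) : ∃ z ∈ diskSingular c r m, z.1.1 0 = s.pole j := by
  obtain ⟨z, hz, h⟩ := s.exists_singular_of_mem (m := m) (s.mem_closedRegion_of_power_eq_zero
    (s.cap j).pole_inside.le (s.power_pole j)) (Or.inr ⟨j, s.power_pole j, Or.inl rfl⟩)
  exact ⟨z, hz, by rw [h]; rfl⟩

theorem exists_diskSingular_unit {t : ℝ} (ht : t = -1 ∨ t = 1) :
    ∃ z ∈ diskSingular c r m, z.1.1 0 = t := by
  have hsq : t ^ 2 = 1 := by rcases ht with rfl | rfl <;> norm_num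
  have hmem : !₂[t, 0] ∈ closedRegion c r := by
    have hle : (!₂[t, 0] : EuclideanSpace ℝ (Fin 2)) 0 ^ 2 +
      (!₂[t, 0] : EuclideanSpace ℝ (Fin 2)) 1 ^ 2 ≤ 1 := by simp [hsq]
    refine ⟨hle, fun j => s.power_nonneg hle ?_⟩
    rcases ht with rfl | rfl
    · exact Or.inl (s.cap j).neg_one_lt_lo.le
    · exact Or.inr (s.cap j).hi_lt_one.le
  obtain ⟨z, hz, h⟩ := s.exists_singular_of_mem (m := m) hmem (Or.inl ⟨by
    rw [← sq_eq_sq₀ (norm_nonneg _) zero_le_one, norm_sq_eq_coords]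
    simp [hsq], rfl⟩)
  exact ⟨z, hz, by rw [h]; rfl⟩

theorem exists_diskSingular (v : PendantVertex j₁ j₂) : ∃ z ∈ diskSingular c r m,
    ∃ e, (v = edgeSrc e ∨ v = edgeTgt e) ∧ z ∈ s.edgeSet m e ∧
      diskFun c r m z = s.height v := by
  rcases v with a | p
  · suffices h : ∃ z ∈ diskSingular c r m, z.1.1 0 = s.pathHeight a by
      obtain ⟨z, hz, h⟩ := h
      exact ⟨z, hz, s.exists_edge_of_eq_pathHeight h⟩
    rcases s.pathHeight_cases a with h | h | ⟨j, h⟩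
    · rw [h]
      exact s.exists_diskSingular_unit (Or.inl rfl)
    · rw [h]
      exact s.exists_diskSingular_unit (Or.inr rfl)
    · have : s.pathHeight a = s.pole j ∨ s.pathHeight a = s.base j := by
        rcases (s.cap j).order with h' | h'
        · exact h.imp (fun e => e.trans h'.2.2.1) fun e => e.trans h'.2.2.2.1
        · exact h.symm.imp (fun e => e.trans h'.2.2.1) fun e => e.trans h'.2.2.2.1
      rcases this with h | h
      · rw [h]
        exact s.exists_diskSingular_pole j
      · obtain ⟨z, hz, h', -⟩ := s.exists_diskSingular_tip_base (m := m) (Or.inr h)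
        exact ⟨z, hz, h'⟩
  · obtain ⟨z, hz, h1, h2, h3⟩ := s.exists_diskSingular_tip_base (m := m)
      (j := finSumFinEquiv p) (Or.inl rfl)
    have hmem : z.1.1 0 ∈ Set.Icc (s.lt (finSumFinEquiv p)) (s.rt (finSumFinEquiv p)) :=
      h1 ▸ s.tip_mem_lt_rt _
    exact ⟨z, hz, .inr p, mem_ends_pendant.2 (Or.inl rfl),
      Or.inl ⟨hmem, ((s.cap _).top h3 h2 hmem).1⟩, h1⟩

theorem reebGraphIso (hm : 0 < m 1) :
    ReebGraphIso (diskFun c r m) (diskSingular c r m) (pendantGraph j₁ j₂) := by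
  have := isCompact_iff_compactSpace.1 (isCompact_diskManifold c r m)
  exact reebGraphIso_of_cover continuous_diskFun s.height_src_lt_tgt
    (fun a b => pendantGraph_adj_iff) exists_edge edge_ext (s.edgeSet m) s.isClosed_edgeSet
    s.exists_mem_edgeSet s.diskFun_mem_Icc (s.isPreconnected_edgeLevel hm)
    s.exists_mem_edgeLevel s.exists_common s.mem_edgeSet_of_common
    s.exists_vertex_of_mem_diskSingular s.exists_diskSingular

end CapSystem

/-! ### From admissible families to sorted systems of caps -/

section Admissible

variable {n : ℕ} {c : Fin n → EuclideanSpace ℝ (Fin 2)} {r : Fin n → ℝ}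
  {L : Set (EuclideanSpace ℝ (Fin 2))} {ε : ℝ}

theorem exists_sign_of_arc (hL : L = upperArc ∨ L = lowerArc) :
    ∃ ε : ℝ, (ε = 1 ∨ ε = -1) ∧ L = {x | ‖x‖ = 1 ∧ 0 < ε * x 1} := by
  rcases hL with rfl | rfl
  · exact ⟨1, Or.inl rfl, by simp [upperArc]⟩
  · exact ⟨-1, Or.inr rfl, by simp [lowerArc]⟩

theorem closure_diskRegion_subset (hr : ∀ j, 0 < r j) :
    closure (diskRegion c r) ⊆ closedRegion c r := by
  have h : closure (diskRegion c r) ⊆ {x | ‖x‖ ≤ 1 ∧ ∀ j, r j ≤ ‖x - c j‖} := by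
    refine closure_minimal (fun x hx => ⟨hx.1.le, fun j => (hx.2 j).le⟩) ?_
    simp only [Set.ofPred_and, Set.ofPred_forall]
    exact (isClosed_le continuous_norm continuous_const).inter (isClosed_iInter fun j =>
      isClosed_le continuous_const (continuous_id.sub continuous_const).norm)
  refine h.trans fun x hx => ⟨?_, fun j => ?_⟩
  · rw [← norm_sq_eq_coords]
    exact pow_le_one₀ (norm_nonneg x) hx.1
  · exact sub_nonneg.2 (pow_le_pow_left₀ (hr j).le (hx.2 j) 2)

theorem mem_sphere_iff_circlePower (hr : ∀ j, 0 < r j) {j : Fin n}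
    {x : EuclideanSpace ℝ (Fin 2)} :
    x ∈ Metric.sphere (c j) (r j) ↔ circlePower c r j x = 0 := by
  rw [mem_sphere_iff_norm, circlePower, sub_eq_zero, sq_eq_sq₀ (norm_nonneg _) (hr j).le]

theorem mem_unit_sphere_iff {x : EuclideanSpace ℝ (Fin 2)} :
    x ∈ Metric.sphere (0 : EuclideanSpace ℝ (Fin 2)) 1 ↔ x 0 ^ 2 + x 1 ^ 2 = 1 := by
  rw [mem_sphere_zero_iff_norm, ← norm_sq_eq_coords, ← sq_eq_sq₀ (norm_nonneg _) zero_le_one,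
    one_pow]

theorem coords_of_mem_verticalPoles {j : Fin n} {v : EuclideanSpace ℝ (Fin 2)}
    (hv : v ∈ verticalPoles (c j) (r j)) : (v 0 = c j 0 - r j ∨ v 0 = c j 0 + r j) ∧
      v 1 = c j 1 ∧ circlePower c r j v = 0 := by
  rw [circlePower_eq_coords]
  rcases hv with rfl | rfl <;> simp

namespace IsAdmissible

variable (h : IsAdmissible L c r)

include h

theorem isCap (hL : L = {x | ‖x‖ = 1 ∧ 0 < ε * x 1}) (hε : ε = 1 ∨ ε = -1) (j : Fin n) :
    IsCap |c j 0| (ε * c j 1) (r j) := by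
  have hsub := closure_diskRegion_subset (c := c) h.radius_pos
  have hr := h.radius_pos j
  have hc := h.center_mem j
  rw [hL] at hc
  have hε2 : ε ^ 2 = 1 := by rcases hε with rfl | rfl <;> norm_num
  have hnorm : c j 0 ^ 2 + c j 1 ^ 2 = 1 := by rw [← norm_sq_eq_coords, hc.1, one_pow]
  refine ⟨abs_pos.2 (h.center_ne_pole j), hc.2, ?_, hr, ?_, ?_⟩
  · rw [sq_abs, mul_pow, hε2, one_mul, hnorm]
  · obtain ⟨v, ⟨hv, hvcl⟩, -⟩ := h.pole_unique j
    have h1 := (hsub hvcl).1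
    have h2 := h.pole_notMem j v hv hvcl
    rw [mem_unit_sphere_iff] at h2
    have h3 := lt_of_le_of_ne h1 h2
    obtain ⟨h4, h5, -⟩ := coords_of_mem_verticalPoles hv
    rw [h5] at h3
    rcases h4 with h4 | h4 <;> rw [h4] at h3
    -- Being strictly inside the unit disk, the pole satisfies `(c j 0 - r j) ^ 2 + c j 1 ^ 2 < 1`;
    -- expand and divide by `r j`.
    · have : r j < 2 * c j 0 := by nlinarith
      exact this.trans_le (by linarith [le_abs_self (c j 0)])
    · have : r j < 2 * -c j 0 := by nlinarith
      exact this.trans_le (by linarith [neg_le_abs (c j 0)])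
  -- The power at `(d, 0)` is nonnegative since this point is in the closed region. It is nonzero,
  -- since otherwise `(d, 0)` would itself be a marked point.
  · have key : ∀ d : ℝ, d ^ 2 = 1 → !₂[d, 0] ∈ verticalPoles 0 1 → d * c j 0 < capCos (r j) := by
      intro d hd hmem
      have h1 := h.unit_poles_mem hmem
      have h2 := (hsub h1).2 j
      have h3 : circlePower c r j !₂[d, 0] = 2 * (capCos (r j) - d * c j 0) := by
        rw [circlePower_eq_coords]
        simp only [Matrix.cons_val_zero, Matrix.cons_val_one]
        unfold capCos
        linear_combination hd + hnorm
      have h4 : circlePower c r j !₂[d, 0] ≠ 0 := fun h0 =>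
        h.unit_poles_ne _ hmem j _ ⟨h1, Or.inr ⟨mem_unit_sphere_iff.2 (by simp [hd]),
          (mem_sphere_iff_circlePower h.radius_pos).2 h0⟩⟩ rfl
      have := lt_of_le_of_ne h2 h4.symm
      linarith
    have h1 := key 1 (by norm_num) (by simp [verticalPoles])
    have h2 := key (-1) (by norm_num) (by simp [verticalPoles])
    exact abs_lt.2 ⟨by linarith, by linarith⟩

/-- The ends of a projection are abscissae of marked points, namely of the pole and the base, so the
separation of marked points separates the intervals. -/
theorem hi_lt_lo_or (hε2 : ε ^ 2 = 1) {i j : Fin n} (hij : i ≠ j)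
    {lo hi lt rt pole tip base : Fin n → ℝ}
    (hcap : ∀ j, CapGeometry ε (c j 0) (c j 1) (r j) (lo j) (hi j) (lt j) (rt j) (pole j) (tip j)
      (base j)) : hi i < lo j ∨ hi j < lo i := by
  have hsub := closure_diskRegion_subset (c := c) h.radius_pos
  have hpole : ∀ j, ∃ a ∈ markedPoints c r j, a 0 = pole j := by
    intro j
    obtain ⟨v, ⟨hv, hvcl⟩, -⟩ := h.pole_unique j
    obtain ⟨-, h1, h2⟩ := coords_of_mem_verticalPoles hv
    rw [circlePower_eq_coords] at h2
    exact ⟨v, ⟨hvcl, Or.inl hv⟩, (hcap j).eq_pole (hsub hvcl).1 h1 h2⟩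
  have hbase : ∀ j, ∃ a ∈ markedPoints c r j, a 0 = base j := by
    intro j
    obtain ⟨y, h1, -, h2⟩ := (hcap j).exists_intersection hε2 (Or.inr rfl)
    have hmem : !₂[base j, y] ∈ Metric.sphere 0 1 ∩ Metric.sphere (c j) (r j) :=
      ⟨mem_unit_sphere_iff.2 h1, (mem_sphere_iff_circlePower h.radius_pos).2 (by
        rw [circlePower_eq_coords]; exact h2)⟩
    exact ⟨_, ⟨h.inter_subset j hmem, Or.inr hmem⟩, rfl⟩
  have hlo : ∀ j, ∃ a ∈ markedPoints c r j, a 0 = lo j := by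
    intro j
    rcases (hcap j).order with h | h
    · rw [h.2.2.1]; exact hpole j
    · rw [h.2.2.2.1]; exact hbase j
  have hhi : ∀ j, ∃ a ∈ markedPoints c r j, a 0 = hi j := by
    intro j
    rcases (hcap j).order with h | h
    · rw [h.2.2.2.1]; exact hbase j
    · rw [h.2.2.1]; exact hpole j
  obtain ⟨a, ha, ha'⟩ := hlo i
  obtain ⟨b, hb, hb'⟩ := hhi i
  obtain ⟨d, hd, hd'⟩ := hlo j
  obtain ⟨e, he, he'⟩ := hhi j
  rw [← ha', ← hb', ← hd', ← he']
  exact (h.marked_separated i j hij).imp (fun h => h b hb d hd) fun h => h a ha e he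

theorem comp_perm (σ : Equiv.Perm (Fin n)) : IsAdmissible L (c ∘ σ) (r ∘ σ) := by
  have hD : diskRegion (c ∘ σ) (r ∘ σ) = diskRegion c r := by
    ext x
    exact and_congr_right fun _ => σ.forall_congr_left.trans (by simp)
  have hM : ∀ j, markedPoints (c ∘ σ) (r ∘ σ) j = markedPoints c r (σ j) := by
    intro j
    unfold markedPoints
    rw [hD]
    rfl
  constructor
  case radius_pos => exact fun j => h.radius_pos _
  case center_mem => exact fun j => h.center_mem _
  case center_ne_pole => exact fun j => h.center_ne_pole _
  case disjoint => exact fun i j hij => h.disjoint _ _ (σ.injective.ne hij)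
  case inter_ncard => exact fun j => h.inter_ncard _
  case inter_subset => rw [hD]; exact fun j => h.inter_subset _
  case pole_unique => rw [hD]; exact fun j => h.pole_unique _
  case pole_notMem => rw [hD]; exact fun j => h.pole_notMem _
  case marked_injOn => intro j; rw [hM]; exact h.marked_injOn _
  case marked_separated =>
    intro i j hij
    rw [hM, hM]
    exact h.marked_separated _ _ (σ.injective.ne hij)
  case unit_poles_mem => rw [hD]; exact h.unit_poles_mem
  case unit_poles_ne => intro v hv j; rw [hM]; exact h.unit_poles_ne v hv _

end IsAdmissible

theorem exists_neg_iff_lt {g : Fin n → ℝ} (hg : Monotone g) :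
    ∃ k ≤ n, ∀ j, g j < 0 ↔ (j : ℕ) < k := by
  classical
  have hex : ∃ k : ℕ, ∀ j : Fin n, k ≤ j → 0 ≤ g j := ⟨n, fun j hj => absurd j.2 (not_lt.2 hj)⟩
  refine ⟨Nat.find hex, Nat.find_min' hex fun j hj => absurd j.2 (not_lt.2 hj), fun j => ?_⟩
  constructor
  · intro hj
    by_contra! hcon
    exact absurd hj (not_lt.2 (Nat.find_spec hex j hcon))
  · intro hj
    have := Nat.find_min hex hj
    push Not at this
    obtain ⟨i, hij, hi⟩ := this
    exact (hg (Fin.le_def.2 hij)).trans_lt hi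

theorem IsAdmissible.exists_capSystem (h : IsAdmissible L c r)
    (hL : L = {x | ‖x‖ = 1 ∧ 0 < ε * x 1}) (hε : ε = 1 ∨ ε = -1) :
    ∃ (j₁ j₂ : ℕ) (hn : n = j₁ + j₂) (σ : Equiv.Perm (Fin n)),
      Nonempty (CapSystem ε j₁ j₂ ((c ∘ σ) ∘ Fin.cast hn.symm) ((r ∘ σ) ∘ Fin.cast hn.symm)) := by
  have hε2 : ε ^ 2 = 1 := by rcases hε with rfl | rfl <;> norm_num
  let σ := Tuple.sort fun j => c j 0
  have hmono : Monotone fun j => c (σ j) 0 := Tuple.monotone_sort fun j => c j 0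
  have h' := h.comp_perm σ
  obtain ⟨k, hk, hneg⟩ := exists_neg_iff_lt hmono
  obtain ⟨l, rfl⟩ := Nat.exists_eq_add_of_le hk
  choose lo hi lt rt pole tip base hcap using fun j =>
    exists_capGeometry hε (h'.center_ne_pole j) (h'.isCap hL hε j)
  refine ⟨k, l, rfl, σ, ⟨?_⟩⟩
  refine ⟨lo, hi, lt, rt, pole, tip, base, hcap, hε, fun j => ?_, h'.radius_pos, ?_, hneg⟩
  · have := h'.center_mem j
    rw [hL] at this
    exact this.2
  · intro i j hij
    -- Each centre lies over its own interval, so sorting the centres sorts the intervals.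
    refine (h'.hi_lt_lo_or hε2 hij.ne hcap).resolve_right fun hlt => ?_
    have h1 := (hcap i).lo_lt_center
    have h2 := (hcap j).center_lt_hi
    have h3 : (c ∘ σ) i 0 ≤ (c ∘ σ) j 0 := hmono hij.le
    linarith

theorem diskEq_comp_perm (σ : Equiv.Perm (Fin n)) (m : Fin 2 → ℕ) :
    diskEq (c ∘ σ) (r ∘ σ) m = diskEq c r m := by
  funext z
  refine funext (Fin.forall_fin_two.2 ⟨?_, ?_⟩)
  · rw [diskEq_zero, diskEq_zero]
  · rw [diskEq_one, diskEq_one, ← Equiv.prod_comp σ fun j => circlePower c r j z.1]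
    rfl

theorem reebGraphIso_of_diskEq_eq {c' : Fin n → EuclideanSpace ℝ (Fin 2)} {r' : Fin n → ℝ}
    {m : Fin 2 → ℕ} (heq : diskEq c r m = diskEq c' r' m) {V : Type*} [Fintype V]
    [DecidableEq V] {G : SimpleGraph V}
    (h : ReebGraphIso (diskFun c r m) (diskSingular c r m) G) :
    ReebGraphIso (diskFun c' r' m) (diskSingular c' r' m) G := by
  -- The domain depends on the equations, so the equality is substituted for arbitrary maps `F` and
  -- `F'`.
  have key : ∀ F F' : MomentAmbient 2 m → Fin 2 → ℝ, F = F' →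
      ReebGraphIso (fun z : {z | F z = 0} => firstCoord m z)
        {z | IsSingularPointOn F (firstCoord m) z} G →
      ReebGraphIso (fun z : {z | F' z = 0} => firstCoord m z)
        {z | IsSingularPointOn F' (firstCoord m) z} G := by
    rintro F _ rfl
    exact id
  exact key _ _ heq h

theorem IsAdmissible.exists_reebGraphIso (h : IsAdmissible L c r)
    (hL : L = {x | ‖x‖ = 1 ∧ 0 < ε * x 1}) (hε : ε = 1 ∨ ε = -1) {m : Fin 2 → ℕ}
    (hm : 0 < m 1) : IsNonsingularZeroSet (diskEq c r m) ∧ ∃ j₁ j₂ : ℕ, j₁ + j₂ = n ∧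
      ReebGraphIso (diskFun c r m) (diskSingular c r m) (pendantGraph j₁ j₂) := by
  obtain ⟨j₁, j₂, rfl, σ, ⟨s⟩⟩ := h.exists_capSystem hL hε
  have heq : diskEq ((c ∘ σ) ∘ Fin.cast rfl) ((r ∘ σ) ∘ Fin.cast rfl) m = diskEq c r m :=
    diskEq_comp_perm σ m
  exact ⟨heq ▸ s.isNonsingularZeroSet, j₁, j₂, rfl,
    reebGraphIso_of_diskEq_eq heq (s.reebGraphIso hm)⟩

end Admissible

/-! ### Construction of admissible families -/

section Construction

open Filter Topology

theorem eventually_quadratic_pos {g₀ g₁ : ℝ} (h : 0 < g₀ ∨ g₀ = 0 ∧ 0 < g₁) (g₂ : ℝ) :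
    ∀ᶠ t in 𝓝[>] (0 : ℝ), 0 < g₀ + g₁ * t + g₂ * t ^ 2 := by
  rcases h with h | ⟨rfl, h⟩
  · have : Tendsto (fun t : ℝ => g₀ + g₁ * t + g₂ * t ^ 2) (𝓝[>] 0) (𝓝 g₀) := by
      have : Continuous fun t : ℝ => g₀ + g₁ * t + g₂ * t ^ 2 := by fun_prop
      simpa using (this.tendsto 0).mono_left nhdsWithin_le_nhds
    exact this.eventually_const_lt h
  · have : Tendsto (fun t : ℝ => g₁ + g₂ * t) (𝓝[>] 0) (𝓝 g₁) := by
      have : Continuous fun t : ℝ => g₁ + g₂ * t := by fun_prop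
      simpa using (this.tendsto 0).mono_left nhdsWithin_le_nhds
    filter_upwards [this.eventually_const_lt h, self_mem_nhdsWithin] with t ht ht0
    have := mul_pos (show 0 < t from ht0) ht
    nlinarith

/-- The points `x + t • v` lie in the open region for small `t > 0`: each defining inequality is a
quadratic in `t` whose constant term is positive, or zero with positive linear term. -/
theorem mem_closure_diskRegion {n : ℕ} {c : Fin n → EuclideanSpace ℝ (Fin 2)} {r : Fin n → ℝ}
    (hr : ∀ j, 0 < r j) {x v : EuclideanSpace ℝ (Fin 2)}
    (hx : x 0 ^ 2 + x 1 ^ 2 < 1 ∨ x 0 ^ 2 + x 1 ^ 2 = 1 ∧ x 0 * v 0 + x 1 * v 1 < 0)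
    (hc : ∀ j, 0 < circlePower c r j x ∨ circlePower c r j x = 0 ∧
      0 < (x 0 - c j 0) * v 0 + (x 1 - c j 1) * v 1) : x ∈ closure (diskRegion c r) := by
  have hlim : Tendsto (fun t : ℝ => x + t • v) (𝓝[>] 0) (𝓝 x) := by
    have : Continuous fun t : ℝ => x + t • v := by fun_prop
    simpa using (this.tendsto 0).mono_left nhdsWithin_le_nhds
  refine mem_closure_of_tendsto hlim ?_
  have h1 := eventually_quadratic_pos (g₀ := 1 - (x 0 ^ 2 + x 1 ^ 2))
    (g₁ := -2 * (x 0 * v 0 + x 1 * v 1))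
    (hx.imp (fun h => by linarith) fun h => ⟨by linarith [h.1], by linarith [h.2]⟩)
    (-(v 0 ^ 2 + v 1 ^ 2))
  have h2 : ∀ j, ∀ᶠ t in 𝓝[>] (0 : ℝ), 0 < circlePower c r j x +
      2 * ((x 0 - c j 0) * v 0 + (x 1 - c j 1) * v 1) * t + (v 0 ^ 2 + v 1 ^ 2) * t ^ 2 :=
    fun j => eventually_quadratic_pos
      ((hc j).imp id fun h => ⟨h.1, by linarith [h.2]⟩) _
  filter_upwards [h1, eventually_all.2 h2] with t ht1 ht2
  constructor
  · rw [← sq_lt_one_iff₀ (norm_nonneg _), norm_sq_eq_coords]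
    simp only [PiLp.add_apply, PiLp.smul_apply, smul_eq_mul]
    linarith
  · intro j
    rw [← sq_lt_sq₀ (hr j).le (norm_nonneg _), ← sub_pos]
    change 0 < circlePower c r j (x + t • v)
    have := ht2 j
    rw [circlePower_eq_coords] at this ⊢
    simp only [PiLp.add_apply, PiLp.smul_apply, smul_eq_mul]
    linarith

theorem eq_of_coords {x y : EuclideanSpace ℝ (Fin 2)} (h0 : x 0 = y 0) (h1 : x 1 = y 1) :
    x = y := by
  ext i
  fin_cases i
  · exact h0
  · exact h1

namespace CapSystem

variable {ε : ℝ} {j₁ j₂ : ℕ} {c : Fin (j₁ + j₂) → EuclideanSpace ℝ (Fin 2)}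
  {r : Fin (j₁ + j₂) → ℝ} (s : CapSystem ε j₁ j₂ c r)

include s

theorem eq_of_fst_eq {x y : EuclideanSpace ℝ (Fin 2)} (hx : x 0 ^ 2 + x 1 ^ 2 = 1)
    (hy : y 0 ^ 2 + y 1 ^ 2 = 1) (hx' : 0 ≤ ε * x 1) (hy' : 0 ≤ ε * y 1) (h0 : x 0 = y 0) :
    x = y := by
  refine eq_of_coords h0 ?_
  have h1 : (ε * x 1) ^ 2 = (ε * y 1) ^ 2 := by
    rw [mul_pow, mul_pow, s.eps_sq]
    rw [h0] at hx
    linarith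
  have h2 := (sq_eq_sq₀ hx' hy').1 h1
  rcases s.sign with e | e <;> rw [e] at h2 <;> linarith

theorem mem_closure_of_circlePower_eq_zero (hc : ∀ j, ‖c j‖ = 1) (hr : ∀ j, r j < 1) {j}
    {x : EuclideanSpace ℝ (Fin 2)} (hx : x 0 ^ 2 + x 1 ^ 2 ≤ 1) (hj : circlePower c r j x = 0)
    (hx' : x 0 ^ 2 + x 1 ^ 2 = 1 ∨ x 1 = c j 1) : x ∈ closure (diskRegion c r) := by
  have hcj := norm_sq_eq_coords (c j)
  rw [hc j] at hcj
  have hrj := s.radius_pos j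
  have hrj' := hr j
  have hj' := hj
  rw [circlePower_eq_coords] at hj'
  -- The direction `-c j` leads into the unit disk, because points of the unit circle at distance `r
  -- j < 1` from `c j` have positive inner product with it. It also leads out of the `j`-th circle,
  -- both at corners and at the pole.
  refine mem_closure_diskRegion s.radius_pos (v := -c j) ?_ fun i => ?_
  · refine (lt_or_eq_of_le hx).imp_right fun h => ⟨h, ?_⟩
    simp only [PiLp.neg_apply]
    nlinarith
  · by_cases hij : j = i
    · subst hij
      refine Or.inr ⟨hj, ?_⟩
      simp only [PiLp.neg_apply]
      rcases hx' with h | h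
      · nlinarith
      · rw [h] at hx hj' ⊢
        have hp := (s.cap j).eq_pole hx rfl hj'
        rw [hp]
        rcases (s.cap j).order with h' | h' <;> rw [h'.2.1] <;> nlinarith [h'.1]
    · exact Or.inl (s.power_pos hx
        (s.outside_of_mem_Icc (s.mem_Icc_of_power_nonpos hx hj.le) hij))

theorem tip_ne_base (j) : s.tip j ≠ s.base j := by
  have h1 := (s.cap j).lo_lt_tip
  have h2 := (s.cap j).tip_lt_hi
  rcases (s.cap j).order with h | h
  · rw [← h.2.2.2.1]; exact h2.ne
  · rw [← h.2.2.2.1]; exact h1.ne'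

theorem pole_ne_tip (j) : s.pole j ≠ s.tip j := by
  have h1 := (s.cap j).lo_lt_tip
  have h2 := (s.cap j).tip_lt_hi
  rcases (s.cap j).order with h | h
  · rw [← h.2.2.1]; exact h1.ne
  · rw [← h.2.2.1]; exact h2.ne'

theorem pole_ne_base (j) : s.pole j ≠ s.base j := by
  have h1 := s.lo_lt_hi j
  rcases (s.cap j).order with h | h
  · rw [← h.2.2.1, ← h.2.2.2.1]; exact h1.ne
  · rw [← h.2.2.1, ← h.2.2.2.1]; exact h1.ne'

theorem coords_of_mem_inter {j} {x : EuclideanSpace ℝ (Fin 2)}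
    (hx : x ∈ Metric.sphere 0 1 ∩ Metric.sphere (c j) (r j)) :
    x 0 ^ 2 + x 1 ^ 2 = 1 ∧ circlePower c r j x = 0 ∧ 0 < ε * x 1 ∧
      (x 0 = s.tip j ∨ x 0 = s.base j) := by
  have h1 := mem_unit_sphere_iff.1 hx.1
  have h2 := (mem_sphere_iff_circlePower s.radius_pos).1 hx.2
  refine ⟨h1, h2, ?_⟩
  rw [circlePower_eq_coords] at h2
  exact (s.cap j).eq_tip_or_base h1 h2

theorem coords_of_mem_markedPoints {j} {x : EuclideanSpace ℝ (Fin 2)}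
    (hx : x ∈ markedPoints c r j) : (x 0 = s.pole j ∧ x 1 = c j 1) ∨
      (x 0 ^ 2 + x 1 ^ 2 = 1 ∧ 0 < ε * x 1 ∧ (x 0 = s.tip j ∨ x 0 = s.base j)) := by
  rcases hx.2 with h | h
  · obtain ⟨-, h1, h2⟩ := coords_of_mem_verticalPoles h
    rw [circlePower_eq_coords] at h2
    exact Or.inl ⟨(s.cap j).eq_pole (closure_diskRegion_subset s.radius_pos hx.1).1 h1 h2, h1⟩
  · obtain ⟨h1, -, h2⟩ := s.coords_of_mem_inter h
    exact Or.inr ⟨h1, h2⟩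

theorem fst_mem_Icc_of_mem_markedPoints {j} {x : EuclideanSpace ℝ (Fin 2)}
    (hx : x ∈ markedPoints c r j) : x 0 ∈ Set.Icc (s.lo j) (s.hi j) := by
  have hle := (closure_diskRegion_subset s.radius_pos hx.1).1
  refine s.mem_Icc_of_power_nonpos hle (le_of_eq ?_)
  rcases hx.2 with h | h
  · exact (coords_of_mem_verticalPoles h).2.2
  · exact (s.coords_of_mem_inter h).2.1

theorem inter_ncard (j) :
    (Metric.sphere 0 1 ∩ Metric.sphere (c j) (r j)).ncard = 2 := by
  obtain ⟨a, ha1, ha2, ha3, ha4⟩ := s.exists_intersection (j := j) (Or.inl rfl)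
  obtain ⟨b, hb1, hb2, hb3, hb4⟩ := s.exists_intersection (j := j) (Or.inr rfl)
  have ha : a ∈ Metric.sphere 0 1 ∩ Metric.sphere (c j) (r j) :=
    ⟨mem_sphere_zero_iff_norm.2 ha3, (mem_sphere_iff_circlePower s.radius_pos).2 ha4⟩
  have hb : b ∈ Metric.sphere 0 1 ∩ Metric.sphere (c j) (r j) :=
    ⟨mem_sphere_zero_iff_norm.2 hb3, (mem_sphere_iff_circlePower s.radius_pos).2 hb4⟩
  have hab : a ≠ b := fun h => s.tip_ne_base j (by rw [← ha1, ← hb1, h])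
  refine Eq.trans (congrArg Set.ncard ?_) (Set.ncard_pair hab)
  ext x
  constructor
  · intro hx
    obtain ⟨h1, -, h2, h3⟩ := s.coords_of_mem_inter hx
    rcases h3 with h3 | h3
    · exact Or.inl (s.eq_of_fst_eq h1 (mem_unit_sphere_iff.1 ha.1) h2.le ha2 (h3.trans ha1.symm))
    · exact Or.inr (s.eq_of_fst_eq h1 (mem_unit_sphere_iff.1 hb.1) h2.le hb2 (h3.trans hb1.symm))
  · rintro (rfl | rfl)
    · exact ha
    · exact hb

theorem pole_mem_verticalPoles (j) : !₂[s.pole j, c j 1] ∈ verticalPoles (c j) (r j) := by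
  rcases (s.cap j).order with h | h <;> rw [h.2.1] <;> simp [verticalPoles]

theorem isAdmissible (hc : ∀ j, ‖c j‖ = 1) (hr : ∀ j, r j < 1)
    (hdisj : ∀ i j, i ≠ j → Disjoint (Metric.sphere (c i) (r i)) (Metric.sphere (c j) (r j))) :
    IsAdmissible {x | ‖x‖ = 1 ∧ 0 < ε * x 1} c r := by
  have hsub := closure_diskRegion_subset (c := c) s.radius_pos
  have hpole : ∀ j, ∀ v ∈ verticalPoles (c j) (r j), v ∈ closure (diskRegion c r) →
      v = !₂[s.pole j, c j 1] := by
    intro j v hv hvcl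
    obtain ⟨-, h1, h2⟩ := coords_of_mem_verticalPoles hv
    rw [circlePower_eq_coords] at h2
    exact eq_of_coords ((s.cap j).eq_pole (hsub hvcl).1 h1 h2) h1
  constructor
  case radius_pos => exact s.radius_pos
  case center_mem => exact fun j => ⟨hc j, s.center_pos j⟩
  case center_ne_pole =>
    intro j
    rcases (s.cap j).order with h | h
    · exact h.1.ne'
    · exact h.1.ne
  case disjoint => exact hdisj
  case inter_ncard => exact s.inter_ncard
  case inter_subset =>
    intro j x hx
    obtain ⟨h1, h2, -⟩ := s.coords_of_mem_inter hx
    exact s.mem_closure_of_circlePower_eq_zero hc hr h1.le h2 (Or.inl h1)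
  case pole_unique =>
    intro j
    refine ⟨!₂[s.pole j, c j 1], ⟨s.pole_mem_verticalPoles j, ?_⟩,
      fun v hv => hpole j v hv.1 hv.2⟩
    exact s.mem_closure_of_circlePower_eq_zero hc hr (s.cap j).pole_inside.le (s.power_pole j) (Or.inr rfl)
  case pole_notMem =>
    intro j v hv hvcl hmem
    rw [hpole j v hv hvcl, mem_unit_sphere_iff] at hmem
    exact (s.cap j).pole_inside.ne hmem
  case marked_injOn =>
    intro j a ha b hb hab
    have hab : a 0 = b 0 := hab
    rcases s.coords_of_mem_markedPoints ha with ⟨ha0, ha1⟩ | ⟨ha1, ha2, ha3⟩ <;>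
      rcases s.coords_of_mem_markedPoints hb with ⟨hb0, hb1⟩ | ⟨hb1, hb2, hb3⟩
    · exact eq_of_coords hab (ha1.trans hb1.symm)
    · rcases hb3 with hb3 | hb3
      · exact absurd (by rw [← ha0, ← hb3, hab]) (s.pole_ne_tip j)
      · exact absurd (by rw [← ha0, ← hb3, hab]) (s.pole_ne_base j)
    · rcases ha3 with ha3 | ha3
      · exact absurd (by rw [← hb0, ← ha3, hab]) (s.pole_ne_tip j)
      · exact absurd (by rw [← hb0, ← ha3, hab]) (s.pole_ne_base j)
    · exact s.eq_of_fst_eq ha1 hb1 ha2.le hb2.le hab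
  case marked_separated =>
    intro i j hij
    rcases lt_or_gt_of_ne hij with h | h
    · refine Or.inl fun a ha b hb => ?_
      linarith [s.hi_lt_lo i j h, (s.fst_mem_Icc_of_mem_markedPoints ha).2,
        (s.fst_mem_Icc_of_mem_markedPoints hb).1]
    · refine Or.inr fun a ha b hb => ?_
      linarith [s.hi_lt_lo j i h, (s.fst_mem_Icc_of_mem_markedPoints ha).1,
        (s.fst_mem_Icc_of_mem_markedPoints hb).2]
  case unit_poles_mem =>
    have key : ∀ d : ℝ, d = -1 ∨ d = 1 → !₂[d, 0] ∈ closure (diskRegion c r) := by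
      intro d hd
      have hd2 : d ^ 2 = 1 := by rcases hd with rfl | rfl <;> norm_num
      have hsq : (!₂[d, 0] : EuclideanSpace ℝ (Fin 2)) 0 ^ 2 +
        (!₂[d, 0] : EuclideanSpace ℝ (Fin 2)) 1 ^ 2 = 1 := by simp [hd2]
      refine mem_closure_diskRegion s.radius_pos (v := !₂[-d, 0]) (Or.inr ⟨hsq, ?_⟩)
        fun j => Or.inl (s.power_pos hsq.le ?_)
      · simp only [Matrix.cons_val_zero, Matrix.cons_val_one]
        nlinarith
      · rcases hd with rfl | rfl
        · exact Or.inl (s.cap j).neg_one_lt_lo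
        · exact Or.inr (s.cap j).hi_lt_one
    rintro v (rfl | rfl)
    · simpa using key (-1) (Or.inl rfl)
    · simpa using key 1 (Or.inr rfl)
  case unit_poles_ne =>
    intro v hv j a ha hva
    have hmem := s.fst_mem_Icc_of_mem_markedPoints ha
    have h1 := (s.cap j).neg_one_lt_lo
    have h2 := (s.cap j).hi_lt_one
    rcases hv with rfl | rfl
    · have : a 0 = -1 := by simpa using hva.symm
      linarith [hmem.1]
    · have : a 0 = 1 := by simpa using hva.symm
      linarith [hmem.2]

end CapSystem

/-- Both ends of the projection are abscissae of points on the circle. -/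
theorem CapGeometry.sub_le_lo_and_hi_le_add {ε c₀ c₁ r lo hi lt rt pole tip base : ℝ}
    (h : CapGeometry ε c₀ c₁ r lo hi lt rt pole tip base) (hε : ε ^ 2 = 1) (hr : 0 < r) :
    c₀ - r ≤ lo ∧ hi ≤ c₀ + r := by
  obtain ⟨y, -, -, hy⟩ := h.exists_intersection hε (Or.inr rfl)
  have h1 : |base - c₀| ≤ r := abs_le_of_sq_le_sq (by nlinarith [sq_nonneg (y - c₁)]) hr.le
  rw [abs_le] at h1
  rcases h.order with h | h <;> constructor <;> linarith [h.2.1, h.2.2.1, h.2.2.2.1]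

/-- The first coordinates of the centres of a family of small circles, `j₁` of them negative. -/
noncomputable def spacedCenter (j₁ j₂ : ℕ) (j : Fin (j₁ + j₂)) : ℝ :=
  ((j : ℝ) - j₁ + 1 / 2) / ((j₁ + j₂ : ℕ) + 1)

theorem exists_admissible (j₁ j₂ : ℕ) {ε : ℝ} (hε : ε = 1 ∨ ε = -1) :
    ∃ (c : Fin (j₁ + j₂) → EuclideanSpace ℝ (Fin 2)) (r : Fin (j₁ + j₂) → ℝ),
      IsAdmissible {x | ‖x‖ = 1 ∧ 0 < ε * x 1} c r ∧ Nonempty (CapSystem ε j₁ j₂ c r) := by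
  have hε2 : ε ^ 2 = 1 := by rcases hε with rfl | rfl <;> norm_num
  set q := spacedCenter j₁ j₂ with hq
  set d : ℝ := 1 / ((j₁ + j₂ : ℕ) + 1) with hd
  have hN : (0 : ℝ) < (j₁ + j₂ : ℕ) + 1 := by positivity
  have hd0 : 0 < d := by positivity
  have hd1 : d ≤ 1 := by
    rw [hd, div_le_one hN]
    linarith [(Nat.cast_nonneg (j₁ + j₂) : (0 : ℝ) ≤ _)]
  have hqd : ∀ j, q j = ((j : ℝ) - j₁ + 1 / 2) * d := fun j => by
    rw [hq, spacedCenter, hd]; ring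
  have hNd : ((j₁ : ℝ) + j₂ + 1) * d = 1 := by
    rw [hd]
    push_cast
    field_simp
  have hneg : ∀ j : Fin (j₁ + j₂), (j : ℕ) < j₁ → q j ≤ -(d / 2) ∧ -(1 - d) ≤ q j := by
    intro j hj
    have h1 : (j : ℝ) + 1 ≤ j₁ := by exact_mod_cast hj
    have h2 : (0 : ℝ) ≤ j := Nat.cast_nonneg _
    have h3 : (0 : ℝ) ≤ j₂ := Nat.cast_nonneg _
    rw [hqd]
    constructor <;> nlinarith
  have hpos : ∀ j : Fin (j₁ + j₂), ¬ (j : ℕ) < j₁ → d / 2 ≤ q j ∧ q j ≤ 1 - d := by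
    intro j hj
    have h1 : (j₁ : ℝ) ≤ j := by exact_mod_cast not_lt.1 hj
    have h2 : (j : ℝ) + 1 ≤ j₁ + j₂ := by exact_mod_cast j.2
    have h3 : (0 : ℝ) ≤ j₁ := Nat.cast_nonneg _
    rw [hqd]
    constructor <;> nlinarith
  have habs : ∀ j, d / 2 ≤ |q j| ∧ |q j| ≤ 1 - d := by
    intro j
    by_cases hj : (j : ℕ) < j₁
    · obtain ⟨h1, h2⟩ := hneg j hj
      rw [abs_of_nonpos (by linarith)]
      constructor <;> linarith
    · obtain ⟨h1, h2⟩ := hpos j hj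
      rw [abs_of_nonneg (by linarith)]
      exact ⟨h1, h2⟩
  have hsep : ∀ i j, i < j → q i + d ≤ q j := by
    intro i j hij
    have : (i : ℝ) + 1 ≤ j := by exact_mod_cast hij
    rw [hqd, hqd]
    nlinarith
  have hq1 : ∀ j, 0 < 1 - q j ^ 2 := by
    intro j
    rw [← sq_abs]
    nlinarith [(habs j).1, (habs j).2]
  have hsqrt : ∀ j, √(1 - q j ^ 2) ^ 2 = 1 - q j ^ 2 := fun j => Real.sq_sqrt (hq1 j).le
  have hεε : ∀ y, ε * (ε * y) = y := fun y => by rw [← mul_assoc, ← pow_two, hε2, one_mul]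
  let c : Fin (j₁ + j₂) → EuclideanSpace ℝ (Fin 2) := fun j => !₂[q j, ε * √(1 - q j ^ 2)]
  -- The abscissae `q j` have spacing at least `d` and satisfy `d / 2 ≤ |q j| ≤ 1 - d`, the shift by
  -- `1 / 2` keeping them off 0. Hence `d / 4 < 2 * |q j|`, the horizontal shadows of radius `d / 4`
  -- are disjoint, and `1 - d < 1 - d ^ 2 / 32 = capCos (d / 4)`.
  let r : Fin (j₁ + j₂) → ℝ := fun _ => d / 4
  have hr0 : ∀ j, 0 < r j := fun j => by positivity
  have hcap : ∀ j, IsCap |c j 0| (ε * c j 1) (r j) := by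
    intro j
    change IsCap |q j| (ε * (ε * √(1 - q j ^ 2))) (d / 4)
    rw [hεε]
    have h1 := (habs j).1
    have h2 := (habs j).2
    refine ⟨by linarith, Real.sqrt_pos.2 (hq1 j), ?_, hr0 j, by linarith, ?_⟩
    · rw [sq_abs, hsqrt]
      ring
    · unfold capCos
      nlinarith
  have hc0 : ∀ j, c j 0 ≠ 0 := fun j => abs_pos.1 (by
    have := (habs j).1
    change 0 < |q j|
    linarith)
  choose lo hi lt rt pole tip base hgeom using fun j => exists_capGeometry hε (hc0 j) (hcap j)
  have hs : CapSystem ε j₁ j₂ c r := by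
    refine ⟨lo, hi, lt, rt, pole, tip, base, hgeom, hε, fun j => (hcap j).b_pos, hr0, ?_, ?_⟩
    · intro i j hij
      have h1 := ((hgeom i).sub_le_lo_and_hi_le_add hε2 (hr0 i)).2
      have h2 := ((hgeom j).sub_le_lo_and_hi_le_add hε2 (hr0 j)).1
      have h3 := hsep i j hij
      change hi i ≤ q i + d / 4 at h1
      change q j - d / 4 ≤ lo j at h2
      linarith
    · intro j
      change q j < 0 ↔ _
      by_cases hj : (j : ℕ) < j₁
      · exact iff_of_true (by linarith [(hneg j hj).1]) hj
      · exact iff_of_false (by linarith [(hpos j hj).1]) hj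
  refine ⟨c, r, hs.isAdmissible ?_ (fun j => by change d / 4 < 1; linarith) ?_, ⟨hs⟩⟩
  · intro j
    rw [← sq_eq_sq₀ (norm_nonneg _) zero_le_one, norm_sq_eq_coords]
    change q j ^ 2 + (ε * √(1 - q j ^ 2)) ^ 2 = 1 ^ 2
    rw [mul_pow, hε2, hsqrt]
    ring
  · intro i j hij
    rw [Set.disjoint_left]
    intro x hxi hxj
    rw [mem_sphere_iff_circlePower hr0, circlePower_eq_coords] at hxi hxj
    have key : ∀ k, (x 0 - c k 0) ^ 2 + (x 1 - c k 1) ^ 2 - r k ^ 2 = 0 →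
        |x 0 - q k| ≤ d / 4 := fun k hk =>
      abs_le_of_sq_le_sq (b := d / 4) (by
        change (x 0 - q k) ^ 2 + (x 1 - c k 1) ^ 2 - (d / 4) ^ 2 = 0 at hk
        nlinarith [sq_nonneg (x 1 - c k 1)]) (by positivity)
    have h1 := abs_le.1 (key i hxi)
    have h2 := abs_le.1 (key j hxj)
    rcases lt_or_gt_of_ne hij with h | h
    · linarith [hsep i j h]
    · linarith [hsep j i h]

end Construction

/-! ### The main theorem -/

theorem theorem6 (m : Fin 2 → ℕ) (hm : 0 < m 1)
    (L : Set (EuclideanSpace ℝ (Fin 2))) (hL : L = upperArc ∨ L = lowerArc) (n : ℕ) :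
    (∀ (c : Fin n → EuclideanSpace ℝ (Fin 2)) (r : Fin n → ℝ), IsAdmissible L c r →
      IsCompact (diskManifold c r m) ∧
      IsNonsingularZeroSet (diskEq c r m) ∧
      (reebMk (diskFun c r m) '' diskSingular c r m).ncard = 3 * n + 2 ∧
      ∃ j₁ j₂ : ℕ, j₁ + j₂ = n ∧
        ReebGraphIso (diskFun c r m) (diskSingular c r m) (pendantGraph j₁ j₂)) ∧
    (∀ j₁ j₂ : ℕ, j₁ + j₂ = n →
      ∃ (c : Fin n → EuclideanSpace ℝ (Fin 2)) (r : Fin n → ℝ), IsAdmissible L c r ∧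
        ReebGraphIso (diskFun c r m) (diskSingular c r m) (pendantGraph j₁ j₂)) := by

  obtain ⟨ε, hε, rfl⟩ := exists_sign_of_arc hL
  constructor
  · intro c r h
    obtain ⟨hns, j₁, j₂, hn, hG⟩ := h.exists_reebGraphIso rfl hε hm
    refine ⟨isCompact_diskManifold c r m, hns, ?_, j₁, j₂, hn, hG⟩
    rw [hG.ncard_vertices]
    simp only [Fintype.card_sum, Fintype.card_fin]
    omega
  · rintro j₁ j₂ rfl
    obtain ⟨c, r, h, ⟨s⟩⟩ := exists_admissible j₁ j₂ hε
    exact ⟨c, r, h, s.reebGraphIso hm⟩
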